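/- **Conventions.** Matroids have finite ground sets and groups are abelian. A matroid $M$ on $E$ is $\mathrm{GF}(q)$-representable if there is a matrix over $\mathrm{GF}(q)$ with columns indexed by $E$ such that the bases of $M$ are exactly the sets whose columns form a basis of the column space. For positive integers $\alpha,k$, a matroid $M$ is *weakly $(\alpha,k)$-base orderable* if for any two bases $B_1,B_2$ with $|B_1\setminus B_2|\ge\alpha$ there exist pairwise disjoint nonempty sets $X_1,\dots,X_k\subseteq B_1\setminus B_2$ and pairwise disjoint nonempty sets $Y_1,\dots,Y_k\subseteq B_2\setminus B_1$ such that $\bigl(B_1\setminus\bigcup_{i\in Z}X_i\bigr)\cup\bigcup_{i\in Z}Y_i$ is a basis for every $Z\subseteq\{1,\dots,k\}$. For a labeling $\psi\colon E\to\Gamma$ into a group and $S\subseteq E$ put $\psi(S)=\sum_{x\in S}\psi(x)$; for a finite set $F\subseteq\Gamma$, a basis $B$ is *$F$-avoiding* if $\psi(B)\notin F$, and it is a *zero basis* if $\psi(B)=0$. **Theorem.** 1. There is a function $f$ that assigns a positive integer $f(q,k)$ to all $q,k$ such that, for every prime power $q$ and every $\mathrm{GF}(q)$-representable matroid $M$: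 (a) $M$ is weakly $(f(q,k),k)$-base orderable for every positive integer $k$; (b) for every labeling $\psi\colon E(M)\to\Gamma$ into a group and every finite $F\subseteq\Gamma$, if $M$ has an $F$-avoiding basis, then for every basis $B$ there is an $F$-avoiding basis $B^*$ with $|B\setminus B^*|\le f(q,|F|+1)-1$. 2. Let $q$ be a prime power. Consider $\mathrm{GF}(q)$-representable matroids given by an independence oracle, on a ground set of $n$ elements labeled by a group that is given by an operation oracle, where oracle calls have unit cost. (a) For every fixed $m$ there are an algorithm and a polynomial $p$ such that, for every set $F$ of $m$ forbidden labels, the algorithm finds an $F$-avoiding basis or correctly reports that none exists in at most $p(n)$ steps. (b) There are an algorithm, a computable function $g$ and a constant $d$ such that, for every finite group $\Gamma$, the algorithm finds a zero basis or correctly reports that none exists in at most $g(|\Gamma|)\,(n+1)^d$ steps. -/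

import Mathlib

open Set Function

universe u v

noncomputable section

namespace WeakOrder

/-! ### Matroids -/

/-- `M` is representable over the field `K`: its elements index the columns of a matrix `A` over `K`,
and a set of elements is a basis of `M` exactly when the corresponding columns form a basis
of the space spanned by all columns. Columns outside of the ground set play no role. -/
def Representable (K : Type) [Field K] {α : Type u} (M : Matroid α) : Prop :=
  ∃ (m : ℕ) (A : Matrix (Fin m) α K), ∀ B : Set α, M.IsBase B ↔
    B ⊆ M.E ∧ LinearIndepOn K A.col B ∧
      Submodule.span K (A.col '' B) = Submodule.span K (A.col '' M.E)

/-- `M` is representable over the field with `q` elements (which is unique up to isomorphism). -/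
def RepresentableGF (q : ℕ) {α : Type u} (M : Matroid α) : Prop :=
  ∃ (K : Type) (_ : Field K), Finite K ∧ Nat.card K = q ∧ Representable K M

/-- The `k`-exchange property of the ordered pair `(B₁, B₂)`. -/
def KExchange {α : Type u} (M : Matroid α) (k : ℕ) (B₁ B₂ : Set α) : Prop :=
  ∃ X Y : Fin k → Set α,
    (∀ i, (X i).Nonempty ∧ X i ⊆ B₁ \ B₂) ∧
    (∀ i, (Y i).Nonempty ∧ Y i ⊆ B₂ \ B₁) ∧
    Pairwise (Disjoint on X) ∧ Pairwise (Disjoint on Y) ∧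
    ∀ Z : Set (Fin k), M.IsBase ((B₁ \ ⋃ i ∈ Z, X i) ∪ ⋃ i ∈ Z, Y i)

/-- `M` is weakly `(a, k)`-base orderable. -/
def WeaklyBaseOrderable {α : Type u} (M : Matroid α) (a k : ℕ) : Prop :=
  ∀ B₁ B₂ : Set α, M.IsBase B₁ → M.IsBase B₂ → (a : ℕ∞) ≤ (B₁ \ B₂).encard →
    KExchange M k B₁ B₂

/-- The label `ψ(S)`, the sum of the labels of the elements of the (finite) set `S`. -/
def label {α : Type u} {Γ : Type v} [AddCommGroup Γ] (ψ : α → Γ) (S : Set α) : Γ :=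
  ∑ᶠ x ∈ S, ψ x

/-! ### The model of computation

Algorithms are while-programs over binary trees, whose leaves are `nil`, an element of the matroid
or an element of the group. A program is finite and does not depend on the matroid or on the group:
it can only combine and compare the atoms which it is given, and it reaches the matroid, the labeling
and the group only through oracle calls. All elementary operations and all oracle calls have
unit cost (trees being stored as pointers to pairs). -/

/-- The values that programs work with. -/
inductive Tree (α : Type u) (Γ : Type v) : Type (max u v)
  | nil : Tree α Γ
  | elt : α → Tree α Γ
  | grp : Γ → Tree α Γ
  | cons : Tree α Γ → Tree α Γ → Tree α Γ

namespace Tree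

variable {α : Type u} {Γ : Type v}

/-- A list as a right comb that ends in `nil`. -/
def ofList : List (Tree α Γ) → Tree α Γ
  | [] => nil
  | t :: ts => cons t (ofList ts)

/-- A list of elements of the matroid. -/
def ofElts (L : List α) : Tree α Γ := ofList (L.map elt)

/-- A list of elements of the group. -/
def ofGrps (L : List Γ) : Tree α Γ := ofList (L.map grp)

/-- The set of elements that a list contains. -/
def eltSet : Tree α Γ → Set α
  | cons (elt x) t => insert x (eltSet t)
  | cons _ t => eltSet t
  | _ => ∅

/-- First component of a pair, `nil` for all other trees. -/
def hd : Tree α Γ → Tree α Γ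
  | cons a _ => a
  | _ => nil

/-- Second component of a pair, `nil` for all other trees. -/
def tl : Tree α Γ → Tree α Γ
  | cons _ b => b
  | _ => nil

/-- Truth values: `nil` is false and a pair is true. -/
def ofProp (p : Prop) : Tree α Γ :=
  open Classical in if p then cons nil nil else nil

/-- Equality of two leaves. Pairs are not compared in a single step. -/
def SameLeaf : Tree α Γ → Tree α Γ → Prop
  | nil, nil => True
  | elt x, elt y => x = y
  | grp g, grp h => g = h
  | _, _ => False

end Tree

/-- Expressions, over variables that are numbered by the natural numbers. -/
inductive Expr : Type
  | var : ℕ → Expr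
  | nil : Expr
  | cons : Expr → Expr → Expr
  | hd : Expr → Expr
  | tl : Expr → Expr
  | eq : Expr → Expr → Expr
  /-- The independence oracle, called with a list of elements. -/
  | indep : Expr → Expr
  /-- The labeling, called with an element. -/
  | lab : Expr → Expr
  /-- The neutral element of the group. -/
  | zero : Expr
  /-- The addition oracle of the group. -/
  | add : Expr → Expr → Expr
  /-- The inversion oracle of the group. -/
  | neg : Expr → Expr

/-- The number of operations and oracle calls in an expression. -/
def Expr.cost : Expr → ℕ
  | .var _ => 1
  | .nil => 1
  | .cons a b => a.cost + b.cost + 1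
  | .hd a => a.cost + 1
  | .tl a => a.cost + 1
  | .eq a b => a.cost + b.cost + 1
  | .indep a => a.cost + 1
  | .lab a => a.cost + 1
  | .zero => 1
  | .add a b => a.cost + b.cost + 1
  | .neg a => a.cost + 1

section Semantics

variable {α : Type u} {Γ : Type v} [AddCommGroup Γ] (M : Matroid α) (ψ : α → Γ)

/-- The label of a leaf that is an element, `nil` for all other trees. -/
def labOp : Tree α Γ → Tree α Γ
  | .elt x => .grp (ψ x)
  | _ => .nil

/-- The sum of two leaves that are group elements, `nil` for all other trees. -/
def addOp : Tree α Γ → Tree α Γ → Tree α Γ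
  | .grp g, .grp h => .grp (g + h)
  | _, _ => .nil

/-- The inverse of a leaf that is a group element, `nil` for all other trees. -/
def negOp : Tree α Γ → Tree α Γ
  | .grp g => .grp (-g)
  | _ => .nil

/-- The value of an expression, given the values of the variables. -/
def Expr.eval (s : ℕ → Tree α Γ) : Expr → Tree α Γ
  | .var i => s i
  | .nil => .nil
  | .cons a b => .cons (a.eval s) (b.eval s)
  | .hd a => (a.eval s).hd
  | .tl a => (a.eval s).tl
  | .eq a b => Tree.ofProp ((a.eval s).SameLeaf (b.eval s))
  | .indep a => Tree.ofProp (M.Indep (a.eval s).eltSet)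
  | .lab a => labOp ψ (a.eval s)
  | .zero => .grp 0
  | .add a b => addOp (a.eval s) (b.eval s)
  | .neg a => negOp (a.eval s)

end Semantics

/-- Programs. -/
inductive Prog : Type
  | skip : Prog
  | assign : ℕ → Expr → Prog
  | seq : Prog → Prog → Prog
  | ite : Expr → Prog → Prog → Prog
  | while : Expr → Prog → Prog

/-- `Run M ψ c s t s'`: started with the values `s` of the variables, the program `c` halts
after exactly `t` steps with the values `s'`. -/
inductive Run {α : Type u} {Γ : Type v} [AddCommGroup Γ] (M : Matroid α) (ψ : α → Γ) :
    Prog → (ℕ → Tree α Γ) → ℕ → (ℕ → Tree α Γ) → Prop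
  | skip (s) : Run M ψ .skip s 1 s
  | assign (i e s) :
      Run M ψ (.assign i e) s (e.cost + 1) (Function.update s i (e.eval M ψ s))
  | seq {c d s s' s'' t t'} (h : Run M ψ c s t s') (h' : Run M ψ d s' t' s'') :
      Run M ψ (.seq c d) s (t + t') s''
  | ite_true {e c d s s' t} (he : e.eval M ψ s ≠ .nil) (h : Run M ψ c s t s') :
      Run M ψ (.ite e c d) s (e.cost + 1 + t) s'
  | ite_false {e c d s s' t} (he : e.eval M ψ s = .nil) (h : Run M ψ d s t s') :
      Run M ψ (.ite e c d) s (e.cost + 1 + t) s'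
  | while_true {e c s s' s'' t t'} (he : e.eval M ψ s ≠ .nil) (h : Run M ψ c s t s')
      (h' : Run M ψ (.while e c) s' t' s'') :
      Run M ψ (.while e c) s (e.cost + 1 + t + t') s''
  | while_false {e c s} (he : e.eval M ψ s = .nil) :
      Run M ψ (.while e c) s (e.cost + 1) s

/-- The program `c` halts on input `x` after exactly `t` steps with output `y`: the input is the
initial value of variable `0`, all other variables are `nil` at the start, and the output is
the final value of variable `0`. -/
def Computes {α : Type u} {Γ : Type v} [AddCommGroup Γ] (M : Matroid α) (ψ : α → Γ)
    (c : Prog) (x : Tree α Γ) (t : ℕ) (y : Tree α Γ) : Prop :=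
  ∃ s, Run M ψ c (Function.update (fun _ => .nil) 0 x) t s ∧ s 0 = y

/-- `y` is a correct answer to the task of finding a basis of `M` with property `P`: it is `nil`
and there is no such basis, or it is a pair of `nil` and a list of the elements of such a basis. -/
def IsAnswer {α : Type u} {Γ : Type v} (M : Matroid α) (P : Set α → Prop) (y : Tree α Γ) : Prop :=
  (y = .nil ∧ ∀ B, M.IsBase B → ¬ P B) ∨
  ∃ L : List α, L.Nodup ∧ y = .cons .nil (.ofElts L) ∧ M.IsBase {x | x ∈ L} ∧ P {x | x ∈ L}

/-- For matroids that are representable over the field with `q` elements and for sets `F` of `m`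
forbidden labels, there is an algorithm that is polynomial in the size of the ground set and finds
an `F`-avoiding basis or reports that there is none. The input consists of
lists of the elements of the ground set and of `F`. -/
def AvoidingBasisPolyTime (q m : ℕ) : Prop :=
  ∃ (c : Prog) (p : Polynomial ℕ),
    ∀ (α : Type u) (Γ : Type v) [AddCommGroup Γ] (M : Matroid α) (ψ : α → Γ)
      (LE : List α) (LF : List Γ),
      RepresentableGF q M → LE.Nodup → {x | x ∈ LE} = M.E → LF.Nodup → LF.length = m →
      ∃ t y, Computes M ψ c (.cons (.ofElts LE) (.ofGrps LF)) t y ∧ t ≤ p.eval LE.length ∧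
        IsAnswer M (fun B => label ψ B ∉ LF) y

/-- For matroids that are representable over the field with `q` elements and for finite groups `Γ`,
there is a fixed-parameter algorithm, parameterized by `|Γ|`, that finds a basis with label zero or
reports that there is none. The input is a list of the elements of the ground set. -/
def ZeroBasisFPT (q : ℕ) : Prop :=
  ∃ (c : Prog) (g : ℕ → ℕ) (d : ℕ), Computable g ∧
    ∀ (α : Type u) (Γ : Type v) [AddCommGroup Γ] [Finite Γ] (M : Matroid α) (ψ : α → Γ)
      (LE : List α),
      RepresentableGF q M → LE.Nodup → {x | x ∈ LE} = M.E →
      ∃ t y, Computes M ψ c (.ofElts LE) t y ∧ t ≤ g (Nat.card Γ) * (LE.length + 1) ^ d ∧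
        IsAnswer M (fun B => label ψ B = 0) y

end WeakOrder

end

open Set Function

noncomputable section

namespace WeakOrder

/-! ### Ladders in matrices of large rank -/

section Ladder

variable {K : Type*} [Field K] {m n : Type*} [Fintype n]

/-! Exchange. Write the elements of `B₂` in the basis `B₁`. The coefficients with rows `B₁ \ B₂` and
columns `B₂ \ B₁` form a square nonsingular matrix, so its rank is |B₁ \ B₂|. Trading a set X of
rows for a set Y of columns of the same size gives a basis when the submatrix on X × Y is
nonsingular. A Ramsey argument driven by rank (`exists_ladder`, `exists_constant_ladder`) finds in
every matrix of large rank over a finite field a long square submatrix that is constant below, on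
and above the diagonal, with the first two constants distinct. From it `exists_nonsingularBlocks`
cuts k blocks all of whose unions are nonsingular; this is the k-exchange property
(`weaklyBaseOrderable_of_representable`).

Proximity. Take an F-avoiding basis as near to B as possible. If it were far from B, then |F| + 1
freely combinable exchanges towards B would exist. A pigeonhole on prefix sums of their label
changes (`exists_subsum_notMem`) selects a nonempty subset of them that keeps the label outside F
and brings the basis nearer to B.

Algorithms. For |F| = m the radius r depends on q and m only, so it suffices to search the
polynomially many candidates within r replacements of one greedy basis. For zero bases the labels
lie in the subgroup H that they generate, and a zero basis is one that avoids H \ {0}; the radius is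
then bounded in terms of |Γ|. Enumerating bases would cost n to the power of that radius, so
multisets of labels are enumerated instead, and their number is bounded in terms of |Γ|. Rado's
condition decides whether an independent set realizes a multiset, and deleting elements while the
condition survives ends in such a set (`indep_of_minimal_radoCond`). The programs are assembled from
blocks whose values and costs are verified together. -/

theorem rank_add_le [Finite m] (A B : Matrix m n K) : (A + B).rank ≤ A.rank + B.rank := by
  classical
  unfold Matrix.rank
  rw [Matrix.mulVecLin_add]
  exact (Submodule.finrank_mono (LinearMap.range_add_le _ _)).trans
    (Submodule.finrank_add_le_finrank_add_finrank _ _)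

theorem rank_sum_le [Finite m] {ι : Type*} (s : Finset ι) (A : ι → Matrix m n K) :
    (∑ i ∈ s, A i).rank ≤ ∑ i ∈ s, (A i).rank := by
  classical
  induction s using Finset.induction_on with
  | empty => simp
  | insert a s ha ih =>
    rw [Finset.sum_insert ha, Finset.sum_insert ha]
    exact (rank_add_le _ _).trans (by gcongr)

open Classical in
/-- The matrix that agrees with `N` on `R × C` and vanishes elsewhere. -/
def mask (N : Matrix m n K) (R : Set m) (C : Set n) : Matrix m n K :=
  Matrix.of fun i j => if i ∈ R ∧ j ∈ C then N i j else 0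

theorem mask_univ {m n : Type*} (N : Matrix m n K) : mask N univ univ = N := by
  ext i j; simp [mask]

theorem exists_rank_le_of_sum [Finite m] [Fintype K] (A : Matrix m n K) (B : K → Matrix m n K)
    (h : A = ∑ v, B v) (t : ℕ) (ht : Fintype.card K * t ≤ A.rank) : ∃ v, t ≤ (B v).rank := by
  by_contra! hlt
  have h1 : A.rank ≤ ∑ v, (B v).rank := h ▸ rank_sum_le _ _
  have h2 : ∑ v, (B v).rank < ∑ _v : K, t :=
    Finset.sum_lt_sum_of_nonempty Finset.univ_nonempty fun v _ => hlt v
  simp at h2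
  omega

/-- Splitting the rows by their entry in column `j` writes the masked matrix as a sum of q pieces.
Rank is subadditive, so some piece keeps a 1/q share of it. -/
theorem exists_rank_le_rows [Finite m] [Fintype K] (N : Matrix m n K) (R : Set m) (C : Set n)
    (j : n) (t : ℕ) (ht : Fintype.card K * t ≤ (mask N R C).rank) :
    ∃ v, t ≤ (mask N {i ∈ R | N i j = v} C).rank := by
  classical
  refine exists_rank_le_of_sum _ (fun v => mask N {i ∈ R | N i j = v} C) ?_ t ht
  ext i k
  rw [Matrix.sum_apply, Finset.sum_eq_single (N i j)]
  · simp [mask]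
  · intro b _ hb
    simp [mask, hb.symm]
  · simp

theorem exists_rank_le_cols [Finite m] [Fintype K] (N : Matrix m n K) (R : Set m) (C : Set n)
    (i : m) (t : ℕ) (ht : Fintype.card K * t ≤ (mask N R C).rank) :
    ∃ v, t ≤ (mask N R {j ∈ C | N i j = v}).rank := by
  classical
  refine exists_rank_le_of_sum _ (fun v => mask N R {j ∈ C | N i j = v}) ?_ t ht
  ext k j
  rw [Matrix.sum_apply, Finset.sum_eq_single (N i j)]
  · simp [mask]
  · intro b _ hb
    simp [mask, hb.symm]
  · simp

/-- If all columns in `C` were constant on `R`, the masked matrix would be an outer product of two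
vectors, of rank at most one. -/
theorem exists_nonconstant_col [Finite m] (N : Matrix m n K) (R : Set m) (C : Set n)
    (h : 2 ≤ (mask N R C).rank) : ∃ j ∈ C, ∀ v, ∃ r ∈ R, N r j ≠ v := by
  classical
  by_contra! hc
  choose! w hw using hc
  have : mask N R C = Matrix.vecMulVec (fun i => if i ∈ R then (1 : K) else 0)
      (fun j => if j ∈ C then w j else 0) := by
    ext i j
    by_cases hi : i ∈ R <;> by_cases hj : j ∈ C <;> simp [mask, Matrix.vecMulVec_apply, hi, hj]
    exact hw j hj i hi
  have h1 := Matrix.rank_vecMulVec_le (fun i => if i ∈ R then (1 : K) else 0)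
      (fun j => if j ∈ C then w j else 0)
  rw [← this] at h1
  omega

/-- Each rung splits the rows by a column and then the columns by a row, which costs a factor q² of
the rank. The leading factor 2 guarantees a nonconstant column in every round. -/
theorem exists_ladder [Finite m] [Fintype K] (N : Matrix m n K) (L : ℕ) :
    ∀ (R : Set m) (C : Set n), 2 * Fintype.card K ^ (2 * L) ≤ (mask N R C).rank →
    ∃ (r : Fin L → m) (c : Fin L → n) (d e b : Fin L → K),
      (∀ i, r i ∈ R ∧ c i ∈ C) ∧ (∀ i, N (r i) (c i) = e i ∧ e i ≠ d i) ∧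
      ∀ i j, i < j → N (r j) (c i) = d i ∧ N (r i) (c j) = b i := by
  induction L with
  | zero => intro R C _; exact ⟨Fin.elim0, Fin.elim0, Fin.elim0, Fin.elim0, Fin.elim0, by simp⟩
  | succ L ih =>
    intro R C h
    have hq : 0 < Fintype.card K := Fintype.card_pos
    obtain ⟨j, hj, hjv⟩ := exists_nonconstant_col N R C
      (le_trans (Nat.le_mul_of_pos_right 2 (Nat.pow_pos hq)) h)
    obtain ⟨d0, hd0⟩ := exists_rank_le_rows N R C j
      (2 * Fintype.card K ^ (2 * L + 1)) (le_trans (le_of_eq (by ring)) h)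
    -- The pivot row lies in `R` but outside the class just kept; hence its entry in column `j`
    -- differs from the entries `d0` below it.
    obtain ⟨r0, hr0, hrd⟩ := hjv d0
    obtain ⟨b0, hb0⟩ := exists_rank_le_cols N {i ∈ R | N i j = d0} C r0
      (2 * Fintype.card K ^ (2 * L)) (le_trans (le_of_eq (by ring)) hd0)
    obtain ⟨r, c, d, e, b, h1, h2, h3⟩ := ih _ _ hb0
    refine ⟨Fin.cons r0 r, Fin.cons j c, Fin.cons d0 d, Fin.cons (N r0 j) e, Fin.cons b0 b,
      ?_, ?_, ?_⟩
    · intro i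
      refine Fin.cases ⟨hr0, hj⟩ (fun i => ?_) i
      exact ⟨(h1 i).1.1, (h1 i).2.1⟩
    · intro i
      exact Fin.cases ⟨rfl, hrd⟩ (fun i => h2 i) i
    · intro i k
      refine Fin.cases ?_ (fun i => ?_) i <;> refine Fin.cases ?_ (fun k => ?_) k
      · simp
      · intro _
        exact ⟨(h1 k).1.2, (h1 k).2.2⟩
      · simp
      · intro hik
        exact h3 i k (Fin.succ_lt_succ_iff.1 hik)

/-- A large ladder contains one with constant entries below, on and above the diagonal. -/
theorem exists_constant_ladder [Finite m] [Fintype K] (N : Matrix m n K) (s : ℕ)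
    (h : 2 * Fintype.card K ^ (2 * (Fintype.card K ^ 3 * s)) ≤ N.rank) :
    ∃ (r : Fin s → m) (c : Fin s → n) (d e b : K), e ≠ d ∧ Injective r ∧ Injective c ∧
      (∀ i, N (r i) (c i) = e) ∧ ∀ i j, i < j → N (r j) (c i) = d ∧ N (r i) (c j) = b := by
  classical
  obtain ⟨r, c, d, e, b, -, h2, h3⟩ :=
    exists_ladder N (Fintype.card K ^ 3 * s) univ univ (by rwa [mask_univ])
  obtain ⟨⟨d', e', b'⟩, -, hy⟩ := Finset.exists_le_card_fiber_of_mul_le_card_of_maps_to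
    (s := (Finset.univ : Finset (Fin (Fintype.card K ^ 3 * s))))
    (t := (Finset.univ : Finset (K × K × K))) (f := fun i => (d i, e i, b i)) (n := s)
    (by simp) Finset.univ_nonempty (by
      simp only [Finset.card_univ, Fintype.card_prod, Fintype.card_fin]
      exact le_of_eq (by ring))
  set T := Finset.univ.filter fun i => (d i, e i, b i) = (d', e', b') with hT
  have hmem : ∀ i, Finset.orderEmbOfCardLe T hy i ∈ T := Finset.orderEmbOfCardLe_mem T hy
  set o := Finset.orderEmbOfCardLe T hy with ho
  have hv : ∀ i, d (o i) = d' ∧ e (o i) = e' ∧ b (o i) = b' := by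
    intro i
    have := hmem i
    simpa [hT] using this
  have hlow : ∀ i j, i < j → N (r (o j)) (c (o i)) = d' := fun i j hij => by
    rw [(h3 _ _ (o.strictMono hij)).1, (hv i).1]
  have hdiag : ∀ i, N (r (o i)) (c (o i)) = e' := fun i => by rw [(h2 _).1, (hv i).2.1]
  -- An empty ladder supplies no entry to witness `e ≠ d`, so arbitrary constants are used.
  by_cases hs : s = 0
  · subst hs
    exact ⟨Fin.elim0, Fin.elim0, 0, 1, 0, one_ne_zero, fun i => i.elim0, fun i => i.elim0,
      fun i => i.elim0, fun i => i.elim0⟩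
  have hne : e' ≠ d' := by
    have := (h2 (o ⟨0, by omega⟩)).2
    rwa [(hv _).1, (hv _).2.1] at this
  -- A repeated row or column would identify a diagonal entry with an entry below the diagonal,
  -- against `e' ≠ d'`.
  refine ⟨r ∘ o, c ∘ o, d', e', b', hne, ?_, ?_, hdiag, fun i j hij => ⟨hlow i j hij, ?_⟩⟩
  · intro i j hij
    by_contra hc
    rcases lt_or_gt_of_ne hc with hlt | hlt
    · have := hlow i j hlt
      rw [show r (o j) = r (o i) from hij.symm, hdiag] at this
      exact hne this
    · have := hlow j i hlt
      rw [show r (o i) = r (o j) from hij, hdiag] at this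
      exact hne this
  · intro i j hij
    by_contra hc
    rcases lt_or_gt_of_ne hc with hlt | hlt
    · have := hlow i j hlt
      rw [show c (o i) = c (o j) from hij, hdiag] at this
      exact hne this
    · have := hlow j i hlt
      rw [show c (o j) = c (o i) from hij.symm, hdiag] at this
      exact hne this
  · exact (h3 _ _ (o.strictMono hij)).2.trans (hv i).2.2

/-! ### Blocks whose unions are all nonsingular. -/

/-- `ρ` and `κ` select rows and columns of `N` in blocks indexed by `π`, such that the square
submatrix of every union of blocks is nonsingular. -/
def NonsingularBlocks {m n : Type*} (N : Matrix m n K) (k : ℕ) {P : Type} [Fintype P]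
    (ρ : P → m) (κ : P → n) (π : P → Fin k) : Prop :=
  ∀ (Z : Set (Fin k)) (x : P → K), (∀ p, π p ∉ Z → x p = 0) →
    (∀ p, π p ∈ Z → ∑ p', x p' * N (ρ p) (κ p') = 0) → x = 0

/-- The matrix is (e - d) I + d J. Blocks have size |K|, which is zero in `K`: adding the kernel
equations over a block kills the term with d, so `x` sums to zero on each block, hence altogether,
and then each equation reads (e - d) x = 0. -/
theorem nonsingularBlocks_of_uniform {m n : Type*} [Fintype K] (N : Matrix m n K) {k : ℕ}
    (r : Fin k × Fin (Fintype.card K) → m) (c : Fin k × Fin (Fintype.card K) → n) {d e : K}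
    (hne : e ≠ d) (hN : ∀ p p', N (r p) (c p') = if p = p' then e else d) :
    NonsingularBlocks N k r c Prod.fst := by
  classical
  intro Z x hx h
  have key : ∀ p, p.1 ∈ Z → (e - d) * x p = - d * ∑ p', x p' := by
    intro p hp
    have h1 := h p hp
    have h2 : ∑ p', x p' * N (r p) (c p') = (e - d) * x p + d * ∑ p', x p' := by
      have : ∀ p', x p' * N (r p) (c p') = (if p = p' then (e - d) * x p' else 0) + d * x p' := by
        intro p'
        rw [hN]
        split_ifs <;> ring
      rw [Finset.sum_congr rfl fun p' _ => this p', Finset.sum_add_distrib, Finset.mul_sum]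
      simp
    rw [h2] at h1
    linear_combination h1
  have hsum : (e - d) * ∑ p, x p = 0 := by
    have hrow : ∀ z : Fin k, ∑ i : Fin (Fintype.card K), (e - d) * x (z, i) = 0 := by
      intro z
      by_cases hz : z ∈ Z
      · rw [Finset.sum_congr rfl fun i _ => key (z, i) hz]
        simp
      · exact Finset.sum_eq_zero fun i _ => by rw [hx _ hz, mul_zero]
    rw [Fintype.sum_prod_type, Finset.mul_sum]
    exact Finset.sum_eq_zero fun z _ => by rw [Finset.mul_sum]; exact hrow z
  have hs0 : ∑ p, x p = 0 := (mul_eq_zero.1 hsum).resolve_left (sub_ne_zero.2 hne)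
  funext p
  by_cases hp : p.1 ∈ Z
  · have := key p hp
    rw [hs0, mul_zero] at this
    exact (mul_eq_zero.1 this).resolve_left (sub_ne_zero.2 hne)
  · exact hx p hp

/-- Every subset of the indices inherits the step pattern, so blocks can be singletons. On the
support of a kernel vector, the first row forces the total sum to vanish, and the second row differs
from it only in the coefficient of the first entry, which must then vanish as well. -/
theorem nonsingularBlocks_of_step {m n : Type*} (N : Matrix m n K) {k : ℕ} (r : Fin k → m) (c : Fin k → n)
    {b d : K} (hne : b ≠ d) (hb : b ≠ 0)
    (hN : ∀ i j, N (r i) (c j) = if i ≤ j then b else d) :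
    NonsingularBlocks N k r c id := by
  classical
  intro Z x hx h
  simp only [id] at hx h
  by_contra hx0
  -- Let `i` be the first index in the support of `x` and compare its row with the next row.
  obtain ⟨i, hi, hmin⟩ := (Finset.univ.filter fun i => x i ≠ 0).exists_minimal (by
    obtain ⟨i, hi⟩ := Function.ne_iff.1 hx0
    exact ⟨i, by simpa using hi⟩)
  have hi : x i ≠ 0 := by simpa using hi
  have hlt : ∀ j < i, x j = 0 := by
    intro j hj
    by_contra hj0
    exact absurd (hmin (y := j) (by simpa using hj0) hj.le) (not_le.2 hj)
  have hiZ : i ∈ Z := by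
    by_contra hc
    exact hi (hx i hc)
  have hrow : b * ∑ j, x j = 0 := by
    rw [← h i hiZ, Finset.mul_sum]
    refine Finset.sum_congr rfl fun j _ => ?_
    rw [hN]
    split_ifs with hij
    · ring
    · rw [hlt j (not_le.1 hij)]; ring
  have hs0 : ∑ j, x j = 0 := (mul_eq_zero.1 hrow).resolve_left hb
  -- Either there is a second support element, or the sum is just `x i`.
  by_cases hex : ∃ j, i < j ∧ x j ≠ 0
  · obtain ⟨i', hi', hmin'⟩ := (Finset.univ.filter fun j => i < j ∧ x j ≠ 0).exists_minimal (by
      obtain ⟨j, hj⟩ := hex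
      exact ⟨j, by simpa using hj⟩)
    have hi' : i < i' ∧ x i' ≠ 0 := by simpa using hi'
    have hiZ' : i' ∈ Z := by
      by_contra hc
      exact hi'.2 (hx i' hc)
    have hmid : ∀ j, j < i' → j ≠ i → x j = 0 := by
      intro j hj hji
      rcases lt_or_gt_of_ne hji with hl | hg
      · exact hlt j hl
      · by_contra hj0
        exact absurd (hmin' (y := j) (by simpa using ⟨hg, hj0⟩) hj.le) (not_le.2 hj)
    have hrow' : (d - b) * x i + b * ∑ j, x j = 0 := by
      rw [← h i' hiZ', Finset.mul_sum, ← Finset.sum_erase_add _ _ (Finset.mem_univ i),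
        ← Finset.sum_erase_add (a := i) _ _ (Finset.mem_univ i)]
      have : ∑ j ∈ Finset.univ.erase i, b * x j
          = ∑ j ∈ Finset.univ.erase i, x j * N (r i') (c j) := by
        refine Finset.sum_congr rfl fun j hj => ?_
        rw [hN]
        split_ifs with hij
        · ring
        · rw [hmid j (not_le.1 hij) (by simpa using hj)]; ring
      rw [this, hN, if_neg (not_le.2 hi'.1)]
      ring
    rw [hs0, mul_zero, add_zero] at hrow'
    exact (mul_ne_zero (sub_ne_zero.2 hne.symm) hi) hrow'
  · push Not at hex
    rw [Finset.sum_eq_single i (fun j _ hj => ?_) (by simp)] at hs0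
    · exact hi hs0
    · rcases lt_or_gt_of_ne hj with hl | hg
      · exact hlt j hl
      · exact hex j hg

/-- The ladder length 2kq serves both cases: kq indices form k blocks of size q if `b = d`, and
otherwise 2k indices are divided between rows and columns. -/
theorem exists_nonsingularBlocks [Finite m] [Fintype K] (N : Matrix m n K) (k : ℕ)
    (h : 2 * Fintype.card K ^ (2 * (Fintype.card K ^ 3 * (2 * k * Fintype.card K))) ≤ N.rank) :
    ∃ (P : Type) (_ : Fintype P) (ρ : P → m) (κ : P → n) (π : P → Fin k),
      Injective ρ ∧ Injective κ ∧ Surjective π ∧ NonsingularBlocks N k ρ κ π := by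
  classical
  obtain ⟨r, c, d, e, b, hne, hr, hc, hdiag, hoff⟩ := exists_constant_ladder N _ h
  have hq : 0 < Fintype.card K := Fintype.card_pos
  have hle : 2 * k ≤ 2 * k * Fintype.card K := Nat.le_mul_of_pos_right _ hq
  -- Rows at positions of one parity and columns at positions of the other never meet the diagonal,
  -- so the value `e` disappears and a step matrix remains.
  let ev : Fin k → Fin (2 * k * Fintype.card K) := fun i => ⟨2 * i.1, by omega⟩
  let od : Fin k → Fin (2 * k * Fintype.card K) := fun i => ⟨2 * i.1 + 1, by omega⟩
  have hev : Injective ev := fun i j hij => by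
    have : 2 * i.1 = 2 * j.1 := congrArg Fin.val hij
    exact Fin.ext (by omega)
  have hod : Injective od := fun i j hij => by
    have : 2 * i.1 + 1 = 2 * j.1 + 1 := congrArg Fin.val hij
    exact Fin.ext (by omega)
  by_cases hbd : b = d
  · subst hbd
    let o : Fin k × Fin (Fintype.card K) → Fin (2 * k * Fintype.card K) := fun p =>
      Fin.castLE (by gcongr; omega) (finProdFinEquiv p)
    have ho : Injective o := (Fin.castLE_injective _).comp finProdFinEquiv.injective
    refine ⟨Fin k × Fin (Fintype.card K), inferInstance, r ∘ o, c ∘ o, Prod.fst, hr.comp ho,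
      hc.comp ho, fun i => ⟨(i, ⟨0, hq⟩), rfl⟩, nonsingularBlocks_of_uniform N _ _ hne ?_⟩
    intro p p'
    rcases lt_trichotomy (o p) (o p') with hl | he | hg
    · rw [if_neg (fun hpp => by simp [hpp] at hl)]
      exact (hoff _ _ hl).2
    · rw [if_pos (ho he), ho he]
      exact hdiag _
    · rw [if_neg (fun hpp => by simp [hpp] at hg)]
      exact (hoff _ _ hg).1
  -- The step lemma needs a nonzero value on and above the diagonal. If `b = 0`, exchanging the
  -- parities puts `d` on and below the diagonal, and `Fin.rev` turns this around.
  by_cases hb : b = 0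
  · have hd : d ≠ 0 := fun hd => hbd (hb.trans hd.symm)
    refine ⟨Fin k, inferInstance, r ∘ od ∘ Fin.rev, c ∘ ev ∘ Fin.rev, id,
      hr.comp (hod.comp Fin.rev_injective), hc.comp (hev.comp Fin.rev_injective),
      surjective_id, nonsingularBlocks_of_step N _ _ (b := d) (d := b) (Ne.symm hbd) hd ?_⟩
    intro i j
    split_ifs with hij
    · refine (hoff _ _ ?_).1
      have := Fin.rev_le_rev.2 hij
      simp only [Function.comp, ev, od, Fin.lt_def, Fin.le_def] at *
      omega
    · refine (hoff _ _ ?_).2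
      have := Fin.rev_lt_rev.2 (not_le.1 hij)
      simp only [Function.comp, ev, od, Fin.lt_def] at *
      omega
  · refine ⟨Fin k, inferInstance, r ∘ ev, c ∘ od, id, hr.comp hev, hc.comp hod,
      surjective_id, nonsingularBlocks_of_step N _ _ (b := b) (d := d) hbd hb ?_⟩
    intro i j
    split_ifs with hij
    · refine (hoff _ _ ?_).2
      simp only [ev, od, Fin.lt_def, Fin.le_def] at *
      omega
    · refine (hoff _ _ ?_).1
      simp only [ev, od, Fin.lt_def, Fin.le_def] at *
      omega

end Ladder

/-! ### Representable matroids are weakly base orderable -/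

section Exchange

theorem exists_coeff {K V α : Type*} [Field K] [AddCommGroup V] [Module K V] (w : α → V)
    (B : Finset α) {y : V} (hy : y ∈ Submodule.span K (w '' B)) :
    ∃ a : α → K, y = ∑ b ∈ B, a b • w b := by
  classical
  obtain ⟨a, ha⟩ := (Submodule.mem_span_image_finset_iff_exists_fun K).1 hy
  refine ⟨fun b => if h : b ∈ B then a ⟨b, h⟩ else 0, ?_⟩
  rw [← ha, ← Finset.sum_coe_sort B]
  exact Finset.sum_congr rfl fun b _ => by simp only [dif_pos b.2]

variable {K : Type} [Field K] {α : Type u} {M : Matroid α}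

/-- Representability only speaks of bases; an independent family of columns extends within the
ground set to one that spans, which is such a basis. -/
theorem indep_iff_linearIndepOn {m : ℕ} {A : Matrix (Fin m) α K}
    (hA : ∀ B : Set α, M.IsBase B ↔ B ⊆ M.E ∧ LinearIndepOn K A.col B ∧
      Submodule.span K (A.col '' B) = Submodule.span K (A.col '' M.E)) (I : Set α) :
    M.Indep I ↔ I ⊆ M.E ∧ LinearIndepOn K A.col I := by
  constructor
  · intro hI
    obtain ⟨B, hB, hIB⟩ := hI.exists_isBase_superset
    exact ⟨hI.subset_ground, ((hA B).1 hB).2.1.mono hIB⟩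
  · rintro ⟨hE, hI⟩
    obtain ⟨B, hBE, hIB, hsp, hB⟩ := exists_linearIndepOn_extension hI hE
    refine Matroid.Indep.subset (Matroid.IsBase.indep ((hA B).2 ⟨hBE, hB, le_antisymm ?_ ?_⟩)) hIB
    · exact Submodule.span_mono (image_mono hBE)
    · exact Submodule.span_le.2 hsp

theorem isBase_of_indep_of_encard_le {I B : Set α} (hI : M.Indep I) (hB : M.IsBase B)
    (hfin : B.Finite) (h : B.encard ≤ I.encard) : M.IsBase I := by
  obtain ⟨B', hB', hIB⟩ := hI.exists_isBase_superset
  have h1 : B'.encard = B.encard := hB'.encard_eq_encard_of_isBase hB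
  have hf : B'.Finite := by
    rw [← encard_ne_top_iff, h1, encard_ne_top_iff]; exact hfin
  exact hf.eq_of_subset_of_encard_le' hIB (h1.trans_le h) ▸ hB'

theorem weaklyBaseOrderable_of_representable [Fintype K] (hM : Representable K M)
    (hfin : M.Finite) (k : ℕ) :
    WeaklyBaseOrderable M
      (2 * Fintype.card K ^ (2 * (Fintype.card K ^ 3 * (2 * k * Fintype.card K)))) k := by
  classical
  obtain ⟨m, A, hA⟩ := hM
  intro B₁ B₂ hB₁ hB₂ hcard
  have hf₁ : B₁.Finite := hfin.ground_finite.subset hB₁.subset_ground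
  have hf₂ : B₂.Finite := hfin.ground_finite.subset hB₂.subset_ground
  lift B₁ to Finset α using hf₁
  lift B₂ to Finset α using hf₂
  set w : α → Fin m → K := A.col with hw
  have hli₁ := linearIndepOn_finset_iff.1 ((hA _).1 hB₁).2.1
  have hli₂ := linearIndepOn_finset_iff.1 ((hA _).1 hB₂).2.1
  have hco : ∀ y ∈ B₂, ∃ a : α → K, w y = ∑ b ∈ B₁, a b • w b := fun y hy =>
    exists_coeff w B₁ (by
      rw [((hA _).1 hB₁).2.2]
      exact Submodule.subset_span ⟨y, hB₂.subset_ground hy, rfl⟩)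
  choose! a ha using hco
  let N : Matrix {x // x ∈ B₁ \ B₂} {y // y ∈ B₂ \ B₁} K := fun x y => a y x
  have hcomb : ∀ (Y : Finset α) (c : α → K), Y ⊆ B₂ →
      ∑ y ∈ Y, c y • w y = ∑ b ∈ B₁, (∑ y ∈ Y, c y * a y b) • w b := by
    intro Y c hY
    rw [Finset.sum_congr rfl fun y hy => by rw [ha y (hY hy), Finset.smul_sum], Finset.sum_comm]
    refine Finset.sum_congr rfl fun b _ => ?_
    rw [Finset.sum_smul]
    exact Finset.sum_congr rfl fun y _ => smul_smul _ _ _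
  have hcardeq : (B₁ \ B₂).card = (B₂ \ B₁).card := by
    have := hB₁.encard_sdiff_comm hB₂
    rw [← Finset.coe_sdiff, ← Finset.coe_sdiff, encard_coe_eq_coe_finsetCard,
      encard_coe_eq_coe_finsetCard] at this
    exact_mod_cast this
  -- A relation among the columns of `N` puts a combination of `B₂ \ B₁` into the span of `B₁ ∩ B₂`.
  -- Together with the elements of `B₁ ∩ B₂` it becomes a relation inside the basis `B₂`, so it is
  -- trivial.
  have hrank : N.rank = (B₁ \ B₂).card := by
    rw [← Matrix.rank_transpose, LinearIndependent.rank_matrix, Fintype.card_coe, hcardeq]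
    rw [Fintype.linearIndependent_iff]
    intro g hg
    have hg' : ∀ x ∈ B₁ \ B₂, ∑ y, g y * a y x = 0 := by
      intro x hx
      have := congrFun hg ⟨x, hx⟩
      simpa [Matrix.row, Matrix.transpose, N, Finset.sum_apply] using this
    let c : α → K := fun y => if h : y ∈ B₂ \ B₁ then g ⟨y, h⟩ else 0
    have hcg : ∀ x, ∑ y, g y * a y x = ∑ y ∈ B₂ \ B₁, c y * a y x := by
      intro x
      rw [← Finset.sum_coe_sort (B₂ \ B₁)]
      refine Finset.sum_congr rfl fun y _ => ?_
      simp only [c, dif_pos y.2]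
    have hz : ∑ y ∈ B₂, (if y ∈ B₁ then - ∑ z ∈ B₂ \ B₁, c z * a z y else c y) • w y = 0 := by
      rw [← Finset.sum_sdiff (Finset.inter_subset_left (s₁ := B₂) (s₂ := B₁)),
        Finset.sdiff_inter_self_left]
      have e1 : ∑ y ∈ B₂ \ B₁, (if y ∈ B₁ then - ∑ z ∈ B₂ \ B₁, c z * a z y else c y) • w y
          = ∑ y ∈ B₂ \ B₁, c y • w y :=
        Finset.sum_congr rfl fun y hy => by rw [if_neg (Finset.mem_sdiff.1 hy).2]
      have e2 : ∑ y ∈ B₂ ∩ B₁, (if y ∈ B₁ then - ∑ z ∈ B₂ \ B₁, c z * a z y else c y) • w y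
          = ∑ y ∈ B₂ ∩ B₁, - ((∑ z ∈ B₂ \ B₁, c z * a z y) • w y) :=
        Finset.sum_congr rfl fun y hy => by rw [if_pos (Finset.mem_inter.1 hy).2, neg_smul]
      rw [e1, e2, hcomb _ c Finset.sdiff_subset, Finset.sum_neg_distrib,
        ← Finset.sum_sdiff (Finset.inter_subset_right (s₁ := B₂) (s₂ := B₁))]
      have e3 : ∑ x ∈ B₁ \ (B₂ ∩ B₁), (∑ y ∈ B₂ \ B₁, c y * a y x) • w x = 0 := by
        refine Finset.sum_eq_zero fun x hx => ?_
        rw [← hcg, hg' x (by simp at hx ⊢; tauto), zero_smul]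
      rw [e3, zero_add, add_neg_cancel]
    intro y
    have := hli₂ _ hz y (Finset.mem_sdiff.1 y.2).1
    rw [if_neg (Finset.mem_sdiff.1 y.2).2] at this
    simpa only [c, dif_pos y.2] using this
  have hcard' : 2 * Fintype.card K ^ (2 * (Fintype.card K ^ 3 * (2 * k * Fintype.card K)))
      ≤ N.rank := by
    rw [hrank]
    rw [← Finset.coe_sdiff, encard_coe_eq_coe_finsetCard] at hcard
    exact_mod_cast hcard
  obtain ⟨P, _, ρ, κ, π, hρ, hκ, hπ, hns⟩ := exists_nonsingularBlocks N k hcard'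
  have hρ' : Injective fun p => (ρ p : α) := Subtype.val_injective.comp hρ
  have hκ' : Injective fun p => (κ p : α) := Subtype.val_injective.comp hκ
  refine ⟨fun i => (fun p => (ρ p : α)) '' (π ⁻¹' {i}), fun i => (fun p => (κ p : α)) '' (π ⁻¹' {i}),
    fun i => ⟨?_, ?_⟩, fun i => ⟨?_, ?_⟩, ?_, ?_, fun Z => ?_⟩
  · obtain ⟨p, hp⟩ := hπ i
    exact ⟨_, mem_image_of_mem _ hp⟩
  · rintro _ ⟨p, -, rfl⟩
    exact Finset.mem_sdiff.1 (ρ p).2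
  · obtain ⟨p, hp⟩ := hπ i
    exact ⟨_, mem_image_of_mem _ hp⟩
  · rintro _ ⟨p, -, rfl⟩
    exact Finset.mem_sdiff.1 (κ p).2
  · exact fun i j hij => (disjoint_image_iff hρ').2
      (Disjoint.preimage _ (disjoint_singleton.2 hij))
  · exact fun i j hij => (disjoint_image_iff hκ').2
      (Disjoint.preimage _ (disjoint_singleton.2 hij))
  -- The exchange along `Z`, as a finite set.
  let PZ : Finset P := Finset.univ.filter fun p => π p ∈ Z
  let X : Finset α := PZ.image fun p => (ρ p : α)
  let Y : Finset α := PZ.image fun p => (κ p : α)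
  have hX : (⋃ i ∈ Z, (fun p => (ρ p : α)) '' (π ⁻¹' {i})) = X := by
    ext x; simp [X, PZ]
  have hY : (⋃ i ∈ Z, (fun p => (κ p : α)) '' (π ⁻¹' {i})) = Y := by
    ext x; simp [Y, PZ]
  have hXB : X ⊆ B₁ := fun x hx => by
    obtain ⟨p, -, rfl⟩ := Finset.mem_image.1 hx
    exact (Finset.mem_sdiff.1 (ρ p).2).1
  have hYB : Y ⊆ B₂ := fun x hx => by
    obtain ⟨p, -, rfl⟩ := Finset.mem_image.1 hx
    exact (Finset.mem_sdiff.1 (κ p).2).1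
  have hYd : Disjoint (B₁ \ X) Y := by
    rw [Finset.disjoint_left]
    intro x hx hxY
    obtain ⟨p, -, rfl⟩ := Finset.mem_image.1 hxY
    exact (Finset.mem_sdiff.1 (κ p).2).2 (Finset.mem_sdiff.1 hx).1
  rw [hX, hY, ← Finset.coe_sdiff, ← Finset.coe_union]
  refine isBase_of_indep_of_encard_le ?_ hB₁ B₁.finite_toSet ?_
  · rw [indep_iff_linearIndepOn hA]
    constructor
    · intro x hx
      rcases Finset.mem_union.1 hx with h | h
      · exact hB₁.subset_ground (Finset.mem_sdiff.1 h).1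
      · exact hB₂.subset_ground (hYB h)
    rw [linearIndepOn_finset_iff]
    intro f hf
    rw [Finset.sum_union hYd, hcomb Y f hYB] at hf
    have e1 : ∑ b ∈ B₁ \ X, f b • w b = ∑ b ∈ B₁, (if b ∈ X then 0 else f b) • w b := by
      rw [← Finset.sum_sdiff hXB]
      rw [Finset.sum_eq_zero (s := X) fun x hx => by rw [if_pos hx, zero_smul], add_zero]
      exact Finset.sum_congr rfl fun b hb => by rw [if_neg (Finset.mem_sdiff.1 hb).2]
    rw [e1, ← Finset.sum_add_distrib] at hf
    -- Coefficients are compared in the basis `B₁`. At the removed elements `X` only the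
    -- contribution of `Y` is left, so `f` restricted to `Y` is a kernel vector of the blocks in
    -- `Z`.
    have hf2 := hli₁ (fun b => (if b ∈ X then 0 else f b) + ∑ y ∈ Y, f y * a y b) (by
      rw [← hf]
      exact Finset.sum_congr rfl fun b _ => add_smul _ _ _)
    have hx0 := hns Z (fun p => if π p ∈ Z then f (κ p) else 0)
      (fun p hp => if_neg hp) (fun p hp => by
        have hpX : (ρ p : α) ∈ X := Finset.mem_image_of_mem (fun p => (ρ p : α))
          (Finset.mem_filter.2 ⟨Finset.mem_univ _, hp⟩)
        have := hf2 (ρ p) (hXB hpX)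
        simp only [if_pos hpX, zero_add] at this
        rw [Finset.sum_image fun x _ y _ h => hκ' h] at this
        refine Eq.trans ?_ this
        rw [Finset.sum_filter]
        refine Finset.sum_congr rfl fun p' _ => ?_
        split_ifs <;> simp [N])
    have hfY : ∀ y ∈ Y, f y = 0 := by
      intro y hy
      obtain ⟨p, hp, rfl⟩ := Finset.mem_image.1 hy
      have := congrFun hx0 p
      simpa only [if_pos (Finset.mem_filter.1 hp).2, Pi.zero_apply] using this
    intro i hi
    rcases Finset.mem_union.1 hi with h | h
    · have := hf2 i (Finset.mem_sdiff.1 h).1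
      simp only [if_neg (Finset.mem_sdiff.1 h).2] at this
      rwa [Finset.sum_eq_zero fun y hy => by rw [hfY y hy, zero_mul], add_zero] at this
    · exact hfY i h
  -- `X` and `Y` are injective images of the same `PZ`, so the exchange preserves the cardinality.
  · rw [encard_coe_eq_coe_finsetCard, encard_coe_eq_coe_finsetCard, Finset.card_union_of_disjoint hYd,
      Finset.card_sdiff_of_subset hXB, Finset.card_image_of_injective _ hρ',
      Finset.card_image_of_injective _ hκ']
    have : PZ.card ≤ B₁.card := by
      rw [← Finset.card_image_of_injective PZ hρ']
      exact Finset.card_le_card hXB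
    norm_cast
    omega

end Exchange

/-! ### Proximity of avoiding bases -/

section Proximity

variable {α : Type u} {M : Matroid α} {Γ : Type v} [AddCommGroup Γ]

theorem label_eq_sum (ψ : α → Γ) (S : Finset α) : label ψ (S : Set α) = ∑ x ∈ S, ψ x := by
  unfold label
  exact finsum_mem_coe_finset _ _

theorem label_union_sdiff (ψ : α → Γ) {B X Y : Set α} (hB : B.Finite) (hY : Y.Finite)
    (hXB : X ⊆ B) (hYB : Disjoint Y B) :
    label ψ ((B \ X) ∪ Y) = label ψ B + (label ψ Y - label ψ X) := by
  unfold label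
  rw [finsum_mem_union (hYB.symm.mono_left sdiff_subset) (hB.subset sdiff_subset) hY,
    ← finsum_mem_add_sdiff hXB hB]
  abel

theorem label_biUnion (ψ : α → Γ) {k : ℕ} (X : Fin k → Set α) (hX : ∀ i, (X i).Finite)
    (hd : Pairwise (Disjoint on X)) (Z : Finset (Fin k)) :
    label ψ (⋃ i ∈ (Z : Set (Fin k)), X i) = ∑ i ∈ Z, label ψ (X i) := by
  unfold label
  rw [finsum_mem_biUnion (fun i _ j _ hij => hd hij) Z.finite_toSet fun i _ => hX i,
    finsum_mem_coe_finset]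

/-- If more group elements are given than `F` has elements, and if no element of `F` is `g`, then
some nonempty subsum added to `g` avoids `F`. -/
theorem exists_subsum_notMem (F : Finset Γ) (g : Γ) (hg : g ∉ F) (h : Fin (F.card + 1) → Γ) :
    ∃ Z : Finset (Fin (F.card + 1)), Z.Nonempty ∧ g + ∑ i ∈ Z, h i ∉ F := by
  classical
  by_contra! hc
  -- If all |F| + 1 nonempty prefixes led into `F`, two of them would have equal sums. The stretch
  -- between them sums to zero, is nonempty and leaves the label at `g`, outside `F`.
  let S : Fin (F.card + 1) → Finset (Fin (F.card + 1)) := fun j => Finset.Iic j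
  obtain ⟨i, -, j, -, hij, he⟩ := Finset.exists_ne_map_eq_of_card_lt_of_maps_to
    (s := (Finset.univ : Finset (Fin (F.card + 1)))) (t := F)
    (f := fun j => g + ∑ i ∈ S j, h i) (by simp) (fun j _ => hc _ ⟨j, by simp [S]⟩)
  wlog hlt : i < j generalizing i j
  · exact this j i hij.symm he.symm (lt_of_le_of_ne (not_lt.1 hlt) hij.symm)
  have hsub : S i ⊆ S j := Finset.Iic_subset_Iic.2 hlt.le
  have h0 : ∑ x ∈ S j \ S i, h x = 0 := by
    have := Finset.sum_sdiff hsub (f := h)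
    have he' := add_left_cancel he
    rw [he'] at this
    simpa using this
  have := hc (S j \ S i) ⟨j, by simp [S, hlt]⟩
  rw [h0, add_zero] at this
  exact hg this

theorem exists_avoiding_base_near (hM : M.Finite) {a : ℕ} (ha : 0 < a) (F : Finset Γ)
    (hw : WeaklyBaseOrderable M a (F.card + 1)) (ψ : α → Γ)
    (hex : ∃ B : Set α, M.IsBase B ∧ label ψ B ∉ F) (B : Set α) (hB : M.IsBase B) :
    ∃ B' : Set α, M.IsBase B' ∧ label ψ B' ∉ F ∧ (B \ B').encard ≤ ((a - 1 : ℕ) : ℕ∞) := by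
  classical
  have hfin : ∀ {B : Set α}, M.IsBase B → B.Finite := fun h =>
    hM.ground_finite.subset h.subset_ground
  -- An avoiding basis nearest to `B`. The exchanges below go from `B'` towards `B`, so every
  -- nonempty set of them shrinks `B \ B'`.
  obtain ⟨B', ⟨hB', hF'⟩, hmin⟩ := WellFounded.has_min
    (InvImage.wf (fun B' : Set α => (B \ B').ncard) wellFounded_lt)
    {B' | M.IsBase B' ∧ label ψ B' ∉ F} hex
  refine ⟨B', hB', hF', ?_⟩
  by_contra hlt
  have hge : (a : ℕ∞) ≤ (B' \ B).encard := by
    rw [hB'.encard_sdiff_comm hB]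
    have hf : (B \ B').Finite := (hfin hB).subset sdiff_subset
    rw [hf.encard_eq_coe_toFinset_card] at hlt ⊢
    norm_cast at hlt ⊢
    omega
  obtain ⟨X, Y, hX, hY, hXd, hYd, hZ⟩ := hw B' B hB' hB hge
  have hXfin : ∀ i, (X i).Finite := fun i => (hfin hB').subset ((hX i).2.trans sdiff_subset)
  have hYfin : ∀ i, (Y i).Finite := fun i => (hfin hB).subset ((hY i).2.trans sdiff_subset)
  obtain ⟨Z, hZne, hZF⟩ := exists_subsum_notMem F _ hF'
    (fun i => label ψ (Y i) - label ψ (X i))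
  set UX := ⋃ i ∈ (Z : Set (Fin (F.card + 1))), X i with hUX
  set UY := ⋃ i ∈ (Z : Set (Fin (F.card + 1))), Y i with hUY
  have hUXs : UX ⊆ B' \ B := iUnion₂_subset fun i _ => (hX i).2
  have hUYs : UY ⊆ B \ B' := iUnion₂_subset fun i _ => (hY i).2
  have hlab : label ψ ((B' \ UX) ∪ UY) ∉ F := by
    rw [label_union_sdiff ψ (hfin hB') ((hfin hB).subset (hUYs.trans sdiff_subset))
      (hUXs.trans sdiff_subset) (disjoint_sdiff_left.mono_left hUYs), hUX, hUY,
      label_biUnion ψ X hXfin hXd, label_biUnion ψ Y hYfin hYd, ← Finset.sum_sub_distrib]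
    exact hZF
  refine hmin _ ⟨hZ Z, hlab⟩ (Set.ncard_lt_ncard ?_ ((hfin hB).subset sdiff_subset))
  obtain ⟨i, hi⟩ := hZne
  obtain ⟨y, hy⟩ := (hY i).1
  have hyU : y ∈ UY := mem_biUnion (s := (Z : Set (Fin (F.card + 1)))) hi hy
  refine ssubset_iff_subset_ne.2 ⟨?_, ?_⟩
  · rintro x ⟨hxB, hx⟩
    refine ⟨hxB, fun hxB' => hx (Or.inl ⟨hxB', fun hxU => (hUXs hxU).2 hxB⟩)⟩
  · intro he
    have h1 : y ∈ B \ B' := hUYs hyU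
    rw [← he] at h1
    exact h1.2 (Or.inr hyU)

/-- The function `f` of the main theorem. -/
def exchangeBound (q k : ℕ) : ℕ := 2 * (q + 1) ^ (2 * (q ^ 3 * (2 * k * q)))

theorem exchangeBound_pos (q k : ℕ) : 0 < exchangeBound q k := by
  unfold exchangeBound; positivity

theorem exchangeBound_mono (q : ℕ) : Monotone (exchangeBound q) := by
  intro k l h
  unfold exchangeBound
  gcongr
  omega

theorem weaklyBaseOrderable_exchangeBound {q : ℕ} (hM : M.Finite) (h : RepresentableGF q M)
    (k : ℕ) : WeaklyBaseOrderable M (exchangeBound q k) k := by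
  obtain ⟨K, _, hK, hq, hrep⟩ := h
  have := Fintype.ofFinite K
  intro B₁ B₂ h₁ h₂ h12
  refine weaklyBaseOrderable_of_representable hrep hM k B₁ B₂ h₁ h₂ (le_trans ?_ h12)
  -- The ladder gives a power of q. The base q + 1 in `exchangeBound` is larger, and makes
  -- positivity and monotonicity evident for all q.
  rw [← Nat.card_eq_fintype_card, hq]
  unfold exchangeBound
  gcongr
  omega

theorem exists_avoiding_base_near_of_representableGF {q : ℕ} (hM : M.Finite)
    (h : RepresentableGF q M) (F : Finset Γ) (ψ : α → Γ)
    (hex : ∃ B : Set α, M.IsBase B ∧ label ψ B ∉ F) (B : Set α) (hB : M.IsBase B) :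
    ∃ B' : Set α, M.IsBase B' ∧ label ψ B' ∉ F ∧
      (B \ B').encard ≤ ((exchangeBound q (F.card + 1) - 1 : ℕ) : ℕ∞) :=
  exists_avoiding_base_near hM (exchangeBound_pos _ _) F
    (weaklyBaseOrderable_exchangeBound hM h _) ψ hex B hB

end Proximity

/-! ### Independent sets with prescribed labels -/

section Rado

variable {α : Type u} {Γ : Type v} (M : Matroid α) (ψ : α → Γ)

open Classical in
/-- The number of labels in the multiset `W` that lie in `S`. -/
def labelCount (W : Multiset Γ) (S : Set Γ) : ℕ := W.countP (· ∈ S)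

/-- Rado's condition for the multiset `W` of labels: for every set `S` of labels, the elements
of `E` with labels in `S` have at least the rank that `W` demands. -/
def RadoCond (W : Multiset Γ) (E : Set α) : Prop :=
  ∀ S : Set Γ, (labelCount W S : ℕ∞) ≤ M.eRk {e ∈ E | ψ e ∈ S}

variable {M ψ}

theorem RadoCond.mono {W : Multiset Γ} {E E' : Set α} (h : RadoCond M ψ W E) (hE : E ⊆ E') :
    RadoCond M ψ W E' := fun S =>
  (h S).trans (M.eRk_mono fun _ hx => ⟨hE hx.1, hx.2⟩)

theorem radoCond_of_indep {B : Finset α} (hB : M.Indep B) :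
    RadoCond M ψ (B.val.map ψ) B := by
  classical
  intro S
  have h1 : ({e ∈ (B : Set α) | ψ e ∈ S} : Set α) = ↑(B.filter fun e => ψ e ∈ S) := by
    ext; simp
  rw [h1, (hB.subset (by simp [Set.subset_def]; tauto)).eRk_eq_encard, encard_coe_eq_coe_finsetCard, labelCount, Multiset.countP_map]
  simp only [Finset.card, Finset.filter_val]
  exact le_of_eq (by congr!)

theorem labelCount_inter_add_union (W : Multiset Γ) (S T : Set Γ) :
    labelCount W (S ∩ T) + labelCount W (S ∪ T) = labelCount W S + labelCount W T := by
  classical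
  unfold labelCount
  induction W using Multiset.induction_on with
  | empty => simp
  | cons a W ih =>
    simp only [Multiset.countP_cons]
    by_cases h1 : a ∈ S <;> by_cases h2 : a ∈ T <;> simp [h1, h2] <;> simp at ih <;> omega

/-- The elements of `J` are coloops of `X`, so they can be added to `I` one after the other. -/
theorem indep_union_of_coloops {I J X : Set α} (hI : M.Indep I) (hJ : J.Finite) (hJE : J ⊆ M.E)
    (hIJ : Disjoint I J) (hX : I ∪ J ⊆ X) (h : ∀ e ∈ J, e ∉ M.closure (X \ {e})) :
    M.Indep (I ∪ J) := by
  induction J, hJ using Set.Finite.induction_on with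
  | empty => simpa using hI
  | @insert a s ha hs ih =>
    have hs' := ih ((subset_insert _ _).trans hJE) (hIJ.mono_right (subset_insert _ _))
      ((union_subset_union_right _ (subset_insert _ _)).trans hX)
      (fun e he => h e (mem_insert_of_mem _ he))
    have haI : a ∉ I := fun hc => (Set.disjoint_left.1 hIJ hc) (mem_insert _ _)
    rw [union_insert]
    rw [hs'.insert_indep_iff]
    refine Or.inl ⟨hJE (mem_insert _ _), fun hc => h a (mem_insert _ _)
      (M.closure_subset_closure (Y := X \ {a}) (fun x hx => ⟨hX ?_, ?_⟩) hc)⟩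
    · exact union_subset_union_right _ (subset_insert _ _) hx
    · rintro rfl
      exact hx.elim haI ha

/-- A set that is minimal with Rado's condition is independent and has the prescribed labels. -/
theorem indep_of_minimal_radoCond [Finite Γ] {W : Multiset Γ} {E : Finset α}
    (hE : (E : Set α) ⊆ M.E) (h : RadoCond M ψ W E)
    (hmin : ∀ e ∈ E, ¬ RadoCond M ψ W ((E : Set α) \ {e})) :
    M.Indep E ∧ E.val.map ψ = W := by
  classical
  have hfin : ∀ X ⊆ (E : Set α), M.eRk X ≠ ⊤ := fun X hX =>
    ne_top_of_le_ne_top (encard_ne_top_iff.2 (E.finite_toSet.subset hX)) (M.eRk_le_encard X)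
  let F : Set Γ → Set α := fun S => {e ∈ (E : Set α) | ψ e ∈ S}
  have hFE : ∀ S, F S ⊆ (E : Set α) := fun S x hx => hx.1
  let ρ : Set Γ → ℕ := fun S => (M.eRk (F S)).toNat
  have hρ : ∀ S, (ρ S : ℕ∞) = M.eRk (F S) := fun S => ENat.natCast_toNat (hfin _ (hFE S))
  let n : Set Γ → ℕ := labelCount W
  have hn : ∀ S, n S ≤ ρ S := fun S => by
    have := h S
    rw [show {e ∈ (E : Set α) | ψ e ∈ S} = F S from rfl, ← hρ] at this
    simpa [n] using this
  -- Rank is submodular and the demand `n` is modular, so the sets where they agree are closed under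
  -- intersection.
  have htight : ∀ S T, ρ S = n S → ρ T = n T → ρ (S ∩ T) = n (S ∩ T) := by
    intro S T hS hT
    have hsub : ρ (S ∩ T) + ρ (S ∪ T) ≤ ρ S + ρ T := by
      have := M.eRk_inter_add_eRk_union_le (F S) (F T)
      rw [show F S ∩ F T = F (S ∩ T) by ext; simp [F]; tauto,
        show F S ∪ F T = F (S ∪ T) by ext; simp [F]; tauto, ← hρ, ← hρ, ← hρ, ← hρ] at this
      exact_mod_cast this
    have hmod : n (S ∩ T) + n (S ∪ T) = n S + n T := labelCount_inter_add_union W S T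
    have := hn (S ∩ T)
    have := hn (S ∪ T)
    omega
  -- Removing `e` violates the condition at some `S`. As the rank falls by at most one, `S` was
  -- tight and `e` is a coloop of `F S`.
  have hcol : ∀ e ∈ E, ∃ S, ψ e ∈ S ∧ ρ S = n S ∧ e ∉ M.closure (F S \ {e}) := by
    intro e he
    have := hmin e he
    unfold RadoCond at this
    push Not at this
    obtain ⟨S, hS⟩ := this
    rw [show {x ∈ (E : Set α) \ {e} | ψ x ∈ S} = F S \ {e} by ext; simp [F]; tauto] at hS
    have hle : M.eRk (F S) ≤ M.eRk (F S \ {e}) + 1 :=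
      (M.eRk_mono (by simp)).trans (M.eRk_insert_le_add_one e (F S \ {e}))
    have hS' : M.eRk (F S \ {e}) < n S := hS
    have hmem : ψ e ∈ S := by
      by_contra hc
      rw [sdiff_singleton_eq_self (fun hx => hc hx.2), ← hρ] at hS'
      exact absurd (hn S) (not_le.2 (by exact_mod_cast hS'))
    have hb : M.eRk (F S \ {e}) = ((M.eRk (F S \ {e})).toNat : ℕ∞) :=
      (ENat.natCast_toNat (hfin _ (sdiff_subset.trans (hFE S)))).symm
    refine ⟨S, hmem, ?_, fun hcl => ?_⟩
    · rw [hb] at hS' hle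
      rw [← hρ] at hle
      norm_cast at hS' hle
      have := hn S
      omega
    · have h1 : M.eRk (F S) = M.eRk (F S \ {e}) := by
        rw [← M.eRk_closure_eq (F S \ {e}), ← insert_eq_of_mem hcl, M.eRk_insert_closure_eq,
          insert_sdiff_singleton, insert_eq_of_mem (show e ∈ F S from ⟨he, hmem⟩)]
      rw [← h1, ← hρ] at hS'
      exact absurd (hn S) (not_le.2 (by exact_mod_cast hS'))
  have hcount : ∀ γ, (E.filter fun e => ψ e = γ).card = W.count γ := by
    intro γ
    have hF1 : F {γ} = ↑(E.filter fun e => ψ e = γ) := by ext; simp [F]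
    have hn1 : n {γ} = W.count γ := by
      simp only [n, labelCount, mem_singleton_iff, Multiset.count]
      exact Multiset.countP_congr rfl fun x _ => by simp [eq_comm]
    refine le_antisymm ?_ ?_
    · by_cases hγ : ∃ e ∈ E, ψ e = γ
      · obtain ⟨e₀, he₀, rfl⟩ := hγ
        -- By closure under intersection, a minimal tight `T` with the label of `e₀` lies in every
        -- tight set with that label. Hence all elements with this label are coloops of `F T`, and
        -- their number is at most n(T) - n(T \ {ψ e₀}), the demand for the label.
        obtain ⟨T, ⟨hγT, hT⟩, hTmin⟩ := Set.Finite.exists_minimal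
          (s := {S : Set Γ | ψ e₀ ∈ S ∧ ρ S = n S}) (Set.toFinite _) (by
            obtain ⟨S, h1, h2, -⟩ := hcol e₀ he₀
            exact ⟨S, h1, h2⟩)
        have hcl : ∀ e ∈ F {ψ e₀}, e ∉ M.closure (F T \ {e}) := by
          rintro e ⟨he, hγe⟩
          rw [mem_singleton_iff] at hγe
          obtain ⟨S, h1, h2, h3⟩ := hcol e he
          have hTS : T ⊆ S := (hTmin (y := T ∩ S) ⟨⟨hγT, hγe ▸ h1⟩, htight T S hT h2⟩
            inter_subset_left).trans inter_subset_right
          have hF : F T ⊆ F S := fun x hx => ⟨hx.1, hTS hx.2⟩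
          exact fun hc => h3 (M.closure_subset_closure (sdiff_subset_sdiff_left hF) hc)
        obtain ⟨I, hI⟩ := M.exists_isBasis (F (T \ {ψ e₀})) ((hFE _).trans hE)
        have hdis : Disjoint I (F {ψ e₀}) := by
          rw [Set.disjoint_left]
          intro x hx hx'
          exact (hI.subset hx).2.2 hx'.2
        have hsub : I ∪ F {ψ e₀} ⊆ F T := by
          rintro x (hx | hx)
          · exact ⟨(hI.subset hx).1, (hI.subset hx).2.1⟩
          · exact ⟨hx.1, by rw [mem_singleton_iff.1 hx.2]; exact hγT⟩
        have hind := indep_union_of_coloops hI.indep (E.finite_toSet.subset (hFE _))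
          ((hFE _).trans hE) hdis hsub hcl
        have hle := hind.encard_le_eRk_of_subset hsub
        rw [encard_union_eq hdis, hI.encard_eq_eRk, ← hρ, ← hρ, hF1,
          encard_coe_eq_coe_finsetCard] at hle
        norm_cast at hle
        have h4 := hn (T \ {ψ e₀})
        -- Two instances of modularity, for `T` and for the singleton against the same complement,
        -- combine to n(T) = n(T \ {ψ e₀}) + n({ψ e₀}).
        have h5 : n (T ∩ {ψ e₀}ᶜ) + n (T ∪ {ψ e₀}ᶜ) = n T + n {ψ e₀}ᶜ :=
          labelCount_inter_add_union W T {ψ e₀}ᶜ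
        have h6 : n (({ψ e₀} : Set Γ) ∩ {ψ e₀}ᶜ) + n ({ψ e₀} ∪ {ψ e₀}ᶜ) = n {ψ e₀} + n {ψ e₀}ᶜ :=
          labelCount_inter_add_union W {ψ e₀} {ψ e₀}ᶜ
        have h7 : n (({ψ e₀} : Set Γ) ∩ {ψ e₀}ᶜ) = 0 := by
          rw [inter_compl_self]; simp [n, labelCount]
        have h8 : T ∪ {ψ e₀}ᶜ = {ψ e₀} ∪ {ψ e₀}ᶜ := by
          rw [union_compl_self, ← univ_subset_iff]
          intro x _
          by_cases hx : x = ψ e₀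
          · exact Or.inl (hx ▸ hγT)
          · exact Or.inr hx
        rw [h8] at h5
        rw [← Set.sdiff_eq] at h5
        omega
      · push Not at hγ
        rw [Finset.filter_eq_empty_iff.2 fun {x} hx => hγ x hx]
        simp
    · rw [← hn1]
      refine (hn _).trans ?_
      have := M.eRk_le_encard (F {γ})
      rw [← hρ, hF1, encard_coe_eq_coe_finsetCard] at this
      exact_mod_cast this
  have hmap : E.val.map ψ = W := by
    ext γ
    rw [← hcount, Multiset.count_map]
    simp only [Finset.card, Finset.filter_val]
    congr 1
    exact Multiset.filter_congr fun x _ => by rw [eq_comm]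
  refine ⟨?_, hmap⟩
  -- For the set of all labels the condition says that the rank of `E` is at least |W|, which is now
  -- |E|.
  refine Matroid.IsRkFinite.indep_of_encard_le_eRk (Matroid.eRk_ne_top_iff.1 (hfin _ subset_rfl)) ?_
  have := h univ
  rw [show {e ∈ (E : Set α) | ψ e ∈ univ} = E by simp] at this
  refine le_trans ?_ this
  rw [encard_coe_eq_coe_finsetCard, ← hmap]
  simp [labelCount]

end Rado

/-! ### Structured programs

Programs are built from blocks: a block at `b` leaves its result in variable `b`, uses the variables
from `b` on as scratch space and leaves the variables below `b` unchanged. -/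

section Blocks

variable {α : Type u} {Γ : Type v} [AddCommGroup Γ] (M : Matroid α) (ψ : α → Γ)

/-- Started in state `s`, the program `c` halts within `T` steps with the value `v` of variable `b`
and the values of all smaller variables unchanged. -/
def Comp (c : Prog) (b : ℕ) (s : ℕ → Tree α Γ) (v : Tree α Γ) (T : ℕ) : Prop :=
  ∃ t s', Run M ψ c s t s' ∧ t ≤ T ∧ s' b = v ∧ ∀ i < b, s' i = s i

variable {M ψ}

theorem Comp.mono {c : Prog} {b : ℕ} {s : ℕ → Tree α Γ} {v : Tree α Γ} {T T' : ℕ}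
    (h : Comp M ψ c b s v T) (hT : T ≤ T') : Comp M ψ c b s v T' := by
  obtain ⟨t, s', h1, h2, h3⟩ := h
  exact ⟨t, s', h1, h2.trans hT, h3⟩

theorem comp_assign (b : ℕ) (e : Expr) (s : ℕ → Tree α Γ) {v : Tree α Γ} {T : ℕ}
    (hv : e.eval M ψ s = v) (hT : e.cost + 1 ≤ T) : Comp M ψ (.assign b e) b s v T :=
  ⟨_, _, Run.assign b e s, hT, by simp [hv], fun i hi => by simp [hi.ne]⟩

/-- Compute a value into variable `b` and run the block `d` at `b + 1` with it. -/
def letP (b : ℕ) (c d : Prog) : Prog := .seq c (.seq d (.assign b (.var (b + 1))))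

theorem comp_let {b : ℕ} {c d : Prog} {s : ℕ → Tree α Γ} {v w : Tree α Γ} {T₁ T₂ : ℕ}
    (h₁ : Comp M ψ c b s v T₁)
    (h₂ : ∀ s', s' b = v → (∀ i < b, s' i = s i) → Comp M ψ d (b + 1) s' w T₂) :
    Comp M ψ (letP b c d) b s w (T₁ + T₂ + 2) := by
  obtain ⟨t, s', h1, h2, h3, h4⟩ := h₁
  obtain ⟨t', s'', g1, g2, g3, g4⟩ := h₂ s' h3 h4
  refine ⟨_, _, Run.seq h1 (Run.seq g1 (Run.assign _ _ _)), ?_, ?_, ?_⟩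
  · simp only [Expr.cost]; omega
  · simp [Expr.eval, g3]
  · intro i hi
    rw [update_of_ne hi.ne, g4 i (by omega), h4 i hi]

theorem comp_ite {b : ℕ} {e : Expr} {c d : Prog} {s : ℕ → Tree α Γ} {v : Tree α Γ} {T : ℕ}
    (h₁ : e.eval M ψ s ≠ .nil → Comp M ψ c b s v T)
    (h₂ : e.eval M ψ s = .nil → Comp M ψ d b s v T) :
    Comp M ψ (.ite e c d) b s v (e.cost + 1 + T) := by
  by_cases h : e.eval M ψ s = .nil
  · obtain ⟨t, s', h1, h2, h3⟩ := h₂ h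
    exact ⟨_, s', Run.ite_false h h1, by omega, h3⟩
  · obtain ⟨t, s', h1, h2, h3⟩ := h₁ h
    exact ⟨_, s', Run.ite_true h h1, by omega, h3⟩

/-- Fold over the list in variable `x`, with the accumulator in variable `b`, the current element in
variable `b + 2` and the loop body as a block at `b + 3`. -/
def foldP (b x : ℕ) (init : Expr) (body : Prog) : Prog :=
  .seq (.assign b init) (.seq (.assign (b + 1) (.var x))
    (.while (.var (b + 1)) (.seq (.assign (b + 2) (.hd (.var (b + 1))))
      (.seq (.assign (b + 1) (.tl (.var (b + 1)))) (.seq body (.assign b (.var (b + 3))))))))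

/-- The cost of a loop of at most `D` rounds, each of cost at most `T`. -/
def loopCost (D T : ℕ) : ℕ := D * (T + 10) + 10

/-- Loop invariant: after the prefix `pre`, variable `b` holds its fold and `b + 1` the remaining
list. The body may use the actual prefix, so size bounds on the accumulator are available in every
round. The test and the three bookkeeping assignments cost 10 steps per round. -/
theorem comp_fold_aux {β γ : Type*} {b : ℕ} {body : Prog} {s : ℕ → Tree α Γ} {T : ℕ}
    (encβ : β → Tree α Γ) (encγ : γ → Tree α Γ) (f : β → γ → β) (l : List γ) (b₀ : β)
    (hbody : ∀ pre a suf, l = pre ++ a :: suf → ∀ s' : ℕ → Tree α Γ,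
      s' b = encβ (pre.foldl f b₀) → s' (b + 2) = encγ a → (∀ i < b, s' i = s i) →
      Comp M ψ body (b + 3) s' (encβ (f (pre.foldl f b₀) a)) T) :
    ∀ (suf pre : List γ), l = pre ++ suf → ∀ s' : ℕ → Tree α Γ, s' b = encβ (pre.foldl f b₀) →
      s' (b + 1) = .ofList (suf.map encγ) → (∀ i < b, s' i = s i) →
      ∃ t s'', Run M ψ (.while (.var (b + 1)) (.seq (.assign (b + 2) (.hd (.var (b + 1))))
        (.seq (.assign (b + 1) (.tl (.var (b + 1)))) (.seq body (.assign b (.var (b + 3)))))))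
        s' t s'' ∧ t ≤ suf.length * (T + 10) + 2 ∧ s'' b = encβ (l.foldl f b₀) ∧
        ∀ i < b, s'' i = s i := by
  intro suf
  induction suf with
  | nil =>
    intro pre hl s' h1 h2 h3
    refine ⟨_, s', Run.while_false (by simpa [Expr.eval, Tree.ofList] using h2), by
      simp [Expr.cost], ?_, h3⟩
    rw [h1, hl, List.append_nil]
  | cons a suf ih =>
    intro pre hl s' h1 h2 h3
    let s₁ := update s' (b + 2) (encγ a)
    let s₂ := update s₁ (b + 1) (Tree.ofList (suf.map encγ))
    have r1 : Run M ψ (.assign (b + 2) (.hd (.var (b + 1)))) s' 3 s₁ := by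
      have := Run.assign (M := M) (ψ := ψ) (b + 2) (.hd (.var (b + 1))) s'
      simpa [Expr.eval, h2, Tree.ofList, Tree.hd, Expr.cost] using this
    have r2 : Run M ψ (.assign (b + 1) (.tl (.var (b + 1)))) s₁ 3 s₂ := by
      have := Run.assign (M := M) (ψ := ψ) (b + 1) (.tl (.var (b + 1))) s₁
      have hv : s₁ (b + 1) = .ofList ((a :: suf).map encγ) := by
        rw [← h2]; exact update_of_ne (by omega) _ _
      simpa [Expr.eval, hv, Tree.ofList, Tree.tl, Expr.cost] using this
    have hfr : ∀ i < b, s₂ i = s i := fun i hi => by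
      rw [← h3 i hi]
      simp only [s₂, s₁]
      rw [update_of_ne (by omega), update_of_ne (by omega)]
    obtain ⟨t, s₃, g1, g2, g3, g4⟩ := hbody pre a suf hl s₂
      (by simp only [s₂, s₁]; rw [update_of_ne (by omega), update_of_ne (by omega), h1])
      (by simp only [s₂, s₁]; rw [update_of_ne (by omega), update_self]) hfr
    obtain ⟨t', s₄, k1, k2, k3, k4⟩ := ih (pre ++ [a]) (by simp [hl])
      (update s₃ b (s₃ (b + 3))) (by simp [g3])
      (by rw [update_of_ne (by omega), g4 _ (by omega)]; simp [s₂])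
      (fun i hi => by rw [update_of_ne hi.ne, g4 i (by omega), hfr i hi])
    refine ⟨_, s₄, Run.while_true (by simp [Expr.eval, h2, Tree.ofList])
      (Run.seq r1 (Run.seq r2 (Run.seq g1 (Run.assign _ _ _)))) k1, ?_, k3, k4⟩
    simp only [Expr.cost, List.length_cons]
    rw [add_mul]
    omega

/-- The additive 10 in `loopCost` pays for an initialization of cost at most 5, the copy of the list
and the last test. -/
theorem comp_fold {β γ : Type*} {b x : ℕ} {init : Expr} {body : Prog} {s : ℕ → Tree α Γ} {D T : ℕ}
    (encβ : β → Tree α Γ) (encγ : γ → Tree α Γ) (f : β → γ → β) (l : List γ) (b₀ : β)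
    (hx : s x = .ofList (l.map encγ)) (hxb : x < b) (hinit : init.eval M ψ s = encβ b₀)
    (hcost : init.cost ≤ 5) (hD : l.length ≤ D)
    (hbody : ∀ pre a suf, l = pre ++ a :: suf → ∀ s' : ℕ → Tree α Γ,
      s' b = encβ (pre.foldl f b₀) → s' (b + 2) = encγ a → (∀ i < b, s' i = s i) →
      Comp M ψ body (b + 3) s' (encβ (f (pre.foldl f b₀) a)) T) :
    Comp M ψ (foldP b x init body) b s (encβ (l.foldl f b₀)) (loopCost D T) := by
  let s₁ := update s b (encβ b₀)
  let s₂ := update s₁ (b + 1) (Tree.ofList (l.map encγ))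
  have r1 : Run M ψ (.assign b init) s (init.cost + 1) s₁ := by
    have := Run.assign (M := M) (ψ := ψ) b init s
    rwa [hinit] at this
  have r2 : Run M ψ (.assign (b + 1) (.var x)) s₁ 2 s₂ := by
    have := Run.assign (M := M) (ψ := ψ) (b + 1) (.var x) s₁
    have hv : s₁ x = .ofList (l.map encγ) := by
      rw [← hx]; exact update_of_ne (by omega) _ _
    simpa [Expr.eval, hv, Expr.cost] using this
  obtain ⟨t, s', h1, h2, h3, h4⟩ := comp_fold_aux encβ encγ f l b₀ hbody l [] rfl s₂
    (by simp only [s₂, s₁]; rw [update_of_ne (by omega), update_self]; rfl)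
    (by simp [s₂])
    (fun i hi => by simp only [s₂, s₁]; rw [update_of_ne (by omega), update_of_ne hi.ne])
  refine ⟨_, s', Run.seq r1 (Run.seq r2 h1), ?_, h3, h4⟩
  have : l.length * (T + 10) ≤ D * (T + 10) := Nat.mul_le_mul_right _ hD
  unfold loopCost
  omega

end Blocks

/-! ### Polynomially bounded costs -/

/-- The function `f` is bounded by a polynomial. -/
def PolyBdd (f : ℕ → ℕ) : Prop := ∃ c d, ∀ D, f D ≤ c * (D + 1) ^ d

theorem polyBdd_const (a : ℕ) : PolyBdd fun _ => a := ⟨a, 0, by simp⟩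

theorem polyBdd_id : PolyBdd fun D => D := ⟨1, 1, by simp⟩

theorem PolyBdd.mul {f g : ℕ → ℕ} (hf : PolyBdd f) (hg : PolyBdd g) :
    PolyBdd fun D => f D * g D := by
  obtain ⟨c, d, h⟩ := hf
  obtain ⟨c', d', h'⟩ := hg
  exact ⟨c * c', d + d', fun D => (Nat.mul_le_mul (h D) (h' D)).trans (le_of_eq (by ring))⟩

theorem PolyBdd.add {f g : ℕ → ℕ} (hf : PolyBdd f) (hg : PolyBdd g) :
    PolyBdd fun D => f D + g D := by
  obtain ⟨c, d, h⟩ := hf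
  obtain ⟨c', d', h'⟩ := hg
  refine ⟨c + c', d + d', fun D => ?_⟩
  have h1 : (D + 1) ^ d ≤ (D + 1) ^ (d + d') := Nat.pow_le_pow_right (by omega) (by omega)
  have h2 : (D + 1) ^ d' ≤ (D + 1) ^ (d + d') := Nat.pow_le_pow_right (by omega) (by omega)
  calc f D + g D ≤ c * (D + 1) ^ d + c' * (D + 1) ^ d' := add_le_add (h D) (h' D)
    _ ≤ c * (D + 1) ^ (d + d') + c' * (D + 1) ^ (d + d') := by gcongr
    _ = _ := by ring

theorem PolyBdd.loopCost {f g : ℕ → ℕ} (hf : PolyBdd f) (hg : PolyBdd g) :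
    PolyBdd fun D => loopCost (f D) (g D) :=
  (hf.mul (hg.add (polyBdd_const 10))).add (polyBdd_const 10)

/-! ### Elementary blocks -/

section Elementary

variable {α : Type u} {Γ : Type v}

/-- The list of trees that encodes a list over a type with an encoding `enc`. -/
def encL {β : Type*} (enc : β → Tree α Γ) (l : List β) : Tree α Γ := .ofList (l.map enc)

theorem encL_cons {β : Type*} (enc : β → Tree α Γ) (a : β) (l : List β) :
    encL enc (a :: l) = .cons (enc a) (encL enc l) := rfl

theorem ofProp_ne_nil {p : Prop} : (Tree.ofProp p : Tree α Γ) ≠ .nil ↔ p := by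
  unfold Tree.ofProp
  split_ifs with h <;> simp [h]

theorem ofProp_eq_nil {p : Prop} : (Tree.ofProp p : Tree α Γ) = .nil ↔ ¬ p := by
  unfold Tree.ofProp
  split_ifs with h <;> simp [h]

theorem ofProp_true : (Tree.ofProp True : Tree α Γ) = .cons .nil .nil := if_pos trivial

theorem ofProp_false : (Tree.ofProp False : Tree α Γ) = .nil := if_neg id

/-- The encoding `enc` turns equality into equality of leaves. -/
def Faithful {β : Type*} (enc : β → Tree α Γ) : Prop :=
  ∀ p q, (enc p).SameLeaf (enc q) ↔ p = q

theorem faithful_elt : Faithful (Tree.elt : α → Tree α Γ) := fun _ _ => Iff.rfl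

theorem faithful_grp : Faithful (Tree.grp : Γ → Tree α Γ) := fun _ _ => Iff.rfl

/-- Unary numbers. -/
def unary (n : ℕ) : Tree α Γ := .ofList (List.replicate n .nil)

theorem encL_id_replicate (n : ℕ) : encL id (List.replicate n .nil) = (unary n : Tree α Γ) := by
  simp [encL, unary]

theorem eltSet_ofElts (l : List α) : (Tree.ofElts l : Tree α Γ).eltSet = {x | x ∈ l} := by
  induction l with
  | nil => simp [Tree.ofElts, Tree.ofList, Tree.eltSet]
  | cons a l ih =>
    have : (Tree.ofElts (a :: l) : Tree α Γ).eltSet = insert a (Tree.ofElts l : Tree α Γ).eltSet :=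
      rfl
    rw [this, ih]
    ext; simp

variable [AddCommGroup Γ] {M : Matroid α} {ψ : α → Γ}

/-- Is the leaf in variable `x` a member of the list in variable `y`? -/
def memP (x y b : ℕ) : Prog :=
  foldP b y .nil (.ite (.eq (.var x) (.var (b + 2))) (.assign (b + 3) (.cons .nil .nil))
    (.assign (b + 3) (.var b)))

def memCost (D : ℕ) : ℕ := loopCost D 8

theorem foldl_or_eq {β : Type*} (a : β) (l : List β) (P : Prop) :
    l.foldl (fun P c => a = c ∨ P) P = (a ∈ l ∨ P) := by
  induction l generalizing P with
  | nil => simp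
  | cons c l ih => rw [List.foldl_cons, ih, List.mem_cons]; exact propext (by tauto)

theorem comp_mem {β : Type*} {enc : β → Tree α Γ} (henc : Faithful enc) {x y b D : ℕ}
    {s : ℕ → Tree α Γ} {a : β} {l : List β} (hx : s x = enc a) (hy : s y = encL enc l)
    (hxb : x < b) (hyb : y < b) (hD : l.length ≤ D) :
    Comp M ψ (memP x y b) b s (.ofProp (a ∈ l)) (memCost D) := by
  have := comp_fold (M := M) (ψ := ψ) (T := 8) Tree.ofProp enc (fun P c => a = c ∨ P) l False
    (init := .nil)
    (body := .ite (.eq (.var x) (.var (b + 2))) (.assign (b + 3) (.cons .nil .nil))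
      (.assign (b + 3) (.var b))) hy hyb (by simp [Expr.eval, ofProp_false]) (by simp [Expr.cost])
      hD ?_
  · simpa [foldl_or_eq, memP, memCost] using this
  intro pre c suf _ s' h1 h2 h3
  have he : (Expr.eq (.var x) (.var (b + 2))).eval M ψ s' = .ofProp (a = c) := by
    simp only [Expr.eval, h3 x hxb, h2, hx]
    rw [show ((enc a).SameLeaf (enc c)) = (a = c) from propext (henc a c)]
  refine (comp_ite (T := 4) (fun h => comp_assign _ _ _ ?_ (by simp [Expr.cost]))
    (fun h => comp_assign _ _ _ ?_ (by simp [Expr.cost]))).mono (by simp [Expr.cost])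
  · rw [he, ofProp_ne_nil] at h
    simp only [h, true_or, ofProp_true, Expr.eval]
  · rw [he, ofProp_eq_nil] at h
    simp only [h, false_or, Expr.eval, h1]

/-- The key `kf` turns an expression for an encoded `a` into one for the encoded `κ a`. -/
def IsKey {β γ : Type*} (M : Matroid α) (ψ : α → Γ) (enc : β → Tree α Γ) (enc' : γ → Tree α Γ)
    (κ : β → γ) (kf : Expr → Expr) : Prop :=
  (∀ i, (kf (.var i)).cost ≤ 2) ∧
    ∀ (s : ℕ → Tree α Γ) i a, s i = enc a → (kf (.var i)).eval M ψ s = enc' (κ a)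

theorem isKey_id {β : Type*} (enc : β → Tree α Γ) : IsKey M ψ enc enc id id :=
  ⟨fun i => by simp [Expr.cost], fun s i a h => h⟩

theorem isKey_lab : IsKey M ψ .elt .grp ψ .lab :=
  ⟨fun i => by simp [Expr.cost], fun s i a h => by simp [Expr.eval, h, labOp]⟩

/-- The entries of the list in `x` whose keys belong to the list in `y`, in reverse order. -/
def filterP (kf : Expr → Expr) (x y b : ℕ) : Prog :=
  foldP b x .nil (letP (b + 3) (.assign (b + 3) (kf (.var (b + 2))))
    (letP (b + 4) (memP (b + 3) y (b + 4)) (.ite (.var (b + 4))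
      (.assign (b + 5) (.cons (.var (b + 2)) (.var b))) (.assign (b + 5) (.var b)))))

def filterCost (D : ℕ) : ℕ := loopCost D (memCost D + 15)

theorem foldl_filter_cons {β : Type*} (p : β → Prop) [DecidablePred p] (l acc : List β) :
    l.foldl (fun acc a => if p a then a :: acc else acc) acc = (l.filter p).reverse ++ acc := by
  induction l generalizing acc with
  | nil => simp
  | cons a l ih =>
    rw [List.foldl_cons, ih]
    by_cases h : p a <;> simp [h]

open Classical in
theorem comp_filter {β γ : Type*} {enc : β → Tree α Γ} {enc' : γ → Tree α Γ} {κ : β → γ}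
    {kf : Expr → Expr} (hk : IsKey M ψ enc enc' κ kf) (henc : Faithful enc') {x y b D : ℕ}
    {s : ℕ → Tree α Γ} {l : List β} {S : List γ} (hx : s x = encL enc l) (hy : s y = encL enc' S)
    (hxb : x < b) (hyb : y < b) (hD : l.length ≤ D) (hD' : S.length ≤ D) :
    Comp M ψ (filterP kf x y b) b s (encL enc (l.filter fun a => κ a ∈ S).reverse)
      (filterCost D) := by
  have := comp_fold (M := M) (ψ := ψ) (T := memCost D + 15) (encL enc) enc
    (fun acc a => if κ a ∈ S then a :: acc else acc) l []
    (init := .nil) (body := letP (b + 3) (.assign (b + 3) (kf (.var (b + 2))))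
    (letP (b + 4) (memP (b + 3) y (b + 4)) (.ite (.var (b + 4))
      (.assign (b + 5) (.cons (.var (b + 2)) (.var b))) (.assign (b + 5) (.var b)))))
      hx hxb rfl (by simp [Expr.cost]) hD ?_
  · rwa [foldl_filter_cons, List.append_nil] at this
  intro pre c suf _ s' h1 h2 h3
  refine (comp_let (T₁ := 3) (T₂ := memCost D + 8)
    (comp_assign _ _ _ (hk.2 s' _ c h2) (by have := hk.1 (b + 2); omega)) ?_).mono (by omega)
  intro s₁ g1 g2
  refine (comp_let (T₂ := 6) (comp_mem henc (D := D) g1 (l := S)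
    (by rw [g2 y (by omega), h3 y hyb, hy]) (by omega) (by omega) hD') ?_).mono (by omega)
  intro s₂ k1 k2
  refine (comp_ite (T := 4) (fun h => comp_assign _ _ _ ?_ (by simp [Expr.cost]))
    (fun h => comp_assign _ _ _ ?_ (by simp [Expr.cost]))).mono (by simp [Expr.cost])
  · simp only [Expr.eval, k1, ofProp_ne_nil] at h
    simp only [Expr.eval, if_pos h, encL_cons]
    rw [k2 _ (by omega), g2 _ (by omega), h2, k2 _ (by omega), g2 _ (by omega), h1]
  · simp only [Expr.eval, k1, ofProp_eq_nil] at h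
    simp only [Expr.eval, if_neg h]
    rw [k2 _ (by omega), g2 _ (by omega), h1]

/-- A maximal independent subset of the list in `x`. -/
def greedyP (x b : ℕ) : Prog :=
  foldP b x .nil (.ite (.indep (.cons (.var (b + 2)) (.var b)))
    (.assign (b + 3) (.cons (.var (b + 2)) (.var b))) (.assign (b + 3) (.var b)))

def greedyCost (D : ℕ) : ℕ := loopCost D 9

open Classical in
/-- The greedy algorithm for a maximal independent subset. -/
def greedy (M : Matroid α) (l : List α) : List α :=
  l.foldl (fun acc e => if M.Indep {x | x ∈ e :: acc} then e :: acc else acc) []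

theorem comp_greedy {x b D : ℕ} {s : ℕ → Tree α Γ} {l : List α} (hx : s x = .ofElts l)
    (hxb : x < b) (hD : l.length ≤ D) :
    Comp M ψ (greedyP x b) b s (.ofElts (greedy M l)) (greedyCost D) := by
  classical
  refine comp_fold (M := M) (ψ := ψ) Tree.ofElts .elt _ l [] hx hxb rfl (by simp [Expr.cost])
    hD ?_
  intro pre c suf _ s' h1 h2 h3
  set acc := List.foldl (fun acc e => if M.Indep {x | x ∈ e :: acc} then e :: acc else acc) [] pre
  have he : (Expr.indep (.cons (.var (b + 2)) (.var b))).eval M ψ s'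
      = .ofProp (M.Indep {x | x ∈ c :: acc}) := by
    simp only [Expr.eval, h1, h2]
    rw [show Tree.cons (.elt c) (.ofElts acc) = (.ofElts (c :: acc) : Tree α Γ) from rfl,
      eltSet_ofElts]
  refine (comp_ite (T := 4) (fun h => comp_assign _ _ _ ?_ (by simp [Expr.cost]))
    (fun h => comp_assign _ _ _ ?_ (by simp [Expr.cost]))).mono (by simp [Expr.cost])
  · rw [he, ofProp_ne_nil] at h
    simp only [Expr.eval, if_pos h, h1, h2]
    rfl
  · rw [he, ofProp_eq_nil] at h
    simp only [Expr.eval, if_neg h, h1]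

/-- A rejected element lies in the closure of the elements accepted so far, so these remain a basis
of the elements seen. -/
theorem greedy_spec (l : List α) (hl : l.Nodup) (hE : {x | x ∈ l} ⊆ M.E) :
    (greedy M l).Nodup ∧ M.IsBasis {x | x ∈ greedy M l} {x | x ∈ l} := by
  classical
  induction l using List.reverseRecOn with
  | nil => simp [greedy]
  | append_singleton l e ih =>
    have hl' := List.nodup_append.1 hl
    obtain ⟨h1, h2⟩ := ih hl'.1 (fun x hx => hE (by simp at hx ⊢; exact Or.inl hx))
    have hel : e ∉ l := fun h => hl'.2.2 e h e (by simp) rfl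
    have heE : e ∈ M.E := hE (by simp)
    have hset : {x | x ∈ l ++ [e]} = insert e {x | x ∈ l} := by ext; simp; tauto
    have hstep : greedy M (l ++ [e]) = if M.Indep {x | x ∈ e :: greedy M l}
        then e :: greedy M l else greedy M l := by
      simp [greedy, List.foldl_append]
    have hcons : {x | x ∈ e :: greedy M l} = insert e {x | x ∈ greedy M l} := by ext; simp
    rw [hstep, hset]
    split_ifs with h
    · refine ⟨List.nodup_cons.2 ⟨fun hc => hel (h2.subset hc), h1⟩, ?_⟩
      rw [hcons] at h ⊢
      exact h2.insert_isBasis_insert h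
    · refine ⟨h1, ?_⟩
      rw [hcons] at h
      have hcl : e ∈ M.closure {x | x ∈ greedy M l} := by
        by_contra hc
        exact h (h2.indep.insert_indep_iff.2 (Or.inl ⟨heE, hc⟩))
      refine h2.indep.isBasis_of_subset_of_subset_closure
        (h2.subset.trans (subset_insert _ _)) (insert_subset hcl ?_)
      exact h2.subset_closure

theorem encard_setOf_mem {l : List α} (hl : l.Nodup) : {x | x ∈ l}.encard = l.length := by
  classical
  rw [← List.toFinset_card_of_nodup hl, ← encard_coe_eq_coe_finsetCard]
  congr 1
  ext; simp

theorem length_greedy (l : List α) (hl : l.Nodup) (hE : {x | x ∈ l} ⊆ M.E) :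
    ((greedy M l).length : ℕ∞) = M.eRk {x | x ∈ l} := by
  obtain ⟨h1, h2⟩ := greedy_spec l hl hE
  rw [← encard_setOf_mem h1, h2.encard_eq_eRk]

theorem length_greedy_le (l : List α) : (greedy M l).length ≤ l.length := by
  classical
  induction l using List.reverseRecOn with
  | nil => simp [greedy]
  | append_singleton l e ih =>
    have hstep : greedy M (l ++ [e]) = if M.Indep {x | x ∈ e :: greedy M l}
        then e :: greedy M l else greedy M l := by
      simp [greedy, List.foldl_append]
    rw [hstep]
    split_ifs <;> simp <;> omega

/-- The sum of the keys of the list in `x`. -/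
def sumP (kf : Expr → Expr) (x b : ℕ) : Prog :=
  foldP b x .zero (.assign (b + 3) (.add (.var b) (kf (.var (b + 2)))))

def sumCost (D : ℕ) : ℕ := loopCost D 6

theorem comp_sum {β : Type*} {enc : β → Tree α Γ} {κ : β → Γ} {kf : Expr → Expr}
    (hk : IsKey M ψ enc .grp κ kf) {x b D : ℕ} {s : ℕ → Tree α Γ} {l : List β}
    (hx : s x = encL enc l) (hxb : x < b) (hD : l.length ≤ D) :
    Comp M ψ (sumP kf x b) b s (.grp (l.map κ).sum) (sumCost D) := by
  have := comp_fold (M := M) (ψ := ψ) (T := 6) Tree.grp enc (fun acc a => acc + κ a) l 0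
    (init := .zero) (body := .assign (b + 3) (.add (.var b) (kf (.var (b + 2)))))
    hx hxb rfl (by simp [Expr.cost]) hD ?_
  · have hf : l.foldl (fun acc a => acc + κ a) 0 = (l.map κ).sum := by
      rw [List.sum_eq_foldl, List.foldl_map]
    rwa [hf] at this
  intro pre c suf _ s' h1 h2 h3
  refine comp_assign _ _ _ ?_ ?_
  · simp only [Expr.eval, h1, hk.2 s' _ c h2, addOp]
  · have := hk.1 (b + 2)
    simp only [Expr.cost]
    omega

/-- The labels of the list in `x`, in reverse order. -/
def labelsP (x b : ℕ) : Prog :=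
  foldP b x .nil (.assign (b + 3) (.cons (.lab (.var (b + 2))) (.var b)))

def labelsCost (D : ℕ) : ℕ := loopCost D 5

theorem comp_labels {x b D : ℕ} {s : ℕ → Tree α Γ} {l : List α} (hx : s x = .ofElts l)
    (hxb : x < b) (hD : l.length ≤ D) :
    Comp M ψ (labelsP x b) b s (.ofGrps (l.map ψ).reverse) (labelsCost D) := by
  have := comp_fold (M := M) (ψ := ψ) (T := 5) Tree.ofGrps .elt (fun acc a => ψ a :: acc) l []
    (init := .nil) (body := .assign (b + 3) (.cons (.lab (.var (b + 2))) (.var b)))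
    hx hxb rfl (by simp [Expr.cost]) hD ?_
  · have hf : l.foldl (fun acc a => ψ a :: acc) [] = (l.map ψ).reverse := by
      induction l using List.reverseRecOn with
      | nil => rfl
      | append_singleton l e ih => simp [List.foldl_append]
    rwa [hf] at this
  intro pre c suf _ s' h1 h2 h3
  refine comp_assign _ _ _ ?_ (by simp [Expr.cost])
  simp only [Expr.eval, h1, h2, labOp]
  rfl

/-- The distinct labels of the list in `x`. -/
def distinctP (x b : ℕ) : Prog :=
  foldP b x .nil (letP (b + 3) (.assign (b + 3) (.lab (.var (b + 2))))
    (letP (b + 4) (memP (b + 3) b (b + 4)) (.ite (.var (b + 4))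
      (.assign (b + 5) (.var b)) (.assign (b + 5) (.cons (.var (b + 3)) (.var b))))))

def distinctCost (D : ℕ) : ℕ := loopCost D (memCost D + 15)

open Classical in
/-- The distinct labels of a list of elements. -/
def distinctLabels {α Γ : Type*} (ψ : α → Γ) (l : List α) : List Γ :=
  l.foldl (fun acc e => if ψ e ∈ acc then acc else ψ e :: acc) []

open Classical in
theorem distinctLabels_spec {α Γ : Type*} (ψ : α → Γ) (l : List α) :
    (distinctLabels ψ l).Nodup ∧ (∀ g, g ∈ distinctLabels ψ l ↔ ∃ e ∈ l, ψ e = g) ∧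
      (distinctLabels ψ l).length ≤ l.length := by
  induction l using List.reverseRecOn with
  | nil => simp [distinctLabels]
  | append_singleton l e ih =>
    have hstep : distinctLabels ψ (l ++ [e]) = if ψ e ∈ distinctLabels ψ l
        then distinctLabels ψ l else ψ e :: distinctLabels ψ l := by
      rw [distinctLabels, List.foldl_append]
      rfl
    rw [hstep]
    obtain ⟨h1, h2, h3⟩ := ih
    split_ifs with h
    · refine ⟨h1, fun g => ?_, by simp; omega⟩
      rw [h2]
      constructor
      · rintro ⟨x, hx, rfl⟩; exact ⟨x, by simp [hx], rfl⟩
      · rintro ⟨x, hx, rfl⟩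
        rcases List.mem_append.1 hx with hx | hx
        · exact ⟨x, hx, rfl⟩
        · rw [List.mem_singleton.1 hx]; exact (h2 _).1 h
    · refine ⟨List.nodup_cons.2 ⟨h, h1⟩, fun g => ?_, by simp; omega⟩
      rw [List.mem_cons, h2]
      constructor
      · rintro (rfl | ⟨x, hx, rfl⟩)
        · exact ⟨e, by simp, rfl⟩
        · exact ⟨x, by simp [hx], rfl⟩
      · rintro ⟨x, hx, rfl⟩
        rcases List.mem_append.1 hx with hx | hx
        · exact Or.inr ⟨x, hx, rfl⟩
        · rw [List.mem_singleton.1 hx]; exact Or.inl rfl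

theorem comp_distinct {x b D : ℕ} {s : ℕ → Tree α Γ} {l : List α} (hx : s x = .ofElts l)
    (hxb : x < b) (hD : l.length ≤ D) :
    Comp M ψ (distinctP x b) b s (.ofGrps (distinctLabels ψ l)) (distinctCost D) := by
  classical
  refine comp_fold (M := M) (ψ := ψ) Tree.ofGrps .elt _ l [] hx hxb rfl (by simp [Expr.cost])
    hD ?_
  intro pre c suf hl s' h1 h2 h3
  change s' b = .ofGrps (distinctLabels ψ pre) at h1
  change Comp M ψ _ _ _ (.ofGrps (if ψ c ∈ distinctLabels ψ pre then _ else _)) _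
  have hlen : (distinctLabels ψ pre).length ≤ D := by
    refine (distinctLabels_spec ψ pre).2.2.trans (le_trans ?_ hD)
    simp [hl]
  refine (comp_let (T₁ := 3) (T₂ := memCost D + 8) (v := .grp (ψ c))
    (comp_assign _ _ _ (by simp [Expr.eval, h2, labOp]) (by simp [Expr.cost])) ?_).mono (by omega)
  intro s₁ g1 g2
  refine (comp_let (T₂ := 6) (comp_mem faithful_grp (D := D) g1 (l := distinctLabels ψ pre)
    (by rw [g2 b (by omega), h1]; rfl) (by omega) (by omega) hlen) ?_).mono (by omega)
  intro s₂ k1 k2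
  refine (comp_ite (T := 4) (fun h => comp_assign _ _ _ ?_ (by simp [Expr.cost]))
    (fun h => comp_assign _ _ _ ?_ (by simp [Expr.cost]))).mono (by simp [Expr.cost])
  · simp only [Expr.eval, k1, ofProp_ne_nil] at h
    simp only [Expr.eval, if_pos h]
    rw [k2 _ (by omega), g2 _ (by omega), h1]
    rfl
  · simp only [Expr.eval, k1, ofProp_eq_nil] at h
    simp only [Expr.eval, if_neg h]
    rw [k2 _ (by omega), g1, k2 _ (by omega), g2 _ (by omega), h1]
    rfl

/-- Is the list in `x` at most as long as the list in `y`? -/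
def leP (x y b : ℕ) : Prog :=
  letP b (foldP b x (.cons .nil (.var y)) (.assign (b + 3) (.tl (.var b))))
    (.ite (.var b) (.assign (b + 1) (.cons .nil .nil)) (.assign (b + 1) .nil))

def leCost (D : ℕ) : ℕ := loopCost D 3 + 8

theorem foldl_tl_eq_nil_iff {α : Type u} {Γ : Type v} {β : Type*} (l : List β) (m : List (Tree α Γ)) :
    l.foldl (fun acc _ => Tree.tl acc) (.ofList m) = (.nil : Tree α Γ) ↔ m.length ≤ l.length := by
  induction l generalizing m with
  | nil => cases m <;> simp [Tree.ofList]
  | cons a l ih =>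
    cases m with
    | nil => simpa [Tree.ofList, Tree.tl] using ih []
    | cons c m => simpa [Tree.ofList, Tree.tl] using ih m

theorem comp_le {β γ : Type*} {enc : β → Tree α Γ} {enc' : γ → Tree α Γ} {x y b D : ℕ}
    {s : ℕ → Tree α Γ} {l : List β} {m : List γ} (hx : s x = encL enc l) (hy : s y = encL enc' m)
    (hxb : x < b) (hD : l.length ≤ D) :
    Comp M ψ (leP x y b) b s (.ofProp (l.length ≤ m.length)) (leCost D) := by
  -- The second list gets one extra entry in front, so that an entry survives the |l| removals
  -- exactly when |l| ≤ |m|.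
  refine comp_let (T₂ := 6) (v := l.foldl (fun acc _ => Tree.tl acc)
    (.ofList (.nil :: m.map enc'))) ?_ ?_
  · refine comp_fold (M := M) (ψ := ψ) id enc (fun acc _ => Tree.tl acc) l _ hx hxb ?_
      (by simp [Expr.cost]) hD ?_
    · simp only [Expr.eval, hy, encL]; rfl
    · intro pre c suf _ s' h1 h2 h3
      exact comp_assign _ _ _ (by simp [Expr.eval, h1]) (by simp [Expr.cost])
  · intro s₁ g1 _
    refine (comp_ite (T := 4) (fun h => comp_assign _ _ _ ?_ (by simp [Expr.cost]))
      (fun h => comp_assign _ _ _ ?_ (by simp [Expr.cost]))).mono (by simp [Expr.cost])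
    · simp only [Expr.eval, g1, ne_eq, foldl_tl_eq_nil_iff] at h
      simp only [Expr.eval]
      rw [← ofProp_true]
      congr 1
      simp at h
      simpa using by omega
    · simp only [Expr.eval, g1, foldl_tl_eq_nil_iff] at h
      simp only [Expr.eval]
      rw [← ofProp_false]
      congr 1
      simp at h
      simpa using by omega

/-- Remove the leaf in `x` from the list in `y`, and reverse the order. -/
def removeP (x y b : ℕ) : Prog :=
  foldP b y .nil (.ite (.eq (.var (b + 2)) (.var x)) (.assign (b + 3) (.var b))
    (.assign (b + 3) (.cons (.var (b + 2)) (.var b))))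

def removeCost (D : ℕ) : ℕ := loopCost D 8

open Classical in
theorem comp_remove {β : Type*} {enc : β → Tree α Γ} (henc : Faithful enc) {x y b D : ℕ}
    {s : ℕ → Tree α Γ} {a : β} {l : List β} (hx : s x = enc a) (hy : s y = encL enc l)
    (hxb : x < b) (hyb : y < b) (hD : l.length ≤ D) :
    Comp M ψ (removeP x y b) b s (encL enc (l.filter fun c => c ≠ a).reverse) (removeCost D) := by
  have := comp_fold (M := M) (ψ := ψ) (T := 8) (encL enc) enc
    (fun acc c => if c ≠ a then c :: acc else acc) l []
    (init := .nil)
    (body := .ite (.eq (.var (b + 2)) (.var x)) (.assign (b + 3) (.var b))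
      (.assign (b + 3) (.cons (.var (b + 2)) (.var b)))) hy hyb rfl (by simp [Expr.cost])
      hD ?_
  · rwa [foldl_filter_cons, List.append_nil] at this
  intro pre c suf _ s' h1 h2 h3
  have he : (Expr.eq (.var (b + 2)) (.var x)).eval M ψ s' = .ofProp (c = a) := by
    simp only [Expr.eval, h3 x hxb, h2, hx]
    rw [show ((enc c).SameLeaf (enc a)) = (c = a) from propext (henc c a)]
  refine (comp_ite (T := 4) (fun h => comp_assign _ _ _ ?_ (by simp [Expr.cost]))
    (fun h => comp_assign _ _ _ ?_ (by simp [Expr.cost]))).mono (by simp [Expr.cost])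
  · rw [he, ofProp_ne_nil] at h
    simp only [h, ne_eq, not_true_eq_false, if_false, Expr.eval, h1]
  · rw [he, ofProp_eq_nil] at h
    simp only [if_pos h, Expr.eval, h1, h2, encL_cons]

end Elementary

/-! ### Enumeration of the lists near a given list -/

section Candidates

open Classical in
/-- One step of the replacement of the first `a` by `b`. -/
def substStep {β : Type*} (a b : β) (st : Bool × List β) (c : β) : Bool × List β :=
  if st.1 = true then (st.1, c :: st.2) else if c = a then (true, b :: st.2) else (false, c :: st.2)

/-- Replace the first `a` by `b`, and reverse the order. -/
def subst {β : Type*} (a b : β) (l : List β) : List β := (l.foldl (substStep a b) (false, [])).2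

theorem length_subst {β : Type*} (a b : β) (l : List β) : (subst a b l).length = l.length := by
  have : ∀ (l : List β) (st : Bool × List β),
      (l.foldl (substStep a b) st).2.length = l.length + st.2.length := by
    intro l
    induction l with
    | nil => simp
    | cons c l ih =>
      intro st
      rw [List.foldl_cons, ih]
      unfold substStep
      split_ifs <;> simp <;> omega
  simpa [subst] using this l (false, [])

theorem subst_eq_cons_erase {β : Type*} [DecidableEq β] {a b : β} {l : List β} (h : a ∈ l) :
    (subst a b l : Multiset β) = b ::ₘ (l : Multiset β).erase a := by
  have h1 : ∀ (l acc : List β), l.foldl (substStep a b) (true, acc) = (true, l.reverse ++ acc) := by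
    intro l
    induction l with
    | nil => simp
    | cons c l ih => intro acc; rw [List.foldl_cons, substStep, if_pos rfl, ih]; simp
  have h2 : ∀ (l acc : List β), a ∈ l → ((l.foldl (substStep a b) (false, acc)).2 : Multiset β)
      = b ::ₘ ((l : Multiset β).erase a + acc) := by
    intro l
    induction l with
    | nil => simp
    | cons c l ih =>
      intro acc hl
      rw [List.foldl_cons, substStep, if_neg (by simp)]
      by_cases hc : c = a
      · rw [if_pos hc, h1, hc]
        simp only [Multiset.coe_erase, List.erase_cons_head, Multiset.coe_add, Multiset.cons_coe,
          Multiset.coe_eq_coe]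
        refine List.perm_middle.trans (List.Perm.cons b ?_)
        exact (List.reverse_perm l).append_right acc
      · rw [if_neg hc, ih _ ((List.mem_cons.1 hl).resolve_left (Ne.symm hc)),
          ← Multiset.cons_coe, ← Multiset.cons_coe, Multiset.erase_cons_tail _ hc]
        simp
  simpa [subst] using h2 l [] h

/-- All lists of `V`, and all lists that arise by the replacement of one entry by one of `A`. -/
def nextLists {β : Type*} (A : List β) (V : List (List β)) : List (List β) :=
  V.foldl (fun acc W => A.foldl (fun acc a => A.foldl (fun acc b => subst a b W :: acc) acc) acc) V

theorem foldl_cons_map {β γ : Type*} (f : β → γ) (l : List β) (acc : List γ) :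
    l.foldl (fun acc b => f b :: acc) acc = (l.map f).reverse ++ acc := by
  induction l generalizing acc with
  | nil => simp
  | cons c l ih => rw [List.foldl_cons, ih]; simp

theorem foldl_append_flatMap {β γ : Type*} (f : β → List γ) (l : List β) (acc : List γ) :
    l.foldl (fun acc b => f b ++ acc) acc = (l.reverse.flatMap f) ++ acc := by
  induction l generalizing acc with
  | nil => simp
  | cons c l ih => rw [List.foldl_cons, ih]; simp

theorem nextLists_eq {β : Type*} (A : List β) (V : List (List β)) :
    nextLists A V = (V.reverse.flatMap fun W => A.reverse.flatMap fun a =>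
      (A.map fun b => subst a b W).reverse) ++ V := by
  unfold nextLists
  rw [← foldl_append_flatMap]
  congr 1
  funext acc W
  rw [← foldl_append_flatMap]
  congr 1
  funext acc a
  exact foldl_cons_map _ _ _

theorem mem_nextLists {β : Type*} {A : List β} {V : List (List β)} {W' : List β} :
    W' ∈ nextLists A V ↔ W' ∈ V ∨ ∃ W ∈ V, ∃ a ∈ A, ∃ b ∈ A, subst a b W = W' := by
  rw [nextLists_eq]
  simp [or_comm]

/-- A replacement is specified by two values from `A` and not by a position, so the growth factor
does not depend on the length of the lists. This bounds the number of label multisets independently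
of the rank. -/
theorem length_nextLists {β : Type*} (A : List β) (V : List (List β)) :
    (nextLists A V).length = V.length * (A.length ^ 2 + 1) := by
  rw [nextLists_eq]
  simp [List.length_flatMap, List.map_const', List.sum_replicate]
  ring

theorem length_iterate_nextLists {β : Type*} (A W : List β) (r : ℕ) :
    ((nextLists A)^[r] [W]).length = (A.length ^ 2 + 1) ^ r := by
  induction r with
  | zero => simp
  | succ r ih => rw [iterate_succ_apply', length_nextLists, ih]; exact (pow_succ _ _).symm

theorem length_of_mem_iterate_nextLists {β : Type*} {A W W' : List β} {r : ℕ}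
    (h : W' ∈ (nextLists A)^[r] [W]) : W'.length = W.length := by
  induction r generalizing W' with
  | zero => simp at h; rw [h]
  | succ r ih =>
    rw [iterate_succ_apply', mem_nextLists] at h
    rcases h with h | ⟨W₁, h, a, -, b, -, rfl⟩
    · exact ih h
    · rw [length_subst, ih h]

theorem mem_of_mem_iterate_nextLists {β : Type*} {A W W' : List β} {r : ℕ}
    (h : W' ∈ (nextLists A)^[r] [W]) (hW : ∀ x ∈ W, x ∈ A) : ∀ x ∈ W', x ∈ A := by
  have hs : ∀ (a b : β) (l : List β) (st : Bool × List β), b ∈ A → (∀ x ∈ l, x ∈ A) →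
      (∀ x ∈ st.2, x ∈ A) → ∀ x ∈ (l.foldl (substStep a b) st).2, x ∈ A := by
    intro a b l
    induction l with
    | nil => intro st _ _ h; exact h
    | cons c l ih =>
      intro st hb hl hst
      rw [List.foldl_cons]
      refine ih _ hb (fun x hx => hl x (by simp [hx])) ?_
      unfold substStep
      split_ifs <;> intro x hx <;> rcases List.mem_cons.1 hx with rfl | hx <;>
        first | exact hst x hx | exact hb | exact hl _ (by simp)
  induction r generalizing W' with
  | zero => simp at h; rwa [h]
  | succ r ih =>
    rw [iterate_succ_apply', mem_nextLists] at h
    rcases h with h | ⟨W₁, h, a, -, b, hb, rfl⟩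
    · exact ih h
    · exact hs a b W₁ _ hb (ih h) (by simp)

open Classical in
-- Replacing a value of which `W` has too many by one of which it has too few lowers the distance to
-- `T` by one. Lists matter only as multisets, so replacing the first occurrence is enough.
theorem exists_mem_iterate_nextLists {β : Type*} {A : List β} (T : Multiset β)
    (hT : ∀ x ∈ T, x ∈ A) (r : ℕ) :
    ∀ (V : List (List β)) (W : List β), W ∈ V → (∀ x ∈ W, x ∈ A) →
      Multiset.card T = W.length → Multiset.card ((W : Multiset β) - T) ≤ r →
      ∃ W' ∈ (nextLists A)^[r] V, (W' : Multiset β) = T := by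
  induction r with
  | zero =>
    intro V W hWV _ hc hr
    refine ⟨W, hWV, Multiset.eq_of_le_of_card_le ?_ (by simp [hc])⟩
    rw [← tsub_eq_zero_iff_le]
    exact Multiset.card_eq_zero.1 (by omega)
  | succ r ih =>
    intro V W hWV hWA hc hr
    rw [iterate_succ_apply]
    -- When `T` is reached early, `W` survives the remaining rounds because `nextLists` keeps the
    -- old lists.
    by_cases h0 : (W : Multiset β) - T = 0
    · exact ih _ W (mem_nextLists.2 (Or.inl hWV)) hWA hc (by simp [h0])
    obtain ⟨a, ha⟩ := Multiset.exists_mem_of_ne_zero h0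
    have h0' : T - (W : Multiset β) ≠ 0 := by
      intro h
      rw [tsub_eq_zero_iff_le] at h
      refine h0 (tsub_eq_zero_iff_le.2 (le_of_eq ?_))
      exact (Multiset.eq_of_le_of_card_le h (by simp [hc])).symm
    obtain ⟨b, hb⟩ := Multiset.exists_mem_of_ne_zero h0'
    have haW : a ∈ (W : Multiset β) := Multiset.mem_of_le tsub_le_self ha
    have hbT : b ∈ T := Multiset.mem_of_le tsub_le_self hb
    have hs : (subst a b W : Multiset β) = b ::ₘ (W : Multiset β).erase a :=
      subst_eq_cons_erase (by simpa using haW)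
    refine ih _ (subst a b W) (mem_nextLists.2 (Or.inr ⟨W, hWV, a, hWA a (by simpa using haW), b,
      hT b hbT, rfl⟩)) ?_ (by rw [length_subst, hc]) ?_
    · intro x hx
      have : x ∈ (subst a b W : Multiset β) := hx
      rw [hs, Multiset.mem_cons] at this
      rcases this with rfl | h
      · exact hT x hbT
      · exact hWA x (by simpa using Multiset.mem_of_mem_erase h)
    · have hle : (subst a b W : Multiset β) - T ≤ ((W : Multiset β) - T).erase a := by
        rw [Multiset.le_iff_count]
        intro x
        rw [hs, Multiset.count_sub, Multiset.count_cons]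
        have hb' : Multiset.count b (W : Multiset β) < Multiset.count b T := by
          have := Multiset.count_pos.2 hb
          rw [Multiset.count_sub] at this
          omega
        by_cases hxa : x = a
        · subst hxa
          rw [Multiset.count_erase_self, Multiset.count_erase_self, Multiset.count_sub]
          split_ifs with hxb
          · rw [hxb]; omega
          · omega
        · rw [Multiset.count_erase_of_ne hxa, Multiset.count_erase_of_ne hxa, Multiset.count_sub]
          split_ifs with hxb
          · rw [hxb]; omega
          · omega
      have h1 := Multiset.card_le_card hle
      rw [Multiset.card_erase_of_mem ha, Nat.pred_eq_sub_one] at h1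
      have h2 := Multiset.card_pos.2 h0
      omega

/-! ### Programs for the enumeration. -/

variable {α : Type u} {Γ : Type v} [AddCommGroup Γ] {M : Matroid α} {ψ : α → Γ}

theorem eval_cons (e e' : Expr) (s : ℕ → Tree α Γ) :
    (Expr.cons e e').eval M ψ s = .cons (e.eval M ψ s) (e'.eval M ψ s) := rfl

/-- Replace the first occurrence of the leaf in `x` by the leaf in `y` in the list in `w`. -/
def substP (x y w b : ℕ) : Prog :=
  letP b (foldP b w (.cons .nil .nil)
    (.ite (.hd (.var b))
      (.assign (b + 3) (.cons (.hd (.var b)) (.cons (.var (b + 2)) (.tl (.var b)))))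
      (.ite (.eq (.var (b + 2)) (.var x))
        (.assign (b + 3) (.cons (.cons .nil .nil) (.cons (.var y) (.tl (.var b)))))
        (.assign (b + 3) (.cons .nil (.cons (.var (b + 2)) (.tl (.var b))))))))
    (.assign (b + 1) (.tl (.var b)))

def substCost (D : ℕ) : ℕ := loopCost D 17 + 5

theorem comp_subst {β : Type*} {enc : β → Tree α Γ} (henc : Faithful enc) {x y w b D : ℕ}
    {s : ℕ → Tree α Γ} {a c : β} {l : List β} (hx : s x = enc a) (hy : s y = enc c)
    (hw : s w = encL enc l) (hxb : x < b) (hyb : y < b) (hwb : w < b) (hD : l.length ≤ D) :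
    Comp M ψ (substP x y w b) b s (encL enc (subst a c l)) (substCost D) := by
  classical
  let encS : Bool × List β → Tree α Γ := fun st => .cons (.ofProp (st.1 = true)) (encL enc st.2)
  refine comp_let (T₁ := loopCost D 17) (T₂ := 3)
    (v := encS (l.foldl (substStep a c) (false, []))) ?_ ?_
  · refine comp_fold encS enc (substStep a c) l _ hw hwb ?_ (by simp [Expr.cost]) hD ?_
    · simp only [Expr.eval, encS, Bool.false_eq_true, ofProp_false]
      rfl
    intro pre d suf _ s' h1 h2 h3
    set st := pre.foldl (substStep a c) (false, []) with hst
    have hhd : (Expr.hd (.var b)).eval M ψ s' = .ofProp (st.1 = true) := by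
      simp only [Expr.eval, h1]; rfl
    have htl : (Expr.tl (.var b)).eval M ψ s' = encL enc st.2 := by
      simp only [Expr.eval, h1]; rfl
    have heq : (Expr.eq (.var (b + 2)) (.var x)).eval M ψ s' = .ofProp (d = a) := by
      simp only [Expr.eval, h3 x hxb, h2, hx]
      rw [show ((enc d).SameLeaf (enc a)) = (d = a) from propext (henc d a)]
    refine (comp_ite (T := 14) (fun h => comp_assign _ _ _ ?_ (by simp [Expr.cost]))
      (fun h => (comp_ite (T := 10) (fun h' => comp_assign _ _ _ ?_ (by simp [Expr.cost]))
        (fun h' => comp_assign _ _ _ ?_ (by simp [Expr.cost]))).mono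
          (by simp [Expr.cost]))).mono (by simp [Expr.cost])
    · rw [hhd, ofProp_ne_nil] at h
      rw [Expr.eval, hhd, Expr.eval, htl, Expr.eval, h2, substStep, if_pos h]
      rfl
    · rw [hhd, ofProp_eq_nil] at h
      rw [heq, ofProp_ne_nil] at h'
      simp only [eval_cons, htl]
      rw [Expr.eval, h3 y hyb, hy, substStep, if_neg h, if_pos h']
      simp only [encS, ofProp_true, encL_cons, Expr.eval]
    · rw [hhd, ofProp_eq_nil] at h
      rw [heq, ofProp_eq_nil] at h'
      simp only [eval_cons, htl]
      rw [Expr.eval, Expr.eval, h2, substStep, if_neg h, if_neg h']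
      simp only [encS, Bool.false_eq_true, ofProp_false, encL_cons]
  · intro s₁ g1 _
    exact comp_assign _ _ _ (by simp only [Expr.eval, g1]; rfl) (by simp [Expr.cost])

/-- One round of the enumeration, for the atoms in `x` and the lists in `y`. -/
def nextP (x y b : ℕ) : Prog :=
  foldP b y (.var y) (foldP (b + 3) x (.var b) (foldP (b + 6) x (.var (b + 3))
    (letP (b + 9) (substP (b + 5) (b + 8) (b + 2) (b + 9))
      (.assign (b + 10) (.cons (.var (b + 9)) (.var (b + 6)))))))

def nextCost (D : ℕ) : ℕ := loopCost D (loopCost D (loopCost D (substCost D + 6)))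

theorem comp_next {β : Type*} {enc : β → Tree α Γ} (henc : Faithful enc) {x y b D : ℕ}
    {s : ℕ → Tree α Γ} {A : List β} {V : List (List β)} (hx : s x = encL enc A)
    (hy : s y = encL (encL enc) V) (hxb : x < b) (hyb : y < b) (hA : A.length ≤ D)
    (hV : V.length ≤ D) (hVD : ∀ W ∈ V, W.length ≤ D) :
    Comp M ψ (nextP x y b) b s (encL (encL enc) (nextLists A V)) (nextCost D) := by
  -- Three nested folds, each inner one starting from the accumulator of the outer one: `b + 2`
  -- holds the list, `b + 5` the value to be replaced and `b + 8` its replacement.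
  refine comp_fold (encL (encL enc)) (encL enc) _ V V hy hyb hy (by simp [Expr.cost]) hV ?_
  intro pre W suf hl s₁ h1 h2 h3
  have hW : W.length ≤ D := hVD W (by simp [hl])
  refine comp_fold (encL (encL enc)) enc _ A _ (by rw [h3 x hxb, hx]; rfl) (by omega)
    (by simp only [Expr.eval, h1]) (by simp [Expr.cost]) hA ?_
  intro pre' a suf' _ s₂ g1 g2 g3
  refine comp_fold (encL (encL enc)) enc _ A _
    (by rw [g3 x (by omega), h3 x hxb, hx]; rfl) (by omega)
    (by simp only [Expr.eval, g1]) (by simp [Expr.cost]) hA ?_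
  intro pre'' c suf'' _ s₃ k1 k2 k3
  refine (comp_let (T₂ := 4) (comp_subst henc (D := D) (a := a) (c := c) (l := W)
    (by rw [k3 _ (by omega), g2]) k2 (by rw [k3 _ (by omega), g3 _ (by omega), h2])
    (by omega) (by omega) (by omega) hW) ?_)
  intro s₄ m1 m2
  refine comp_assign _ _ _ ?_ (by simp [Expr.cost])
  simp only [Expr.eval, m1]
  rw [m2 _ (by omega), k1, encL_cons]

/-- The lists that arise from the list in `w` by replacements with atoms in `x`, where the number
of rounds is the length of the list in `r`. -/
def candidatesP (x w r b : ℕ) : Prog :=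
  foldP b r (.cons (.var w) .nil) (nextP x b (b + 3))

def candidatesCost (D : ℕ) : ℕ := loopCost D (nextCost D)

theorem comp_candidates {β : Type*} {enc : β → Tree α Γ} (henc : Faithful enc) {x w r b n D : ℕ}
    {s : ℕ → Tree α Γ} {A W : List β} (hx : s x = encL enc A)
    (hw : s w = encL enc W) (hr : s r = unary n) (hxb : x < b) (hrb : r < b)
    (hA : A.length ≤ D) (hW : W.length ≤ D) (hn : n ≤ D)
    (hV : (A.length ^ 2 + 1) ^ n ≤ D) :
    Comp M ψ (candidatesP x w r b) b s (encL (encL enc) ((nextLists A)^[n] [W]))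
      (candidatesCost D) := by
  have := comp_fold (M := M) (ψ := ψ) (T := nextCost D) (encL (encL enc)) id
    (fun V _ => nextLists A V) (List.replicate n .nil) [W]
    (init := .cons (.var w) .nil) (body := nextP x b (b + 3))
    (hr.trans (encL_id_replicate n).symm) hrb (by simp only [Expr.eval, hw]; rfl)
    (by simp [Expr.cost]) (by simpa using hn) ?_
  · rwa [List.foldl_const, List.length_replicate] at this
  intro pre d suf hl s' h1 h2 h3
  have hlen : pre.length ≤ n := by
    have := congrArg List.length hl
    simp at this
    omega
  rw [List.foldl_const] at h1 ⊢
  refine comp_next henc (by rw [h3 x hxb, hx]) h1 (by omega) (by omega) hA ?_ ?_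
  · rw [length_iterate_nextLists]
    exact (Nat.pow_le_pow_right (by omega) hlen).trans hV
  · intro W' hW'
    rw [length_of_mem_iterate_nextLists hW']
    exact hW

end Candidates

/-! ### Sublists -/

section Sublists

/-- All sublists of a list, up to the order of entries. -/
def subsets {β : Type*} (l : List β) : List (List β) :=
  l.foldl (fun V a => V.foldl (fun acc S => (a :: S) :: acc) V) [[]]

theorem subsets_append_singleton {β : Type*} (l : List β) (a : β) :
    subsets (l ++ [a]) = ((subsets l).map (a :: ·)).reverse ++ subsets l := by
  rw [subsets, List.foldl_append, List.foldl_cons, List.foldl_nil, foldl_cons_map]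
  rfl

theorem length_subsets {β : Type*} (l : List β) : (subsets l).length = 2 ^ l.length := by
  induction l using List.reverseRecOn with
  | nil => simp [subsets]
  | append_singleton l a ih =>
    rw [subsets_append_singleton]
    simp [ih, pow_succ]
    omega

theorem length_le_of_mem_subsets {β : Type*} {l S : List β} (h : S ∈ subsets l) :
    S.length ≤ l.length := by
  induction l using List.reverseRecOn generalizing S with
  | nil => simp [subsets] at h; simp [h]
  | append_singleton l a ih =>
    rw [subsets_append_singleton] at h
    simp at h
    rcases h with ⟨S, hS, rfl⟩ | h
    · have := ih hS; simp; omega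
    · have := ih h; simp; omega

theorem mem_of_mem_subsets {β : Type*} {l S : List β} (h : S ∈ subsets l) : ∀ x ∈ S, x ∈ l := by
  induction l using List.reverseRecOn generalizing S with
  | nil => simp [subsets] at h; simp [h]
  | append_singleton l a ih =>
    rw [subsets_append_singleton] at h
    simp at h
    intro x hx
    rcases h with ⟨S, hS, rfl⟩ | h
    · rcases List.mem_cons.1 hx with rfl | hx
      · simp
      · simp [ih hS x hx]
    · simp [ih h x hx]

theorem exists_mem_subsets {β : Type*} (l : List β) (S : Set β) :
    ∃ L ∈ subsets l, ∀ x, x ∈ L ↔ x ∈ l ∧ x ∈ S := by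
  induction l using List.reverseRecOn with
  | nil => exact ⟨[], by simp [subsets], by simp⟩
  | append_singleton l a ih =>
    obtain ⟨L, hL, h⟩ := ih
    rw [subsets_append_singleton]
    by_cases ha : a ∈ S
    · refine ⟨a :: L, by simp [hL], fun x => ?_⟩
      simp only [List.mem_cons, List.mem_append, h, List.not_mem_nil, or_false]
      constructor
      · rintro (rfl | h')
        · exact ⟨Or.inr rfl, ha⟩
        · exact ⟨Or.inl h'.1, h'.2⟩
      · rintro ⟨h1 | h1, h2⟩
        · exact Or.inr ⟨h1, h2⟩
        · exact Or.inl h1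
    · refine ⟨L, by simp [hL], fun x => ?_⟩
      simp only [List.mem_append, h, List.mem_cons, List.not_mem_nil, or_false]
      constructor
      · rintro ⟨h1, h2⟩; exact ⟨Or.inl h1, h2⟩
      · rintro ⟨h1 | rfl, h2⟩
        · exact ⟨h1, h2⟩
        · exact absurd h2 ha

variable {α : Type u} {Γ : Type v} [AddCommGroup Γ] {M : Matroid α} {ψ : α → Γ}

/-- The sublists of the list in `x`. -/
def subsetsP (x b : ℕ) : Prog :=
  foldP b x (.cons .nil .nil) (foldP (b + 3) b (.var b)
    (.assign (b + 6) (.cons (.cons (.var (b + 2)) (.var (b + 5))) (.var (b + 3)))))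

def subsetsCost (D : ℕ) : ℕ := loopCost D (loopCost D 6)

theorem comp_subsets {β : Type*} {enc : β → Tree α Γ} {x b D : ℕ}
    {s : ℕ → Tree α Γ} {l : List β} (hx : s x = encL enc l) (hxb : x < b)
    (hD : 2 ^ l.length ≤ D) :
    Comp M ψ (subsetsP x b) b s (encL (encL enc) (subsets l)) (subsetsCost D) := by
  refine comp_fold (encL (encL enc)) enc _ l _ hx hxb rfl (by simp [Expr.cost])
    ((Nat.lt_two_pow_self).le.trans hD) ?_
  intro pre a suf hl s₁ h1 h2 h3
  change s₁ b = encL (encL enc) (subsets pre) at h1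
  refine comp_fold (encL (encL enc)) (encL enc) _ (subsets pre) _ h1 (by omega)
    (by simp only [Expr.eval, h1]; rfl) (by simp [Expr.cost]) ?_ ?_
  · rw [length_subsets]
    refine (Nat.pow_le_pow_right (by omega) ?_).trans hD
    simp [hl]
  intro pre' S suf' _ s₂ g1 g2 g3
  refine comp_assign _ _ _ ?_ (by simp [Expr.cost])
  simp only [Expr.eval, g1, g2]
  rw [g3 _ (by omega), h2]
  rfl

end Sublists

/-! ### Unary arithmetic -/

section Unary

variable {α : Type u} {Γ : Type v} [AddCommGroup Γ] {M : Matroid α} {ψ : α → Γ}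

/-- The list in `x`, extended at the front by `n` entries. -/
def nilsE (n : ℕ) (e : Expr) : Expr := (Expr.cons .nil)^[n] e

theorem cost_nilsE (n : ℕ) (e : Expr) : (nilsE n e).cost = 2 * n + e.cost := by
  induction n with
  | zero => simp [nilsE]
  | succ n ih =>
    rw [nilsE, iterate_succ_apply', Expr.cost, ← nilsE, ih]
    simp only [Expr.cost]; omega

theorem eval_nilsE (n m : ℕ) (e : Expr) (s : ℕ → Tree α Γ) (h : e.eval M ψ s = unary m) :
    (nilsE n e).eval M ψ s = unary (m + n) := by
  induction n with
  | zero => exact h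
  | succ n ih =>
    rw [nilsE, iterate_succ_apply', Expr.eval, ← nilsE, ih]
    rfl

/-- The sum of the unary numbers in `x` and `y`. -/
def addP (x y b : ℕ) : Prog := foldP b x (.var y) (.assign (b + 3) (nilsE 1 (.var b)))

def addCost (D : ℕ) : ℕ := loopCost D 4

theorem comp_add {x y b m n D : ℕ} {s : ℕ → Tree α Γ} (hx : s x = unary m) (hy : s y = unary n)
    (hxb : x < b) (hm : m ≤ D) :
    Comp M ψ (addP x y b) b s (unary (n + m)) (addCost D) := by
  have := comp_fold (M := M) (ψ := ψ) (T := 4) unary id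
    (fun n _ => n + 1) (List.replicate m .nil) n
    (init := .var y) (body := .assign (b + 3) (nilsE 1 (.var b)))
    (hx.trans (encL_id_replicate m).symm) hxb (by simp only [Expr.eval, hy])
    (by simp [Expr.cost]) (by simpa using hm) ?_
  · have hf : ∀ m n : ℕ, (fun n => n + 1)^[m] n = n + m := fun m => by
      induction m with
      | zero => simp
      | succ m ih => intro n; rw [iterate_succ_apply', ih]; omega
    rwa [List.foldl_const, List.length_replicate, hf] at this
  intro pre d suf _ s' h1 h2 h3
  exact comp_assign _ _ _ (eval_nilsE _ _ _ _ h1) (by rw [cost_nilsE]; simp [Expr.cost])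

/-- The product of the unary number in `x` and the constant `Q`. -/
def mulP (Q x b : ℕ) : Prog := foldP b x .nil (.assign (b + 3) (nilsE Q (.var b)))

def mulCost (Q D : ℕ) : ℕ := loopCost D (2 * Q + 2)

theorem comp_mul {Q x b m D : ℕ} {s : ℕ → Tree α Γ} (hx : s x = unary m) (hxb : x < b)
    (hm : m ≤ D) : Comp M ψ (mulP Q x b) b s (unary (m * Q)) (mulCost Q D) := by
  have := comp_fold (M := M) (ψ := ψ) (T := 2 * Q + 2) unary id
    (fun n _ => n + Q) (List.replicate m .nil) 0
    (init := .nil) (body := .assign (b + 3) (nilsE Q (.var b)))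
    (hx.trans (encL_id_replicate m).symm) hxb rfl
    (by simp [Expr.cost]) (by simpa using hm) ?_
  · have hf : ∀ m : ℕ, (fun n => n + Q)^[m] 0 = m * Q := fun m => by
      induction m with
      | zero => simp
      | succ m ih => rw [iterate_succ_apply', ih]; ring
    rwa [List.foldl_const, List.length_replicate, hf] at this
  intro pre d suf _ s' h1 h2 h3
  exact comp_assign _ _ _ (eval_nilsE _ _ _ _ h1) (by rw [cost_nilsE]; simp [Expr.cost])

/-- The number `2 * Q ^ n`, where `n` is the unary number in `x`. -/
def powP (Q x b : ℕ) : Prog := foldP b x (nilsE 2 .nil) (mulP Q b (b + 3))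

def powCost (Q D : ℕ) : ℕ := loopCost D (mulCost Q D)

theorem comp_pow {Q x b n D : ℕ} {s : ℕ → Tree α Γ} (hx : s x = unary n) (hxb : x < b)
    (hQ : 0 < Q) (hn : n ≤ D) (hD : 2 * Q ^ n ≤ D) :
    Comp M ψ (powP Q x b) b s (unary (2 * Q ^ n)) (powCost Q D) := by
  have hf : ∀ m : ℕ, (fun n => n * Q)^[m] 2 = 2 * Q ^ m := fun m => by
    induction m with
    | zero => simp
    | succ m ih => rw [iterate_succ_apply', ih]; ring
  have := comp_fold (M := M) (ψ := ψ) (T := mulCost Q D) unary id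
    (fun m _ => m * Q) (List.replicate n .nil) 2
    (init := nilsE 2 .nil) (body := mulP Q b (b + 3))
    (hx.trans (encL_id_replicate n).symm) hxb rfl
    (by rw [cost_nilsE]; simp [Expr.cost]) (by simpa using hn) ?_
  · rwa [List.foldl_const, List.length_replicate, hf] at this
  intro pre d suf hl s' h1 h2 h3
  have hlen : pre.length ≤ n := by
    have := congrArg List.length hl
    simp at this
    omega
  refine comp_mul h1 (by omega) ?_
  rw [List.foldl_const, hf]
  exact le_trans (by gcongr) hD

/-- The product of the unary number in `y` and the order of the group element in `x`. -/
def orderP (x y b : ℕ) : Prog :=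
  .seq (.assign b (.var y)) (.seq (.assign (b + 1) (.var x))
    (.while (.eq (.eq (.var (b + 1)) .zero) .nil)
      (.seq (addP y b (b + 2)) (.seq (.assign b (.var (b + 2)))
        (.assign (b + 1) (.add (.var (b + 1)) (.var x)))))))

def orderCost (D : ℕ) : ℕ := D * (addCost D + 20) + 20

/-- `k` counts the additions still to be made and `j + 1` the multiple of `g` already reached. The
outer comparison with `nil` negates the test for zero, since a pair is never the same leaf as `nil`.
-/
theorem comp_order_aux {x y b m D : ℕ} {s : ℕ → Tree α Γ} {g : Γ} (hx : s x = .grp g)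
    (hy : s y = unary m) (hxb : x < b) (hyb : y < b) (hm : m ≤ D) (k : ℕ) :
    ∀ (j : ℕ) (s' : ℕ → Tree α Γ), j + k + 1 = addOrderOf g → s' b = unary (m * (j + 1)) →
      s' (b + 1) = .grp ((j + 1) • g) → (∀ i < b, s' i = s i) →
      ∃ t s'', Run M ψ (.while (.eq (.eq (.var (b + 1)) .zero) .nil)
        (.seq (addP y b (b + 2)) (.seq (.assign b (.var (b + 2)))
          (.assign (b + 1) (.add (.var (b + 1)) (.var x)))))) s' t s'' ∧
        t ≤ k * (addCost D + 20) + 10 ∧ s'' b = unary (m * addOrderOf g) ∧ ∀ i < b, s'' i = s i := by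
  induction k with
  | zero =>
    intro j s' hj h1 h2 h3
    have hz : (j + 1) • g = 0 := by
      rw [show j + 1 = addOrderOf g from by omega]; exact addOrderOf_nsmul_eq_zero g
    refine ⟨_, s', Run.while_false ?_, by simp [Expr.cost], ?_, h3⟩
    · simp only [Expr.eval, h2, hz]
      rw [ofProp_eq_nil, show ((Tree.grp (0 : Γ) : Tree α Γ).SameLeaf (.grp 0)) = True from
        eq_true rfl, ofProp_true]
      exact id
    · rw [h1, show j + 1 = addOrderOf g from by omega]
  | succ k ih =>
    intro j s' hj h1 h2 h3
    have hz : (j + 1) • g ≠ 0 := fun hc => by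
      have := Nat.le_of_dvd (by omega) (addOrderOf_dvd_of_nsmul_eq_zero hc)
      omega
    obtain ⟨t, s₁, g1, g2, g3, g4⟩ := comp_add (M := M) (ψ := ψ) (b := b + 2) (D := D) (s := s')
      ((h3 y hyb).trans hy) h1 (by omega) hm
    let s₂ := update s₁ b (s₁ (b + 2))
    have hs2 : ∀ i < b, s₂ i = s i := fun i hi => by
      simp only [s₂]
      rw [update_of_ne hi.ne, g4 i (by omega), h3 i hi]
    let s₃ := update s₂ (b + 1) ((Expr.add (.var (b + 1)) (.var x)).eval M ψ s₂)
    obtain ⟨t', s₄, k1, k2, k3, k4⟩ := ih (j + 1) s₃ (by omega)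
      (by
        simp only [s₃, s₂]
        rw [update_of_ne (by omega), update_self, g3]
        congr 1)
      (by
        simp only [s₃]
        rw [update_self]
        simp only [Expr.eval]
        rw [hs2 x hxb, hx]
        simp only [s₂]
        rw [update_of_ne (by omega), g4 _ (by omega), h2]
        simp only [addOp]
        rw [succ_nsmul g (j + 1)])
      (fun i hi => by simp only [s₃]; rw [update_of_ne (by omega), hs2 i hi])
    refine ⟨_, s₄, Run.while_true ?_ (Run.seq g1 (Run.seq (Run.assign _ _ _) (Run.assign _ _ _)))
      k1, ?_, k3, k4⟩
    · simp only [Expr.eval, h2]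
      rw [ofProp_ne_nil, show ((Tree.grp ((j + 1) • g) : Tree α Γ).SameLeaf (.grp 0)) = False from
        eq_false hz, ofProp_false]
      trivial
    · simp only [Expr.cost]
      rw [add_mul]
      omega

theorem comp_order {x y b m D : ℕ} {s : ℕ → Tree α Γ} {g : Γ} (hx : s x = .grp g)
    (hy : s y = unary m) (hxb : x < b) (hyb : y < b) (hm : m ≤ D) (hg : 0 < addOrderOf g)
    (hg' : addOrderOf g ≤ D) :
    Comp M ψ (orderP x y b) b s (unary (m * addOrderOf g)) (orderCost D) := by
  let s₁ := update s b (unary m)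
  let s₂ := update s₁ (b + 1) (.grp g)
  have r1 : Run M ψ (.assign b (.var y)) s 2 s₁ := by
    have := Run.assign (M := M) (ψ := ψ) b (.var y) s
    simpa [Expr.eval, hy, Expr.cost] using this
  have r2 : Run M ψ (.assign (b + 1) (.var x)) s₁ 2 s₂ := by
    have := Run.assign (M := M) (ψ := ψ) (b + 1) (.var x) s₁
    have hv : s₁ x = .grp g := by
      rw [← hx]; exact update_of_ne (by omega) _ _
    simpa [Expr.eval, hv, Expr.cost] using this
  obtain ⟨t, s', h1, h2, h3, h4⟩ := comp_order_aux (M := M) (ψ := ψ) hx hy hxb hyb hm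
    (addOrderOf g - 1) 0 s₂ (by omega)
    (by simp only [s₂, s₁]; rw [update_of_ne (by omega), update_self]; simp)
    (by simp [s₂])
    (fun i hi => by simp only [s₂, s₁]; rw [update_of_ne (by omega), update_of_ne hi.ne])
  refine ⟨_, s', Run.seq r1 (Run.seq r2 h1), ?_, h3, h4⟩
  have : (addOrderOf g - 1) * (addCost D + 20) ≤ D * (addCost D + 20) :=
    Nat.mul_le_mul_right _ (by omega)
  unfold orderCost
  omega

/-- The product of the orders of the group elements in the list in `x`. -/
def ordersP (x b : ℕ) : Prog := foldP b x (nilsE 1 .nil) (orderP (b + 2) b (b + 3))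

def ordersCost (D : ℕ) : ℕ := loopCost D (orderCost D)

theorem prod_addOrderOf_le [Finite Γ] (l : List Γ) :
    (l.map addOrderOf).prod ≤ Nat.card Γ ^ l.length := by
  induction l with
  | nil => simp
  | cons g l ih =>
    rw [List.map_cons, List.prod_cons, List.length_cons, pow_succ']
    exact Nat.mul_le_mul (Nat.le_of_dvd Nat.card_pos (addOrderOf_dvd_natCard g)) ih

/-- The input does not contain the order of `Γ`. The product of the orders of the occurring labels
is a computable substitute, and is at most |Γ|^|l|. -/
theorem comp_orders [Finite Γ] {x b D : ℕ} {s : ℕ → Tree α Γ} {l : List Γ} (hx : s x = .ofGrps l)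
    (hxb : x < b) (hl : l.length ≤ D) (hD : Nat.card Γ ^ l.length ≤ D) (hΓ : Nat.card Γ ≤ D) :
    Comp M ψ (ordersP x b) b s (unary (l.map addOrderOf).prod) (ordersCost D) := by
  have hf : ∀ l : List Γ, l.foldl (fun n g => n * addOrderOf g) 1 = (l.map addOrderOf).prod := by
    intro l
    rw [List.prod_eq_foldl, List.foldl_map]
  have := comp_fold (M := M) (ψ := ψ) (T := orderCost D) unary .grp
    (fun n g => n * addOrderOf g) l 1
    (init := nilsE 1 .nil) (body := orderP (b + 2) b (b + 3)) hx hxb rfl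
    (by rw [cost_nilsE]; simp [Expr.cost]) hl ?_
  · rwa [hf] at this
  intro pre g suf hpre s' h1 h2 h3
  refine comp_order h2 h1 (by omega) (by omega) ?_ (addOrderOf_pos g)
    ((Nat.le_of_dvd Nat.card_pos (addOrderOf_dvd_natCard g)).trans hΓ)
  rw [hf]
  refine (prod_addOrderOf_le pre).trans ((Nat.pow_le_pow_right Nat.card_pos ?_).trans hD)
  simp [hpre]

end Unary

/-! ### Auxiliary facts for the two algorithms -/

section Auxiliary

variable {α : Type u} {Γ : Type v}

/-- The encoding of a possible answer. -/
def encO {β : Type*} (enc : β → Tree α Γ) : Option β → Tree α Γ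
  | none => .nil
  | some a => .cons .nil (enc a)

open Classical in
/-- The value of `g` at the last entry of a list that satisfies `p`. -/
def lastSome {β γ : Type*} (p : β → Prop) (g : β → γ) (l : List β) : Option γ :=
  l.foldl (fun acc a => if p a then some (g a) else acc) none

theorem lastSome_spec {β γ : Type*} (p : β → Prop) (g : β → γ) (l : List β) :
    (lastSome p g l = none ∧ ∀ a ∈ l, ¬ p a) ∨ ∃ a ∈ l, p a ∧ lastSome p g l = some (g a) := by
  classical
  induction l using List.reverseRecOn with
  | nil => simp [lastSome]
  | append_singleton l a ih =>
    have hstep : lastSome p g (l ++ [a]) = if p a then some (g a) else lastSome p g l := by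
      rw [lastSome, List.foldl_append]
      rfl
    rw [hstep]
    by_cases ha : p a
    · exact Or.inr ⟨a, by simp, ha, if_pos ha⟩
    · rw [if_neg ha]
      rcases ih with ⟨h1, h2⟩ | ⟨c, hc, h1, h2⟩
      · left
        refine ⟨h1, fun c hc => ?_⟩
        rcases List.mem_append.1 hc with hc | hc
        · exact h2 c hc
        · rwa [List.mem_singleton.1 hc]
      · exact Or.inr ⟨c, by simp [hc], h1, h2⟩

theorem label_setOf_mem [AddCommGroup Γ] (ψ : α → Γ) {L : List α} (hL : L.Nodup) :
    label ψ {x | x ∈ L} = (L.map ψ).sum := by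
  classical
  have : {x | x ∈ L} = (L.toFinset : Set α) := by ext; simp
  rw [this, label_eq_sum, List.sum_toFinset _ hL]

theorem isBase_of_length_le {M : Matroid α} {L L' : List α} (hL : L.Nodup) (hL' : L'.Nodup)
    (hI : M.Indep {x | x ∈ L}) (hB : M.IsBase {x | x ∈ L'}) (h : L'.length ≤ L.length) :
    M.IsBase {x | x ∈ L} := by
  refine isBase_of_indep_of_encard_le hI hB (List.finite_toSet L') ?_
  rw [encard_setOf_mem hL, encard_setOf_mem hL']
  exact_mod_cast h

theorem finite_of_list {M : Matroid α} {LE : List α} (hE : {x | x ∈ LE} = M.E) : M.Finite :=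
  ⟨hE ▸ List.finite_toSet LE⟩

theorem greedy_isBase {M : Matroid α} {LE : List α} (hnd : LE.Nodup) (hE : {x | x ∈ LE} = M.E) :
    (greedy M LE).Nodup ∧ M.IsBase {x | x ∈ greedy M LE} := by
  obtain ⟨h1, h2⟩ := greedy_spec LE hnd hE.le
  rw [hE] at h2
  exact ⟨h1, Matroid.isBasis_ground_iff.1 h2⟩

/-- If two bases are near, then so are the multisets of values of a function on them. -/
theorem card_map_sub_le {β : Type*} [DecidableEq β] (f : α → β) {L : List α} (hL : L.Nodup)
    {B : Finset α} {r : ℕ} (h : ({x | x ∈ L} \ (B : Set α)).encard ≤ r) :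
    Multiset.card (((L.map f : List β) : Multiset β) - B.val.map f) ≤ r := by
  classical
  have hset : ({x | x ∈ L} \ (B : Set α)) = ↑(L.toFinset \ B) := by ext; simp
  rw [hset, encard_coe_eq_coe_finsetCard] at h
  have h' : (L.toFinset \ B).card ≤ r := by exact_mod_cast h
  refine le_trans ?_ h'
  have hLm : ((L.map f : List β) : Multiset β) = L.toFinset.val.map f := by
    rw [List.toFinset_val, hL.dedup, Multiset.map_coe]
  have hle : L.toFinset.val.map f - B.val.map f ≤ (L.toFinset \ B).val.map f := by
    rw [tsub_le_iff_right, ← Multiset.map_add]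
    refine Multiset.map_le_map ?_
    rw [Finset.sdiff_val, ← tsub_le_iff_right]
  rw [hLm]
  have hc := Multiset.card_le_card hle
  rwa [Multiset.card_map] at hc

end Auxiliary

/-! ### Avoiding a fixed number of labels -/

section Avoiding

variable {α : Type u} {Γ : Type v} [AddCommGroup Γ] {M : Matroid α} {ψ : α → Γ}

/-- Enumerate the bases at distance at most `r` from a basis until one of them avoids `F`. -/
def avoidP (r : ℕ) : Prog :=
  .seq (letP 1 (.assign 1 (.hd (.var 0))) (letP 2 (.assign 2 (.tl (.var 0)))
    (letP 3 (greedyP 1 3) (letP 4 (.assign 4 (nilsE r .nil)) (letP 5 (candidatesP 1 3 4 5)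
      (foldP 6 5 .nil (letP 9 (filterP id 1 8 9) (letP 10 (greedyP 9 10)
        (letP 11 (sumP .lab 10 11) (letP 12 (memP 11 2 12) (letP 13 (leP 3 10 13)
          (.ite (.var 12) (.assign 14 (.var 6))
            (.ite (.var 13) (.assign 14 (.cons .nil (.var 10))) (.assign 14 (.var 6)))))))))))))))
    (.assign 0 (.var 1))

def avoidCost (r D : ℕ) : ℕ :=
  greedyCost D + 2 * r + candidatesCost D +
    loopCost D (filterCost D + greedyCost D + sumCost D + memCost D + leCost D + 30) + 30

open Classical in
/-- The basis that the enumeration derives from a list. -/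
def restrictGreedy (M : Matroid α) (LE W : List α) : List α :=
  greedy M (LE.filter fun a => a ∈ W).reverse

open Classical in
/-- The answer that the enumeration finds. -/
def avoidAnswer (M : Matroid α) (ψ : α → Γ) (LE : List α) (LF : List Γ) (r : ℕ) :
    Option (List α) :=
  lastSome (fun W => ((restrictGreedy M LE W).map ψ).sum ∉ LF ∧
      (greedy M LE).length ≤ (restrictGreedy M LE W).length) (restrictGreedy M LE)
    ((nextLists LE)^[r] [greedy M LE])

theorem computes_of_comp {c : Prog} {x y : Tree α Γ} {T : ℕ}
    (h : ∀ s : ℕ → Tree α Γ, s 0 = x → Comp M ψ c 1 s y T) :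
    ∃ t, Computes M ψ (.seq c (.assign 0 (.var 1))) x t y ∧ t ≤ T + 2 := by
  obtain ⟨t, s', h1, h2, h3, -⟩ := h (update (fun _ => .nil) 0 x) (by simp)
  refine ⟨_, ⟨_, Run.seq h1 (Run.assign _ _ _), ?_⟩, ?_⟩
  · simp [Expr.eval, h3]
  · simp only [Expr.cost]; omega

theorem computes_avoid {LE : List α} {LF : List Γ} {r D : ℕ} (hE : LE.length ≤ D)
    (hF : LF.length ≤ D) (hr : r ≤ D) (hV : (LE.length ^ 2 + 1) ^ r ≤ D) :
    ∃ t, Computes M ψ (avoidP r) (.cons (.ofElts LE) (.ofGrps LF)) t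
      (encO .ofElts (avoidAnswer M ψ LE LF r)) ∧ t ≤ avoidCost r D + 2 := by
  classical
  -- Variables 1 to 5 hold the ground set, the forbidden labels, the greedy basis, the radius and
  -- the candidates; inside the loop, 8 holds the candidate. Each `T₂` is the budget left after a
  -- block and the two steps that copy the result; `avoidCost` contains all subtracted terms, so no
  -- subtraction is truncated.
  refine computes_of_comp fun s hs => ?_
  refine (comp_let (T₁ := 3) (v := .ofElts LE)
    (T₂ := avoidCost r D - 5) (comp_assign _ _ _ (by simp only [Expr.eval, hs]; rfl)
    (by simp [Expr.cost])) ?_).mono (by unfold avoidCost; omega)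
  intro s₁ a1 f1
  refine (comp_let (T₁ := 3) (v := .ofGrps LF) (T₂ := avoidCost r D - 10) (comp_assign _ _ _
    (by simp only [Expr.eval]; rw [f1 0 (by omega), hs]; rfl)
    (by simp [Expr.cost])) ?_).mono (by unfold avoidCost; omega)
  intro s₂ a2 f2
  refine (comp_let (T₂ := avoidCost r D - 12 - greedyCost D)
    (comp_greedy (l := LE) (D := D) (by rw [f2 1 (by omega), a1]) (by omega) hE)
    ?_).mono (by unfold avoidCost; omega)
  intro s₃ a3 f3
  refine (comp_let (T₁ := 2 * r + 2) (v := unary r) (T₂ := avoidCost r D - 16 - greedyCost D - 2 * r)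
    (comp_assign _ _ _ (by simpa using eval_nilsE r 0 .nil s₃ rfl)
      (by rw [cost_nilsE]; simp [Expr.cost]))
    ?_).mono (by unfold avoidCost; omega)
  intro s₄ a4 f4
  have hB : (greedy M LE).length ≤ D := (length_greedy_le LE).trans hE
  have e1 : s₄ 1 = .ofElts LE := by rw [f4 1 (by omega), f3 1 (by omega), f2 1 (by omega), a1]
  have e2 : s₄ 2 = .ofGrps LF := by rw [f4 2 (by omega), f3 2 (by omega), a2]
  have e3 : s₄ 3 = .ofElts (greedy M LE) := by rw [f4 3 (by omega), a3]
  refine (comp_let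
    (T₂ := loopCost D (filterCost D + greedyCost D + sumCost D + memCost D + leCost D + 30))
    (comp_candidates faithful_elt (A := LE) (W := greedy M LE) (n := r) (D := D) e1 e3 a4
      (by omega) (by omega) hE hB hr hV) ?_).mono (by unfold avoidCost; omega)
  intro s₅ a5 f5
  refine comp_fold (encO .ofElts) (encL .elt) _ ((nextLists LE)^[r] [greedy M LE]) none a5
    (by omega) rfl (by simp [Expr.cost]) (by rwa [length_iterate_nextLists]) ?_
  intro pre W suf hl s₆ a6 a8 f6
  have hW : W.length ≤ D := by
    rw [length_of_mem_iterate_nextLists (A := LE) (W := greedy M LE) (r := r) (by simp [hl])]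
    exact hB
  have hfil : (LE.filter fun a => a ∈ W).reverse.length ≤ D := by
    rw [List.length_reverse]; exact (List.length_filter_le _ _).trans hE
  have hD' : (restrictGreedy M LE W).length ≤ D := (length_greedy_le _).trans hfil
  have b1 : s₆ 1 = .ofElts LE := by rw [f6 1 (by omega), f5 1 (by omega), e1]
  refine (comp_let (T₂ := greedyCost D + sumCost D + memCost D + leCost D + 28)
    (comp_filter (isKey_id .elt) faithful_elt (D := D) (l := LE) (S := W) b1
      (by exact a8) (by omega) (by omega) hE hW) ?_).mono (by omega)
  intro s₇ a9 f7
  refine (comp_let (T₂ := sumCost D + memCost D + leCost D + 26)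
    (comp_greedy (D := D) (l := (LE.filter fun a => a ∈ W).reverse) (by rw [a9]; rfl) (by omega)
      hfil) ?_).mono (by omega)
  intro s₈ a10 f8
  refine (comp_let (T₂ := memCost D + leCost D + 24)
    (comp_sum isKey_lab (D := D) (l := restrictGreedy M LE W) a10 (by omega) hD') ?_).mono
      (by omega)
  intro s₉ a11 f9
  refine (comp_let (T₂ := leCost D + 22)
    (comp_mem faithful_grp (D := D) (l := LF) a11
      (by rw [f9 2 (by omega), f8 2 (by omega), f7 2 (by omega), f6 2 (by omega), f5 2 (by omega),
        e2]; rfl) (by omega) (by omega) hF) ?_).mono (by omega)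
  intro s₁₀ a12 f10
  refine (comp_let (T₂ := 20)
    (comp_le (D := D) (enc := .elt) (enc' := .elt) (l := greedy M LE) (m := restrictGreedy M LE W)
      (by rw [f10 3 (by omega), f9 3 (by omega), f8 3 (by omega), f7 3 (by omega), f6 3 (by omega),
        f5 3 (by omega), e3]; rfl)
      (by rw [f10 10 (by omega), f9 10 (by omega), a10]; rfl) (by omega) hB) ?_).mono (by omega)
  intro s₁₁ a13 f11
  have c12 : s₁₁ 12 = _ := (f11 12 (by omega)).trans a12
  have c10 : s₁₁ 10 = .ofElts (restrictGreedy M LE W) :=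
    (f11 10 (by omega)).trans ((f10 10 (by omega)).trans ((f9 10 (by omega)).trans a10))
  have c6 : s₁₁ 6 = _ := (f11 6 (by omega)).trans ((f10 6 (by omega)).trans
    ((f9 6 (by omega)).trans ((f8 6 (by omega)).trans ((f7 6 (by omega)).trans a6))))
  refine (comp_ite (T := 10) (fun h => comp_assign _ _ _ ?_ (by simp [Expr.cost])) (fun h =>
    (comp_ite (T := 6) (fun h' => comp_assign _ _ _ ?_ (by simp [Expr.cost])) (fun h' =>
      comp_assign _ _ _ ?_ (by simp [Expr.cost]))).mono (by simp [Expr.cost]))).mono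
      (by simp [Expr.cost])
  · simp only [Expr.eval, c12, ofProp_ne_nil] at h
    simp only [Expr.eval, c6]
    rw [if_neg (fun hc => hc.1 h)]
  · simp only [Expr.eval, c12, ofProp_eq_nil] at h
    simp only [Expr.eval, a13, ofProp_ne_nil] at h'
    rw [if_pos ⟨h, h'⟩]
    simp only [Expr.eval, c10, encO]
  · simp only [Expr.eval, a13, ofProp_eq_nil] at h'
    simp only [Expr.eval, c6]
    rw [if_neg (fun hc => h' hc.2)]

/-! ### Correctness and running time of the search for avoiding bases. -/

/-- A candidate may have repetitions or be dependent. Filtering the ground list and the greedy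
algorithm turn it into a repetition-free independent list, and the length test admits only bases. If
the candidate lists a basis, its set of elements is unchanged, so the avoiding basis that proximity
provides cannot be missed. -/
theorem isAnswer_avoid {q : ℕ} {LE : List α} {LF : List Γ} {r : ℕ} (hq : RepresentableGF q M)
    (hnd : LE.Nodup) (hE : {x | x ∈ LE} = M.E) (hFnd : LF.Nodup)
    (hr : exchangeBound q (LF.length + 1) - 1 ≤ r) :
    IsAnswer M (fun B => label ψ B ∉ LF)
      (encO .ofElts (avoidAnswer M ψ LE LF r) : Tree α Γ) := by
  classical
  obtain ⟨hBnd, hB⟩ := greedy_isBase hnd hE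
  have hfin : M.Finite := finite_of_list hE
  have hres : ∀ W, (restrictGreedy M LE W).Nodup ∧
      M.IsBasis {x | x ∈ restrictGreedy M LE W} {x | x ∈ (LE.filter fun a => a ∈ W).reverse} :=
    fun W => greedy_spec _ (List.nodup_reverse.2 (hnd.filter _)) (by
      rw [← hE]
      intro x hx
      simp only [mem_ofPred_eq, List.mem_reverse, List.mem_filter] at hx
      exact hx.1)
  rcases lastSome_spec (fun W => ((restrictGreedy M LE W).map ψ).sum ∉ LF ∧
      (greedy M LE).length ≤ (restrictGreedy M LE W).length) (restrictGreedy M LE)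
    ((nextLists LE)^[r] [greedy M LE]) with ⟨h1, h2⟩ | ⟨W, -, ⟨h1, h2⟩, h3⟩
  · left
    refine ⟨by rw [avoidAnswer, h1]; rfl, fun B₀ hB₀ hB₀F => ?_⟩
    obtain ⟨B', hB', hF', hnear⟩ := exists_avoiding_base_near_of_representableGF hfin hq
      LF.toFinset ψ ⟨B₀, hB₀, by simpa using hB₀F⟩ _ hB
    rw [List.toFinset_card_of_nodup hFnd] at hnear
    have hBf : B'.Finite := hfin.ground_finite.subset hB'.subset_ground
    lift B' to Finset α using hBf
    have hcard : B'.card = (greedy M LE).length := by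
      have := hB'.encard_eq_encard_of_isBase hB
      rw [encard_setOf_mem hBnd, encard_coe_eq_coe_finsetCard] at this
      exact_mod_cast this
    obtain ⟨W, hW, hWB⟩ := exists_mem_iterate_nextLists (A := LE) B'.val
      (fun x hx => by
        have : x ∈ M.E := hB'.subset_ground hx
        rw [← hE] at this
        exact this) r [greedy M LE] (greedy M LE) (by simp)
      (fun x hx => by
        have : x ∈ M.E := hB.subset_ground hx
        rw [← hE] at this
        exact this) hcard (by
        have := card_map_sub_le id hBnd (hnear.trans (by exact_mod_cast hr))
        simpa using this)
    have hmemW : ∀ x, x ∈ W ↔ x ∈ B' := fun x => by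
      rw [← Multiset.mem_coe, hWB]; rfl
    have hset : {x | x ∈ (LE.filter fun a => a ∈ W).reverse} = (B' : Set α) := by
      ext x
      simp only [mem_ofPred_eq, List.mem_reverse, List.mem_filter, decide_eq_true_eq, hmemW,
        Finset.mem_coe, and_iff_right_iff_imp]
      intro hx
      have : x ∈ M.E := hB'.subset_ground hx
      rw [← hE] at this
      exact this
    obtain ⟨g1, g2⟩ := hres W
    rw [hset] at g2
    replace g2 := g2.eq_of_subset_indep hB'.indep g2.subset subset_rfl
    refine h2 W hW ⟨?_, ?_⟩
    · rw [← label_setOf_mem ψ g1, g2]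
      simpa using hF'
    · rw [← hcard]
      have : ((restrictGreedy M LE W).length : ℕ∞) = B'.card := by
        rw [← encard_setOf_mem g1, g2, encard_coe_eq_coe_finsetCard]
      exact_mod_cast this.ge
  · right
    obtain ⟨g1, g2⟩ := hres W
    refine ⟨restrictGreedy M LE W, g1, by rw [avoidAnswer, h3]; rfl,
      isBase_of_length_le g1 hBnd g2.indep hB h2, ?_⟩
    change label ψ _ ∉ LF
    rwa [label_setOf_mem ψ g1]

theorem polyBdd_avoidCost (r : ℕ) : PolyBdd (avoidCost r) := by
  have c := polyBdd_const
  have i := polyBdd_id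
  have hmem : PolyBdd memCost := i.loopCost (c 8)
  have hgr : PolyBdd greedyCost := i.loopCost (c 9)
  have hfil : PolyBdd filterCost := i.loopCost (hmem.add (c 15))
  have hsum : PolyBdd sumCost := i.loopCost (c 6)
  have hle : PolyBdd leCost := (i.loopCost (c 3)).add (c 8)
  have hsub : PolyBdd substCost := (i.loopCost (c 17)).add (c 5)
  have hcand : PolyBdd candidatesCost :=
    i.loopCost (i.loopCost (i.loopCost (i.loopCost (hsub.add (c 6)))))
  exact (((hgr.add (c _)).add hcand).add (i.loopCost
    (((((hfil.add hgr).add hsum).add hmem).add hle).add (c 30)))).add (c 30)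

theorem avoidingBasisPolyTime (q m : ℕ) : AvoidingBasisPolyTime.{u, v} q m := by
  set r := exchangeBound q (m + 1) - 1 with hr
  obtain ⟨c, d, hcd⟩ := (polyBdd_avoidCost r).add (polyBdd_const 2)
  refine ⟨avoidP r, .C c * (.X + .C m + .C r + (.X ^ 2 + 1) ^ r + 1) ^ d, ?_⟩
  intro α Γ _ M ψ LE LF hq hnd hE hFnd hm
  -- `D` dominates the lengths of all lists, including the number (n² + 1)^r of candidates; it is a
  -- polynomial in n as r is fixed.
  obtain ⟨t, h1, h2⟩ := computes_avoid (M := M) (ψ := ψ) (LE := LE) (LF := LF) (r := r)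
    (D := LE.length + m + r + (LE.length ^ 2 + 1) ^ r) (by omega) (by omega) (by omega) (by omega)
  refine ⟨t, _, h1, h2.trans ((hcd _).trans (le_of_eq ?_)),
    isAnswer_avoid hq hnd hE hFnd (by rw [hm])⟩
  simp

end Avoiding

/-! ### Zero bases -/

section ZeroBasis

variable {α : Type u} {Γ : Type v} [AddCommGroup Γ] {M : Matroid α} {ψ : α → Γ}

open Classical in
/-- Rado's condition for the labels `W`, the elements `L` and the set `S` of labels. -/
def RankOK (M : Matroid α) (ψ : α → Γ) (W : List Γ) (L : List α) (S : List Γ) : Prop :=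
  (W.filter fun g => g ∈ S).reverse.length ≤ (greedy M (L.filter fun e => ψ e ∈ S).reverse).length

/-- Rado's condition for the labels in `x`, the elements in `y` and all label sets in `z`. -/
def rankP (x y z b : ℕ) : Prog :=
  foldP b z (.cons .nil .nil) (letP (b + 3) (filterP id x (b + 2) (b + 3))
    (letP (b + 4) (filterP .lab y (b + 2) (b + 4)) (letP (b + 5) (greedyP (b + 4) (b + 5))
      (letP (b + 6) (leP (b + 3) (b + 5) (b + 6))
        (.ite (.var (b + 6)) (.assign (b + 7) (.var b)) (.assign (b + 7) .nil))))))

def rankCost (D : ℕ) : ℕ :=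
  loopCost D (filterCost D + filterCost D + greedyCost D + leCost D + 16)

theorem foldl_and_eq {β : Type*} (p : β → Prop) (l : List β) (P : Prop) :
    l.foldl (fun P c => p c ∧ P) P = ((∀ c ∈ l, p c) ∧ P) := by
  induction l generalizing P with
  | nil => simp
  | cons c l ih => rw [List.foldl_cons, ih, List.forall_mem_cons]; exact propext (by tauto)

theorem comp_rank {x y z b D : ℕ} {s : ℕ → Tree α Γ} {W : List Γ} {L : List α}
    {V : List (List Γ)} (hx : s x = .ofGrps W) (hy : s y = .ofElts L)
    (hz : s z = encL (encL .grp) V) (hxb : x < b) (hyb : y < b) (hzb : z < b) (hW : W.length ≤ D)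
    (hL : L.length ≤ D) (hV : V.length ≤ D) (hVD : ∀ S ∈ V, S.length ≤ D) :
    Comp M ψ (rankP x y z b) b s (.ofProp (∀ S ∈ V, RankOK M ψ W L S)) (rankCost D) := by
  classical
  have := comp_fold (M := M) (ψ := ψ)
    (T := filterCost D + filterCost D + greedyCost D + leCost D + 16) Tree.ofProp (encL .grp)
    (fun P S => RankOK M ψ W L S ∧ P) V True
    (init := .cons .nil .nil) (body := letP (b + 3) (filterP id x (b + 2) (b + 3))
    (letP (b + 4) (filterP .lab y (b + 2) (b + 4)) (letP (b + 5) (greedyP (b + 4) (b + 5))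
      (letP (b + 6) (leP (b + 3) (b + 5) (b + 6))
        (.ite (.var (b + 6)) (.assign (b + 7) (.var b)) (.assign (b + 7) .nil))))))
    hz hzb (by simp only [Expr.eval, ofProp_true]) (by simp [Expr.cost]) hV ?_
  · simp only [foldl_and_eq, and_true] at this
    exact this
  intro pre S suf hl s₀ a0 a2 f0
  have hS : S.length ≤ D := hVD S (by simp [hl])
  refine (comp_let (T₂ := filterCost D + greedyCost D + leCost D + 14)
    (comp_filter (isKey_id .grp) faithful_grp (D := D) (l := W) (S := S)
      (by rw [f0 x hxb, hx]; rfl) a2 (by omega) (by omega) hW hS) ?_).mono (by omega)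
  intro s₁ a3 f1
  refine (comp_let (T₂ := greedyCost D + leCost D + 12)
    (comp_filter isKey_lab faithful_grp (D := D) (l := L) (S := S)
      (by rw [f1 y (by omega), f0 y hyb, hy]; rfl) (by rw [f1 _ (by omega), a2])
      (by omega) (by omega) hL hS) ?_).mono (by omega)
  intro s₂ a4 f2
  refine (comp_let (T₂ := leCost D + 10)
    (comp_greedy (D := D) (l := (L.filter fun e => ψ e ∈ S).reverse) a4 (by omega)
      (by rw [List.length_reverse]; exact (List.length_filter_le _ _).trans hL)) ?_).mono (by omega)
  intro s₃ a5 f3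
  refine (comp_let (T₂ := 8)
    (comp_le (D := D) (enc := .grp) (enc' := .elt) (l := (W.filter fun g => g ∈ S).reverse)
      (m := greedy M (L.filter fun e => ψ e ∈ S).reverse)
      (by rw [f3 _ (by omega), f2 _ (by omega), a3]; rfl) a5 (by omega)
      (by rw [List.length_reverse]; exact (List.length_filter_le _ _).trans hW)) ?_).mono (by omega)
  intro s₄ a6 f4
  refine (comp_ite (T := 4) (fun h => comp_assign _ _ _ ?_ (by simp [Expr.cost]))
    (fun h => comp_assign _ _ _ ?_ (by simp [Expr.cost]))).mono (by simp [Expr.cost])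
  · simp only [Expr.eval, a6, ofProp_ne_nil] at h
    simp only [Expr.eval]
    rw [f4 b (by omega), f3 b (by omega), f2 b (by omega), f1 b (by omega), a0,
      show RankOK M ψ W L S = True from eq_true h, true_and]
  · simp only [Expr.eval, a6, ofProp_eq_nil] at h
    simp only [Expr.eval]
    rw [show RankOK M ψ W L S = False from eq_false h, false_and, ofProp_false]

/-- The labels in `W` sum up to zero, and satisfy Rado's condition for the label sets in `V`. -/
def CheckOK (M : Matroid α) (ψ : α → Γ) (V : List (List Γ)) (W : List Γ) (L : List α) : Prop :=
  W.sum = 0 ∧ ∀ S ∈ V, RankOK M ψ W L S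

def checkP (x y z b : ℕ) : Prog :=
  letP b (sumP id x b) (letP (b + 1) (rankP x y z (b + 1))
    (.ite (.eq (.var b) .zero) (.assign (b + 2) (.var (b + 1))) (.assign (b + 2) .nil)))

def checkCost (D : ℕ) : ℕ := sumCost D + rankCost D + 14

theorem comp_check {x y z b D : ℕ} {s : ℕ → Tree α Γ} {W : List Γ} {L : List α}
    {V : List (List Γ)} (hx : s x = .ofGrps W) (hy : s y = .ofElts L)
    (hz : s z = encL (encL .grp) V) (hxb : x < b) (hyb : y < b) (hzb : z < b) (hW : W.length ≤ D)
    (hL : L.length ≤ D) (hV : V.length ≤ D) (hVD : ∀ S ∈ V, S.length ≤ D) :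
    Comp M ψ (checkP x y z b) b s (.ofProp (CheckOK M ψ V W L)) (checkCost D) := by
  refine (comp_let (T₂ := rankCost D + 12)
    (comp_sum (isKey_id .grp) (D := D) (l := W) hx hxb hW) ?_).mono (by unfold checkCost; omega)
  intro s₁ a0 f0
  refine (comp_let (T₂ := 10)
    (comp_rank (D := D) (W := W) (L := L) (V := V) (by rw [f0 x hxb, hx]) (by rw [f0 y hyb, hy])
      (by rw [f0 z hzb, hz]) (by omega) (by omega) (by omega) hW hL hV hVD) ?_).mono (by omega)
  intro s₂ a1 f1
  have he : (Expr.eq (.var b) .zero).eval M ψ s₂ = .ofProp (W.sum = 0) := by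
    simp only [Expr.eval]
    rw [f1 b (by omega), a0, List.map_id]
    rfl
  refine (comp_ite (T := 4) (fun h => comp_assign _ _ _ ?_ (by simp [Expr.cost]))
    (fun h => comp_assign _ _ _ ?_ (by simp [Expr.cost]))).mono (by simp [Expr.cost])
  · rw [he, ofProp_ne_nil] at h
    simp only [Expr.eval, a1, CheckOK, h, true_and]
  · rw [he, ofProp_eq_nil] at h
    simp only [Expr.eval, CheckOK, h, false_and, ofProp_false]

/-- Only labels from `A` occur, so Rado's condition for a set of labels depends on its intersection
with `A` alone, and the 2^|A| sublists cover all cases. -/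
theorem checkOK_iff {A W : List Γ} {L : List α} (hL : L.Nodup) (hLE : {x | x ∈ L} ⊆ M.E)
    (hLA : ∀ e ∈ L, ψ e ∈ A) (hWA : ∀ g ∈ W, g ∈ A) :
    CheckOK M ψ (subsets A) W L ↔ W.sum = 0 ∧ RadoCond M ψ (W : Multiset Γ) {x | x ∈ L} := by
  classical
  have key : ∀ (S : List Γ) (T : Set Γ), (∀ g, g ∈ S ↔ g ∈ A ∧ g ∈ T) → (RankOK M ψ W L S ↔
      (labelCount (W : Multiset Γ) T : ℕ∞) ≤ M.eRk {e ∈ {x | x ∈ L} | ψ e ∈ T}) := by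
    intro S T hST
    have h1 : labelCount (W : Multiset Γ) T = (W.filter fun g => g ∈ S).reverse.length := by
      rw [List.length_reverse, labelCount, Multiset.coe_countP, List.countP_eq_length_filter]
      congr 1
      refine List.filter_congr fun g hg => ?_
      simp [hST, hWA g hg]
    have h2 : {e ∈ {x | x ∈ L} | ψ e ∈ T} = {x | x ∈ (L.filter fun e => ψ e ∈ S).reverse} := by
      ext e
      simp only [mem_ofPred_eq, List.mem_reverse, List.mem_filter, decide_eq_true_eq, hST]
      constructor
      · rintro ⟨h, h'⟩; exact ⟨h, hLA e h, h'⟩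
      · rintro ⟨h, -, h'⟩; exact ⟨h, h'⟩
    rw [RankOK, h1, h2, ← length_greedy _ (List.nodup_reverse.2 (hL.filter _)) (h2 ▸ fun x hx =>
      hLE hx.1)]
    norm_cast
  refine and_congr_right fun _ => ⟨fun h T => ?_, fun h S hS => ?_⟩
  · obtain ⟨S, hS, hST⟩ := exists_mem_subsets A T
    exact (key S T hST).1 (h S hS)
  · refine (key S {g | g ∈ S} fun g => ?_).2 (h _)
    exact ⟨fun hg => ⟨mem_of_mem_subsets hS g hg, hg⟩, fun hg => hg.2⟩

open Classical in
/-- Remove one entry after the other, as long as `p` is preserved. -/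
def prune {β : Type*} (p : List β → Prop) (l L : List β) : List β :=
  l.foldl (fun acc e => if p (acc.filter fun c => c ≠ e).reverse
    then (acc.filter fun c => c ≠ e).reverse else acc) L

open Classical in
theorem prune_append_singleton {β : Type*} (p : List β → Prop) (l L : List β) (e : β) :
    prune p (l ++ [e]) L = if p ((prune p l L).filter fun c => c ≠ e).reverse
      then ((prune p l L).filter fun c => c ≠ e).reverse else prune p l L := by
  rw [prune, List.foldl_append]
  rfl

theorem length_prune_le {β : Type*} (p : List β → Prop) (l L : List β) :
    (prune p l L).length ≤ L.length := by
  classical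
  induction l using List.reverseRecOn with
  | nil => exact le_rfl
  | append_singleton l e ih =>
    rw [prune_append_singleton]
    split_ifs
    · rw [List.length_reverse]; exact (List.length_filter_le _ _).trans ih
    · exact ih

/-- One pass is enough because `P` is upward closed: an element that could not be deleted at its
turn cannot be deleted from a smaller set either. -/
theorem prune_spec {β : Type*} {p : List β → Prop} {P : Set β → Prop} {l L : List β}
    (hL : L.Nodup) (hP : ∀ X Y, X ⊆ Y → P X → P Y)
    (hp : ∀ L' : List β, L'.Nodup → (∀ x ∈ L', x ∈ L) → (p L' ↔ P {x | x ∈ L'})) (hPL : p L) :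
    (prune p l L).Nodup ∧ (∀ x ∈ prune p l L, x ∈ L) ∧ p (prune p l L) ∧
      ∀ e ∈ l, e ∈ prune p l L → ¬ P ({x | x ∈ prune p l L} \ {e}) := by
  classical
  induction l using List.reverseRecOn with
  | nil => exact ⟨hL, fun x hx => hx, hPL, by simp⟩
  | append_singleton l e ih =>
    obtain ⟨h1, h2, h3, h4⟩ := ih
    have hset : {x | x ∈ ((prune p l L).filter fun c => c ≠ e).reverse}
        = {x | x ∈ prune p l L} \ {e} := by
      ext x; simp
    have hnd : ((prune p l L).filter fun c => c ≠ e).reverse.Nodup :=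
      List.nodup_reverse.2 (h1.filter _)
    have hsub : ∀ x ∈ ((prune p l L).filter fun c => c ≠ e).reverse, x ∈ L := fun x hx =>
      h2 x (by simp at hx; exact hx.1)
    rw [prune_append_singleton]
    split_ifs with h
    · refine ⟨hnd, hsub, h, fun e' he' he'D => ?_⟩
      rw [hset]
      have he'D' : e' ∈ {x | x ∈ prune p l L} \ {e} := hset ▸ he'D
      rcases List.mem_append.1 he' with hl | hl
      · exact fun hc => h4 e' hl he'D'.1 (hP _ _ (sdiff_subset_sdiff_left sdiff_subset) hc)
      · exact absurd (List.mem_singleton.1 hl) he'D'.2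
    · refine ⟨h1, h2, h3, fun e' he' he'D => ?_⟩
      rcases List.mem_append.1 he' with hl | hl
      · exact h4 e' hl he'D
      · rw [List.mem_singleton.1 hl, ← hset, ← hp _ hnd hsub]
        exact h

/-- Find a multiset of labels that sum up to zero and that a basis realizes, and prune the
ground set to such a basis. -/
def zeroP (Q : ℕ) : Prog :=
  .seq (letP 1 (greedyP 0 1) (letP 2 (labelsP 1 2) (letP 3 (distinctP 0 3) (letP 4 (ordersP 3 4)
    (letP 5 (powP Q 4 5) (letP 6 (candidatesP 3 2 5 6) (letP 7 (subsetsP 3 7)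
      (letP 8 (foldP 8 6 .nil (letP 11 (checkP 10 0 7 11)
          (.ite (.var 11) (.assign 12 (.cons .nil (.var 10))) (.assign 12 (.var 8)))))
        (.ite (.var 8)
          (letP 9 (.assign 9 (.tl (.var 8)))
            (letP 10 (foldP 10 0 (.var 0) (letP 13 (removeP 12 10 13) (letP 14 (checkP 9 13 7 14)
              (.ite (.var 14) (.assign 15 (.var 13)) (.assign 15 (.var 10))))))
              (.assign 11 (.cons .nil (.var 10)))))
          (.assign 9 .nil))))))))))
    (.assign 0 (.var 1))

def pruneCost (D : ℕ) : ℕ := loopCost D (removeCost D + checkCost D + 12) + 20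

def selectCost (D : ℕ) : ℕ := loopCost D (checkCost D + 10)

def zeroCost (Q D : ℕ) : ℕ :=
  greedyCost D + labelsCost D + distinctCost D + ordersCost D + powCost Q D + candidatesCost D +
    subsetsCost D + selectCost D + pruneCost D + 30

/-- The number of rounds that the algorithm for zero bases computes. -/
def zeroRounds (ψ : α → Γ) (Q : ℕ) (LE : List α) : ℕ :=
  2 * Q ^ ((distinctLabels ψ LE).map addOrderOf).prod

/-- The multiset of labels that the algorithm for zero bases selects. -/
def zeroLabels (M : Matroid α) (ψ : α → Γ) (Q : ℕ) (LE : List α) : Option (List Γ) :=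
  lastSome (fun W => CheckOK M ψ (subsets (distinctLabels ψ LE)) W LE) id
    ((nextLists (distinctLabels ψ LE))^[zeroRounds ψ Q LE] [((greedy M LE).map ψ).reverse])

/-- The answer of the algorithm for zero bases. -/
def zeroAnswer (M : Matroid α) (ψ : α → Γ) (Q : ℕ) (LE : List α) : Option (List α) :=
  (zeroLabels M ψ Q LE).map fun W =>
    prune (CheckOK M ψ (subsets (distinctLabels ψ LE)) W) LE LE

theorem comp_prune {D : ℕ} {s : ℕ → Tree α Γ} {W : List Γ} {L : List α} {V : List (List Γ)}
    (h0 : s 0 = .ofElts L) (h8 : s 8 = .cons .nil (.ofGrps W)) (h7 : s 7 = encL (encL .grp) V)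
    (hW : W.length ≤ D) (hL : L.length ≤ D) (hV : V.length ≤ D) (hVD : ∀ S ∈ V, S.length ≤ D) :
    Comp M ψ (letP 9 (.assign 9 (.tl (.var 8)))
      (letP 10 (foldP 10 0 (.var 0) (letP 13 (removeP 12 10 13) (letP 14 (checkP 9 13 7 14)
        (.ite (.var 14) (.assign 15 (.var 13)) (.assign 15 (.var 10))))))
        (.assign 11 (.cons .nil (.var 10))))) 9 s
      (.cons .nil (.ofElts (prune (CheckOK M ψ V W) L L))) (pruneCost D) := by
  classical
  refine (comp_let (T₁ := 3) (v := .ofGrps W)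
    (T₂ := loopCost D (removeCost D + checkCost D + 12) + 6)
    (comp_assign _ _ _ (by simp only [Expr.eval, h8]; rfl) (by simp [Expr.cost])) ?_).mono
      (by unfold pruneCost; omega)
  intro s₁ a9 f1
  refine comp_let (v := .ofElts (prune (CheckOK M ψ V W) L L)) (T₂ := 4) ?_ ?_
  · refine comp_fold Tree.ofElts .elt _ L L (by rw [f1 0 (by omega), h0]; rfl) (by omega)
      (by simp only [Expr.eval]; rw [f1 0 (by omega), h0]) (by simp [Expr.cost]) hL ?_
    intro pre e suf _ s₂ a10 a12 f2
    change s₂ 10 = .ofElts (prune (CheckOK M ψ V W) pre L) at a10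
    change Comp M ψ _ _ _ (.ofElts (if CheckOK M ψ V W
      ((prune (CheckOK M ψ V W) pre L).filter fun c => c ≠ e).reverse then _ else _)) _
    have hlen : (prune (CheckOK M ψ V W) pre L).length ≤ D := (length_prune_le _ _ _).trans hL
    refine (comp_let (T₂ := checkCost D + 10)
      (comp_remove faithful_elt (D := D) (a := e) (l := prune (CheckOK M ψ V W) pre L) a12
        (by rw [a10]; rfl) (by omega) (by omega) hlen) ?_).mono (by omega)
    intro s₃ a13 f3
    refine (comp_let (T₂ := 8)
      (comp_check (D := D) (W := W)
        (L := ((prune (CheckOK M ψ V W) pre L).filter fun c => c ≠ e).reverse) (V := V)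
        (by rw [f3 9 (by omega), f2 9 (by omega), a9]) (by rw [a13]; rfl)
        (by rw [f3 7 (by omega), f2 7 (by omega), f1 7 (by omega), h7]) (by omega) (by omega)
        (by omega) hW (by
          rw [List.length_reverse]; exact (List.length_filter_le _ _).trans hlen)
        hV hVD) ?_).mono (by omega)
    intro s₄ a14 f4
    refine (comp_ite (T := 4) (fun h => comp_assign _ _ _ ?_ (by simp [Expr.cost]))
      (fun h => comp_assign _ _ _ ?_ (by simp [Expr.cost]))).mono (by simp [Expr.cost])
    · simp only [Expr.eval, a14, ofProp_ne_nil] at h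
      simp only [Expr.eval]
      rw [if_pos h, f4 13 (by omega), a13]
      rfl
    · simp only [Expr.eval, a14, ofProp_eq_nil] at h
      simp only [Expr.eval]
      rw [if_neg h, f4 10 (by omega), f3 10 (by omega), a10]
      rfl
  · intro s₅ a10 _
    exact comp_assign _ _ _ (by simp only [Expr.eval, a10]) (by simp [Expr.cost])

theorem computes_zero [Finite Γ] {LE : List α} {Q D : ℕ} (hQ : 0 < Q) (hE : LE.length ≤ D)
    (h2 : 2 ^ (distinctLabels ψ LE).length ≤ D)
    (hN : Nat.card Γ ^ (distinctLabels ψ LE).length ≤ D) (hΓ : Nat.card Γ ≤ D)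
    (hK : ((distinctLabels ψ LE).map addOrderOf).prod ≤ D) (hR : zeroRounds ψ Q LE ≤ D)
    (hV : ((distinctLabels ψ LE).length ^ 2 + 1) ^ zeroRounds ψ Q LE ≤ D) :
    ∃ t, Computes M ψ (zeroP Q) (.ofElts LE) t (encO .ofElts (zeroAnswer M ψ Q LE)) ∧
      t ≤ zeroCost Q D + 2 := by
  classical
  set A := distinctLabels ψ LE with hA
  have hAD : A.length ≤ D := (distinctLabels_spec ψ LE).2.2.trans hE
  have hB : (greedy M LE).length ≤ D := (length_greedy_le LE).trans hE
  have hWD : (((greedy M LE).map ψ).reverse).length ≤ D := by simpa using hB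
  have hSub : (subsets A).length ≤ D := by rwa [length_subsets]
  have hSubD : ∀ S ∈ subsets A, S.length ≤ D := fun S hS =>
    (length_le_of_mem_subsets hS).trans hAD
  -- Variable 0 keeps the ground set. Variables 1 to 8 receive the greedy basis, its labels, the
  -- distinct labels, the product of their orders, the number of rounds, the candidate label lists,
  -- the subsets of labels and the selected list.
  refine computes_of_comp fun s hs => ?_
  refine (comp_let (T₂ := zeroCost Q D - greedyCost D - 2)
    (comp_greedy (l := LE) (D := D) hs (by omega) hE) ?_).mono (by unfold zeroCost; omega)
  intro s₁ a1 f1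
  refine (comp_let (T₂ := zeroCost Q D - greedyCost D - labelsCost D - 4)
    (comp_labels (l := greedy M LE) (D := D) a1 (by omega) hB) ?_).mono (by unfold zeroCost; omega)
  intro s₂ a2 f2
  have e0 : s₂ 0 = .ofElts LE := by rw [f2 0 (by omega), f1 0 (by omega), hs]
  refine (comp_let (T₂ := zeroCost Q D - greedyCost D - labelsCost D - distinctCost D - 6)
    (comp_distinct (l := LE) (D := D) e0 (by omega) hE) ?_).mono (by unfold zeroCost; omega)
  intro s₃ a3 f3
  refine (comp_let
    (T₂ := zeroCost Q D - greedyCost D - labelsCost D - distinctCost D - ordersCost D - 8)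
    (comp_orders (l := A) (D := D) a3 (by omega) hAD hN hΓ) ?_).mono (by unfold zeroCost; omega)
  intro s₄ a4 f4
  refine (comp_let (T₂ := candidatesCost D + subsetsCost D + selectCost D + pruneCost D + 20)
    (comp_pow (Q := Q) (n := (A.map addOrderOf).prod) (D := D) a4 (by omega) hQ hK hR) ?_).mono
      (by unfold zeroCost; omega)
  intro s₅ a5 f5
  have e3 : s₅ 3 = .ofGrps A := by rw [f5 3 (by omega), f4 3 (by omega), a3]
  have e2 : s₅ 2 = .ofGrps ((greedy M LE).map ψ).reverse := by
    rw [f5 2 (by omega), f4 2 (by omega), f3 2 (by omega), a2]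
  have e0' : s₅ 0 = .ofElts LE := by
    rw [f5 0 (by omega), f4 0 (by omega), f3 0 (by omega), e0]
  refine (comp_let (T₂ := subsetsCost D + selectCost D + pruneCost D + 18)
    (comp_candidates faithful_grp (A := A) (W := ((greedy M LE).map ψ).reverse)
      (n := zeroRounds ψ Q LE) (D := D) e3 e2 a5 (by omega) (by omega) hAD hWD hR hV) ?_).mono
      (by omega)
  intro s₆ a6 f6
  refine (comp_let (T₂ := selectCost D + pruneCost D + 16)
    (comp_subsets (enc := .grp) (l := A) (D := D) (by rw [f6 3 (by omega), e3]; rfl) (by omega) h2)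
    ?_).mono (by omega)
  intro s₇ a7 f7
  have e0'' : s₇ 0 = .ofElts LE := by rw [f7 0 (by omega), f6 0 (by omega), e0']
  have hmemlen : ∀ W ∈ (nextLists A)^[zeroRounds ψ Q LE] [((greedy M LE).map ψ).reverse],
      W.length ≤ D := fun W hW => by rw [length_of_mem_iterate_nextLists hW]; exact hWD
  refine (comp_let (v := encO .ofGrps (zeroLabels M ψ Q LE)) (T₁ := selectCost D)
    (T₂ := pruneCost D + 8) ?_ ?_).mono (by omega)
  · refine comp_fold (encO .ofGrps) (encL .grp) _
      ((nextLists A)^[zeroRounds ψ Q LE] [((greedy M LE).map ψ).reverse]) none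
      (by rw [f7 6 (by omega), a6]; rfl) (by omega) rfl (by simp [Expr.cost])
      (by rwa [length_iterate_nextLists]) ?_
    intro pre W suf hl s₈ a8 a10 f8
    refine (comp_let (T₂ := 8)
      (comp_check (D := D) (W := W) (L := LE) (V := subsets A) (by rw [a10]; rfl)
        (by rw [f8 0 (by omega), e0'']) (by rw [f8 7 (by omega), a7]) (by omega) (by omega)
        (by omega) (hmemlen W (by simp [hl])) hE hSub hSubD) ?_).mono (by omega)
    intro s₉ a11 f9
    refine (comp_ite (T := 6) (fun h => comp_assign _ _ _ ?_ (by simp [Expr.cost]))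
      (fun h => comp_assign _ _ _ ?_ (by simp [Expr.cost]))).mono (by simp [Expr.cost])
    · simp only [Expr.eval, a11, ofProp_ne_nil] at h
      simp only [Expr.eval]
      rw [if_pos h, f9 10 (by omega), a10]
      rfl
    · simp only [Expr.eval, a11, ofProp_eq_nil] at h
      simp only [Expr.eval]
      rw [if_neg h, f9 8 (by omega), a8]
  · intro s₈ a8 f8
    rcases hz : zeroLabels M ψ Q LE with _ | W
    · rw [hz] at a8
      refine (comp_ite (T := pruneCost D) (fun h => ?_)
        (fun h => comp_assign _ _ _ ?_ (by simp [Expr.cost, pruneCost]))).mono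
          (by simp [Expr.cost]; omega)
      · exact absurd (show (Expr.var 8).eval M ψ s₈ = .nil from a8) h
      · rw [zeroAnswer, hz]; rfl
    · rw [hz] at a8
      refine (comp_ite (T := pruneCost D) (fun h => ?_) (fun h => ?_)).mono
          (by simp [Expr.cost]; omega)
      · have hW : W.length ≤ D := by
          rcases lastSome_spec (fun W => CheckOK M ψ (subsets A) W LE) id
            ((nextLists A)^[zeroRounds ψ Q LE] [((greedy M LE).map ψ).reverse]) with
            ⟨h1, -⟩ | ⟨W', hW', -, h1⟩
          · rw [zeroLabels, h1] at hz; cases hz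
          · rw [zeroLabels, h1] at hz; cases hz; exact hmemlen _ hW'
        rw [zeroAnswer, hz]
        exact comp_prune (by rw [f8 0 (by omega), e0'']) a8 (by rw [f8 7 (by omega), a7]) hW hE
          hSub hSubD
      · simp only [Expr.eval, a8, encO] at h
        cases h

/-! ### Correctness and running time of the algorithm for zero bases. -/

/-- The subgroup is a sum of cyclic groups, so the product of these groups maps onto it. -/
theorem card_closure_le [Finite Γ] (l : List Γ) :
    Nat.card (AddSubgroup.closure {g | g ∈ l}) ≤ (l.map addOrderOf).prod := by
  induction l with
  | nil => simp
  | cons g l ih =>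
    have hset : {x | x ∈ g :: l} = {g} ∪ {x | x ∈ l} := by ext; simp
    rw [hset, AddSubgroup.closure_union, ← AddSubgroup.zmultiples_eq_closure, List.map_cons,
      List.prod_cons, ← Nat.card_zmultiples]
    refine le_trans ?_ (Nat.mul_le_mul_left _ ih)
    rw [← Nat.card_prod]
    refine Nat.card_le_card_of_surjective (fun p : AddSubgroup.zmultiples g ×
      AddSubgroup.closure {x | x ∈ l} => ⟨p.1.1 + p.2.1, AddSubgroup.add_mem_sup p.1.2 p.2.2⟩) ?_
    rintro ⟨x, hx⟩
    obtain ⟨y, hy, z, hz, rfl⟩ := AddSubgroup.mem_sup.1 hx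
    exact ⟨(⟨y, hy⟩, ⟨z, hz⟩), rfl⟩

/-- All labels of bases lie in the subgroup `H` generated by the occurring labels. With F = H \ {0},
the F-avoiding bases are the zero bases and |F| + 1 = |H|. The bound is stated with the product of
orders because the program can compute it. -/
theorem exists_zero_base_near [Finite Γ] {q : ℕ} (hq : RepresentableGF q M) {LE : List α}
    (hE : {x | x ∈ LE} = M.E) {B₀ : Set α} (hB₀ : M.IsBase B₀)
    (h0 : label ψ B₀ = 0) {B : Set α} (hB : M.IsBase B) :
    ∃ B' : Set α, M.IsBase B' ∧ label ψ B' = 0 ∧ (B \ B').encard ≤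
      ((exchangeBound q ((distinctLabels ψ LE).map addOrderOf).prod - 1 : ℕ) : ℕ∞) := by
  classical
  have hfin : M.Finite := finite_of_list hE
  set H := AddSubgroup.closure {g | g ∈ distinctLabels ψ LE} with hH
  let F : Finset Γ := (Set.toFinite (H : Set Γ)).toFinset.erase 0
  have hFcard : F.card + 1 = Nat.card H := by
    rw [Finset.card_erase_add_one (by simp), ← Set.ncard_eq_toFinset_card]
    rfl
  obtain ⟨B', hB', hF, hnear⟩ := exists_avoiding_base_near_of_representableGF hfin hq F ψ
    ⟨B₀, hB₀, by simp [F, h0]⟩ B hB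
  refine ⟨B', hB', ?_, hnear.trans ?_⟩
  · have hmem : label ψ B' ∈ H := by
      have hBf : B'.Finite := hfin.ground_finite.subset hB'.subset_ground
      lift B' to Finset α using hBf
      rw [label_eq_sum]
      refine AddSubgroup.sum_mem _ fun x hx => AddSubgroup.subset_closure ?_
      have : x ∈ M.E := hB'.subset_ground hx
      rw [← hE] at this
      exact ((distinctLabels_spec ψ LE).2.1 _).2 ⟨x, this, rfl⟩
    by_contra hne
    exact hF (by simp [F, hne, hmem])
  · rw [hFcard]
    have := exchangeBound_mono q (card_closure_le (distinctLabels ψ LE))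
    exact_mod_cast Nat.sub_le_sub_right this 1

theorem isAnswer_zero [Finite Γ] {q Q : ℕ} {LE : List α} (hq : RepresentableGF q M)
    (hnd : LE.Nodup) (hE : {x | x ∈ LE} = M.E) (hQ : Q = (q + 1) ^ (4 * q ^ 4)) :
    IsAnswer M (fun B => label ψ B = 0) (encO .ofElts (zeroAnswer M ψ Q LE) : Tree α Γ) := by
  classical
  obtain ⟨hBnd, hB⟩ := greedy_isBase hnd hE
  have hfin : M.Finite := finite_of_list hE
  set A := distinctLabels ψ LE with hA
  have hAmem : ∀ e ∈ LE, ψ e ∈ A := fun e he => ((distinctLabels_spec ψ LE).2.1 _).2 ⟨e, he, rfl⟩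
  have hmemE : ∀ {X : Set α}, X ⊆ M.E → ∀ x ∈ X, x ∈ LE := fun hX x hx => by
    have : x ∈ M.E := hX hx
    rw [← hE] at this
    exact this
  have hW₀A : ∀ g ∈ ((greedy M LE).map ψ).reverse, g ∈ A := fun g hg => by
    obtain ⟨e, he, rfl⟩ := List.mem_map.1 (List.mem_reverse.1 hg)
    exact hAmem e (hmemE hB.subset_ground e he)
  -- The exponent in `exchangeBound q k` is linear in k, so the bound has the form 2 Q^k that the
  -- program evaluates. It is one more round than needed, which does no harm.
  have hround : exchangeBound q (A.map addOrderOf).prod = zeroRounds ψ Q LE := by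
    rw [zeroRounds, exchangeBound, hQ, ← pow_mul]
    congr 2
    ring
  rcases lastSome_spec (fun W => CheckOK M ψ (subsets A) W LE) id
    ((nextLists A)^[zeroRounds ψ Q LE] [((greedy M LE).map ψ).reverse]) with
    ⟨h1, h2⟩ | ⟨W, hW, hchk, h1⟩
  · left
    have hz : zeroLabels M ψ Q LE = none := h1
    refine ⟨by rw [zeroAnswer, hz]; rfl, fun B₀ hB₀ h0 => ?_⟩
    obtain ⟨B', hB', h0', hnear⟩ := exists_zero_base_near hq hE hB₀ h0 hB
    have hBf : B'.Finite := hfin.ground_finite.subset hB'.subset_ground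
    lift B' to Finset α using hBf
    have hcard : B'.card = (greedy M LE).length := by
      have := hB'.encard_eq_encard_of_isBase hB
      rw [encard_setOf_mem hBnd, encard_coe_eq_coe_finsetCard] at this
      exact_mod_cast this
    obtain ⟨W, hW, hWB⟩ := exists_mem_iterate_nextLists (A := A) (B'.val.map ψ)
      (fun g hg => by
        obtain ⟨x, hx, rfl⟩ := Multiset.mem_map.1 hg
        exact hAmem x (hmemE hB'.subset_ground x hx)) (zeroRounds ψ Q LE)
      [((greedy M LE).map ψ).reverse] ((greedy M LE).map ψ).reverse (by simp) hW₀A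
      (by simpa using hcard) (by
        rw [Multiset.coe_reverse]
        refine card_map_sub_le ψ hBnd (hnear.trans ?_)
        rw [← hA, hround]
        exact_mod_cast Nat.sub_le _ _)
    -- The labels of a near zero basis occur among the candidates, and the basis itself witnesses
    -- Rado's condition in the ground set; so the check could not have failed.
    refine h2 W hW ((checkOK_iff hnd hE.le hAmem
      (mem_of_mem_iterate_nextLists hW hW₀A)).2 ⟨?_, ?_⟩)
    · rw [← Multiset.sum_coe, hWB, ← h0', label_eq_sum]
      rfl
    · rw [hWB]
      exact (radoCond_of_indep hB'.indep).mono (hmemE hB'.subset_ground)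
  · right
    have hz : zeroLabels M ψ Q LE = some W := h1
    have hWA : ∀ g ∈ W, g ∈ A := mem_of_mem_iterate_nextLists hW hW₀A
    have hWlen : W.length = (greedy M LE).length := by
      rw [length_of_mem_iterate_nextLists hW]; simp
    have hiff : ∀ L' : List α, L'.Nodup → (∀ x ∈ L', x ∈ LE) → (CheckOK M ψ (subsets A) W L' ↔
        W.sum = 0 ∧ RadoCond M ψ (W : Multiset Γ) {x | x ∈ L'}) := fun L' hL' hsub =>
      checkOK_iff hL' (by rw [← hE]; exact hsub) (fun e he => hAmem e (hsub e he)) hWA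
    -- The pruned list is minimal with Rado's condition for `W`, hence independent with label
    -- multiset `W`. Replacements preserve lengths, so |W| is the rank and the list is a basis.
    obtain ⟨g1, g2, g3, g4⟩ := prune_spec (l := LE)
      (P := fun X => W.sum = 0 ∧ RadoCond M ψ (W : Multiset Γ) X) hnd
      (fun X Y hXY h => ⟨h.1, h.2.mono hXY⟩) hiff hchk
    set L := prune (CheckOK M ψ (subsets A) W) LE LE with hL
    obtain ⟨hsum, hrado⟩ := (hiff L g1 g2).1 g3
    have hLset : {x | x ∈ L} = (L.toFinset : Set α) := by ext; simp
    rw [hLset] at hrado g4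
    obtain ⟨k1, k2⟩ := indep_of_minimal_radoCond (M := M) (ψ := ψ) (W := (W : Multiset Γ))
      (E := L.toFinset) (by rw [← hLset, ← hE]; exact g2) hrado
      (fun e he hc => g4 e (g2 e (by simpa using he)) (by simpa using he) ⟨hsum, hc⟩)
    have hmap : ((L.map ψ : List Γ) : Multiset Γ) = W := by
      rw [← k2, List.toFinset_val, g1.dedup, Multiset.map_coe]
    refine ⟨L, g1, by rw [zeroAnswer, hz]; rfl, ?_, ?_⟩
    · refine isBase_of_length_le g1 hBnd (by rw [hLset]; exact k1) hB ?_
      have := congrArg Multiset.card hmap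
      simp at this
      omega
    · change label ψ _ = 0
      rw [label_setOf_mem ψ g1, ← Multiset.sum_coe, hmap, Multiset.sum_coe, hsum]

theorem polyBdd_zeroCost (Q : ℕ) : PolyBdd (zeroCost Q) := by
  have c := polyBdd_const
  have i := polyBdd_id
  have hmem : PolyBdd memCost := i.loopCost (c 8)
  have hgr : PolyBdd greedyCost := i.loopCost (c 9)
  have hlab : PolyBdd labelsCost := i.loopCost (c 5)
  have hdis : PolyBdd distinctCost := i.loopCost (hmem.add (c 15))
  have hfil : PolyBdd filterCost := i.loopCost (hmem.add (c 15))
  have hsum : PolyBdd sumCost := i.loopCost (c 6)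
  have hle : PolyBdd leCost := (i.loopCost (c 3)).add (c 8)
  have hsub : PolyBdd substCost := (i.loopCost (c 17)).add (c 5)
  have hrem : PolyBdd removeCost := i.loopCost (c 8)
  have hcand : PolyBdd candidatesCost :=
    i.loopCost (i.loopCost (i.loopCost (i.loopCost (hsub.add (c 6)))))
  have hadd : PolyBdd addCost := i.loopCost (c 4)
  have hord : PolyBdd ordersCost :=
    i.loopCost ((i.mul (hadd.add (c 20))).add (c 20))
  have hpow : PolyBdd (powCost Q) := i.loopCost (i.loopCost (c (2 * Q + 2)))
  have hsubs : PolyBdd subsetsCost := i.loopCost (i.loopCost (c 6))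
  have hrank : PolyBdd rankCost :=
    i.loopCost ((((hfil.add hfil).add hgr).add hle).add (c 16))
  have hchk : PolyBdd checkCost := (hsum.add hrank).add (c 14)
  have hsel : PolyBdd selectCost := i.loopCost (hchk.add (c 10))
  have hpr : PolyBdd pruneCost := (i.loopCost ((hrem.add hchk).add (c 12))).add (c 20)
  exact (((((((((hgr.add hlab).add hdis).add hord).add hpow).add hcand).add hsubs).add hsel).add
    hpr).add (c 30))

/-- A bound on all lengths that depend on the group only. -/
def groupBound (Q N : ℕ) : ℕ :=
  (N ^ 2 + 1) ^ (2 * Q ^ (N ^ N)) + 2 * Q ^ (N ^ N) + N ^ N + 2 ^ N + N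

theorem computable_groupBound (Q c d : ℕ) :
    Computable fun N => c * (groupBound Q N + 1) ^ d := by
  have pow : Primrec₂ (fun a b : ℕ => a ^ b) := Primrec₂.unpaired'.1 Nat.Primrec.pow
  have id' : Primrec fun N : ℕ => N := Primrec.id
  have hNN : Primrec fun N : ℕ => N ^ N := pow.comp id' id'
  have hR : Primrec fun N : ℕ => 2 * Q ^ (N ^ N) :=
    Primrec.nat_mul.comp (.const 2) (pow.comp (.const Q) hNN)
  have hV : Primrec fun N : ℕ => (N ^ 2 + 1) ^ (2 * Q ^ (N ^ N)) :=
    pow.comp (Primrec.succ.comp (pow.comp id' (.const 2))) hR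
  have hG : Primrec (groupBound Q) :=
    Primrec.nat_add.comp (Primrec.nat_add.comp (Primrec.nat_add.comp (Primrec.nat_add.comp hV hR)
      hNN) (pow.comp (.const 2) id')) id'
  exact (Primrec.nat_mul.comp (.const c) (pow.comp (Primrec.succ.comp hG) (.const d))).to_comp

/-- With N = |Γ| there are at most N distinct labels, so the product of their orders is at most N^N.
Every parameter other than n is then bounded by `groupBound Q N`. -/
theorem zeroBasisFPT (q : ℕ) : ZeroBasisFPT.{u, v} q := by
  obtain ⟨Q, hQ⟩ : ∃ Q, Q = (q + 1) ^ (4 * q ^ 4) := ⟨_, rfl⟩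
  have hQ0 : 0 < Q := by rw [hQ]; positivity
  obtain ⟨c, d, hcd⟩ := (polyBdd_zeroCost Q).add (polyBdd_const 2)
  refine ⟨zeroP Q, fun N => c * (groupBound Q N + 1) ^ d, d, computable_groupBound Q c d, ?_⟩
  intro α Γ _ _ M ψ LE hq hnd hE
  obtain ⟨N, hN⟩ : ∃ N, N = Nat.card Γ := ⟨_, rfl⟩
  have hN0 : 0 < N := hN ▸ Nat.card_pos
  obtain ⟨A, hA⟩ : ∃ A, A = distinctLabels ψ LE := ⟨_, rfl⟩
  have hAN : A.length ≤ N := by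
    have := Fintype.ofFinite Γ
    rw [hA, hN, Nat.card_eq_fintype_card]
    exact (distinctLabels_spec ψ LE).1.length_le_card
  have hprod : (A.map addOrderOf).prod ≤ N ^ A.length := by
    rw [hN]
    exact prod_addOrderOf_le A
  have hNA : N ^ A.length ≤ N ^ N := Nat.pow_le_pow_right hN0 hAN
  have h2A : 2 ^ A.length ≤ 2 ^ N := Nat.pow_le_pow_right (by omega) hAN
  have hR : zeroRounds ψ Q LE ≤ 2 * Q ^ (N ^ N) := by
    rw [zeroRounds, ← hA]
    exact Nat.mul_le_mul_left _ (Nat.pow_le_pow_right hQ0 (hprod.trans hNA))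
  have hV : (A.length ^ 2 + 1) ^ zeroRounds ψ Q LE ≤ (N ^ 2 + 1) ^ (2 * Q ^ (N ^ N)) :=
    (Nat.pow_le_pow_left (Nat.succ_le_succ (Nat.pow_le_pow_left hAN 2)) _).trans
      (Nat.pow_le_pow_right (by omega) hR)
  obtain ⟨G, hG⟩ : ∃ G, G = groupBound Q N := ⟨_, rfl⟩
  have hG' := hG
  unfold groupBound at hG'
  have h2N : 0 < 2 ^ N := Nat.two_pow_pos N
  obtain ⟨t, h1, h2⟩ := computes_zero (M := M) (ψ := ψ) (LE := LE) (Q := Q)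
    (D := LE.length + G) hQ0 (by omega) (by rw [← hA]; omega) (by rw [← hA, ← hN]; omega)
    (by rw [← hN]; omega) (by rw [← hA]; omega) (by omega) (by rw [← hA]; omega)
  refine ⟨t, _, h1, h2.trans ((hcd _).trans ?_), isAnswer_zero hq hnd hE hQ⟩
  change _ ≤ c * (groupBound Q (Nat.card Γ) + 1) ^ d * _
  rw [← hN, ← hG, mul_assoc, ← mul_pow]
  -- The inequality n + G + 1 ≤ (G + 1)(n + 1) separates the contribution of the group from that of
  -- the ground set.
  refine Nat.mul_le_mul_left _ (Nat.pow_le_pow_left ?_ _)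
  nlinarith

end ZeroBasis

end WeakOrder

end

theorem mainTheorem6 :
    (∃ f : ℕ → ℕ → ℕ, (∀ q k, 0 < f q k) ∧
      ∀ q : ℕ, IsPrimePow q → ∀ (α : Type u) (M : Matroid α), M.Finite →
        WeakOrder.RepresentableGF q M →
        (∀ k : ℕ, 0 < k → WeakOrder.WeaklyBaseOrderable M (f q k) k) ∧
        (∀ (Γ : Type v) [AddCommGroup Γ] (ψ : α → Γ) (F : Finset Γ),
          (∃ B : Set α, M.IsBase B ∧ WeakOrder.label ψ B ∉ F) →
          ∀ B : Set α, M.IsBase B → ∃ B' : Set α, M.IsBase B' ∧ WeakOrder.label ψ B' ∉ F ∧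
            (B \ B').encard ≤ ((f q (F.card + 1) - 1 : ℕ) : ℕ∞))) ∧
    (∀ q : ℕ, IsPrimePow q →
      (∀ m : ℕ, WeakOrder.AvoidingBasisPolyTime.{u, v} q m) ∧ WeakOrder.ZeroBasisFPT.{u, v} q) := by
  refine ⟨⟨WeakOrder.exchangeBound, WeakOrder.exchangeBound_pos, ?_⟩, ?_⟩
  · intro q _ α M hM hq
    exact ⟨fun k _ => WeakOrder.weaklyBaseOrderable_exchangeBound hM hq k,
      fun Γ _ ψ F hex B hB =>
        WeakOrder.exists_avoiding_base_near_of_representableGF hM hq F ψ hex B hB⟩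
  · intro q _
    exact ⟨WeakOrder.avoidingBasisPolyTime q, WeakOrder.zeroBasisFPT q⟩
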